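/- Let $S^1=\mathbb R/\mathbb Z$, $\mathbf e_k(x)=e^{2\pi i kx}$ and $\hat u(k)=\int_{S^1}u\,\overline{\mathbf e_k}\,dx$. For $q\in\mathbb R$ let $H^q(S^1)$ be the completion of $C^\infty(S^1,\mathbb C)$ for the norm $\|u\|_{H^q}=\big(\sum_{k\in\mathbb Z}(1+k^2)^q|\hat u(k)|^2\big)^{1/2}$, and let $H^q(S^1,\mathbb R)$ be its real subspace of real-valued elements. For $q>3/2$ let $\mathcal D^q(S^1)$ be the group of orientation-preserving $C^1$ diffeomorphisms $\varphi$ of $S^1$ such that $\varphi$ (and then also $\varphi^{-1}$) is of class $H^q$; that is, $\varphi$ lifts to $x\mapsto x+u(x)$ with $u\in H^q(S^1,\mathbb R)$ and $1+u'>0$. It is a smooth Hilbert manifold modelled on $H^q(S^1,\mathbb R)$: it carries the quotient topology of the open set $\{u\in H^q(S^1,\mathbb R): 1+u'>0\}$ under $u\mapsto\big(x\mapsto x+u(x) \bmod 1\big)$, and the local inverses of this map are its charts. For a homeomorphism $\varphi$ of $S^1$ write $R_\varphi v=v\circ\varphi$. **Theorem.** Let $r\ge 1$ and let $p:\mathbb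 R\to\mathbb C$ be a function such that, for some $C>0$, $|p(k)|\le C(1+k^2)^{r/2}$ for all $k\in\mathbb Z$. Let $P=\mathrm{op}(p(k))$ be the Fourier multiplier of order $r$ given by $\widehat{Pu}(k)=p(k)\hat u(k)$; it is bounded from $H^q(S^1)$ to $H^{q-r}(S^1)$ for every $q$. Suppose that for every integer $n\ge 1$ the function $f_n(\xi)=\xi^{n-1}p(\xi)$ is of class $C^{n-1}$ on $\mathbb R$, that $f_n^{(n-1)}$ is absolutely continuous on every compact interval, and that there is a constant $C_n>0$ such that $$|f_n^{(n)}(\xi)|\le C_n(1+\xi^2)^{(r-1)/2}\qquad\text{for almost every }\xi\in\mathbb R.$$ Then for every real $q>\tfrac32+r$ and every $\varphi\in\mathcal D^q(S^1)$ the operator $P_\varphi=R_\varphi\circ P\circ R_{\varphi^{-1}}$ is a well-defined bounded linear operator from $H^q(S^1)$ to $H^{q-r}(S^1)$, and the map $$\varphi\mapsto P_\varphi,\qquad \mathcal D^q(S^1)\to\mathcal L\big(H^q(S^1),H^{q-r}(S^1)\big)$$ is smooth (of class $C^\infty$ for the operator norm). -/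

import Mathlib

open scoped Manifold ContDiff ComplexConjugate

namespace CircleSobolev

noncomputable section

/-! ### The Sobolev spaces of the circle -/

/-- Families of Fourier coefficients `a : ℤ → ℂ` with `∑ₖ (1 + k²)^q |a k|² < ∞`. -/
def sobolevSubmodule (q : ℝ) : Submodule ℂ (ℤ → ℂ) where
  carrier := {a | Summable fun k : ℤ => (1 + (k : ℝ) ^ 2) ^ q * ‖a k‖ ^ 2}
  zero_mem' := by
    have h : (fun k : ℤ => (1 + (k : ℝ) ^ 2) ^ q * ‖(0 : ℤ → ℂ) k‖ ^ 2) = fun _ => 0 := by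
      funext k; simp
    rw [Set.mem_ofPred_eq, h]
    exact summable_zero
  add_mem' := by
    intro a b ha hb
    refine Summable.of_nonneg_of_le (fun k => by positivity) (fun k => ?_)
      ((Summable.add ha hb).mul_left 2)
    have h1 : ‖(a + b) k‖ ≤ ‖a k‖ + ‖b k‖ := norm_add_le _ _
    have h2 : ‖(a + b) k‖ ^ 2 ≤ 2 * (‖a k‖ ^ 2 + ‖b k‖ ^ 2) := by
      nlinarith [norm_nonneg ((a + b) k), norm_nonneg (a k), norm_nonneg (b k),
        sq_nonneg (‖a k‖ - ‖b k‖)]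
    have h3 : (0 : ℝ) ≤ (1 + (k : ℝ) ^ 2) ^ q := by positivity
    nlinarith [mul_le_mul_of_nonneg_left h2 h3]
  smul_mem' := by
    intro c a ha
    have h : (fun k : ℤ => (1 + (k : ℝ) ^ 2) ^ q * ‖(c • a) k‖ ^ 2)
        = fun k : ℤ => ‖c‖ ^ 2 * ((1 + (k : ℝ) ^ 2) ^ q * ‖a k‖ ^ 2) := by
      funext k; simp only [Pi.smul_apply, norm_smul]; ring
    rw [Set.mem_ofPred_eq, h]
    exact Summable.mul_left _ ha

/-- The complex Sobolev space `H^q(S¹)`, `S¹ = ℝ/ℤ`: the completion of the smooth functions for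
`‖u‖² = ∑ₖ (1 + k²)^q |û(k)|²`, realised through Fourier coefficients. -/
def Sob (q : ℝ) : Type := sobolevSubmodule q

instance (q : ℝ) : AddCommGroup (Sob q) := inferInstanceAs (AddCommGroup (sobolevSubmodule q))

instance (q : ℝ) : Module ℂ (Sob q) := inferInstanceAs (Module ℂ (sobolevSubmodule q))

/-- The `k`-th Fourier coefficient `û(k)`. -/
def Sob.coeff {q : ℝ} (u : Sob q) (k : ℤ) : ℂ := u.1 k

/-- The element of `H^q(S¹)` with prescribed Fourier coefficients. -/
def Sob.mk {q : ℝ} (a : ℤ → ℂ)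
    (ha : Summable fun k : ℤ => (1 + (k : ℝ) ^ 2) ^ q * ‖a k‖ ^ 2) : Sob q := ⟨a, ha⟩

theorem Sob.summable {q : ℝ} (u : Sob q) :
    Summable fun k : ℤ => (1 + (k : ℝ) ^ 2) ^ q * ‖u.coeff k‖ ^ 2 := u.2

theorem Sob.ext {q : ℝ} {u v : Sob q} (h : ∀ k, u.coeff k = v.coeff k) : u = v :=
  Subtype.ext (funext h)

@[simp] theorem Sob.coeff_mk {q : ℝ} (a : ℤ → ℂ)
    (ha : Summable fun k : ℤ => (1 + (k : ℝ) ^ 2) ^ q * ‖a k‖ ^ 2) (k : ℤ) :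
    (Sob.mk a ha).coeff k = a k := rfl

@[simp] theorem Sob.coeff_add {q : ℝ} (u v : Sob q) (k : ℤ) :
    (u + v).coeff k = u.coeff k + v.coeff k := rfl

@[simp] theorem Sob.coeff_sub {q : ℝ} (u v : Sob q) (k : ℤ) :
    (u - v).coeff k = u.coeff k - v.coeff k := rfl

@[simp] theorem Sob.coeff_neg {q : ℝ} (u : Sob q) (k : ℤ) :
    (-u).coeff k = -u.coeff k := rfl

@[simp] theorem Sob.coeff_zero {q : ℝ} (k : ℤ) : (0 : Sob q).coeff k = 0 := rfl

@[simp] theorem Sob.coeff_smul {q : ℝ} (c : ℂ) (u : Sob q) (k : ℤ) :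
    (c • u).coeff k = c * u.coeff k := rfl

theorem weight_sq (q : ℝ) (k : ℤ) :
    ((1 + (k : ℝ) ^ 2) ^ (q / 2)) ^ 2 = (1 + (k : ℝ) ^ 2) ^ q := by
  rw [← Real.rpow_natCast, ← Real.rpow_mul (by positivity)]
  norm_num

theorem weight_pos (q : ℝ) (k : ℤ) : 0 < (1 + (k : ℝ) ^ 2) ^ q := by positivity

theorem norm_weighted (q : ℝ) (k : ℤ) (z : ℂ) :
    ‖(((1 + (k : ℝ) ^ 2) ^ (q / 2) : ℝ) : ℂ) * z‖ ^ 2 = (1 + (k : ℝ) ^ 2) ^ q * ‖z‖ ^ 2 := by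
  rw [norm_mul, mul_pow, Complex.norm_real, Real.norm_of_nonneg (weight_pos _ _).le, weight_sq]

/-- The map `û(k) ↦ (1 + k²)^{q/2} û(k)` into `ℓ²(ℤ)`, which defines the norm. -/
def Sob.toL2 (q : ℝ) : Sob q →ₗ[ℂ] lp (fun _ : ℤ => ℂ) 2 where
  toFun u := ⟨fun k => (((1 + (k : ℝ) ^ 2) ^ (q / 2) : ℝ) : ℂ) * u.coeff k, by
    refine memℓp_gen ?_
    refine u.summable.congr fun k => ?_
    rw [← norm_weighted]
    norm_num⟩
  map_add' u v := by
    ext k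
    exact mul_add _ _ _
  map_smul' c u := by
    ext k
    simp [mul_left_comm]

theorem Sob.toL2_injective (q : ℝ) : Function.Injective (Sob.toL2 q) := by
  intro u v h
  refine Sob.ext fun k => ?_
  have h1 : (((1 + (k : ℝ) ^ 2) ^ (q / 2) : ℝ) : ℂ) * u.coeff k
      = (((1 + (k : ℝ) ^ 2) ^ (q / 2) : ℝ) : ℂ) * v.coeff k :=
    congrArg (fun w : lp (fun _ : ℤ => ℂ) 2 => w k) h
  exact mul_left_cancel₀ (Complex.ofReal_ne_zero.2 (weight_pos _ _).ne') h1

instance (q : ℝ) : NormedAddCommGroup (Sob q) :=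
  NormedAddCommGroup.induced (Sob q) (lp (fun _ : ℤ => ℂ) 2) (Sob.toL2 q) (Sob.toL2_injective q)

instance (q : ℝ) : NormedSpace ℂ (Sob q) :=
  NormedSpace.induced ℂ (Sob q) (lp (fun _ : ℤ => ℂ) 2) (Sob.toL2 q)

theorem Sob.norm_sq {q : ℝ} (u : Sob q) :
    ‖u‖ ^ 2 = ∑' k : ℤ, (1 + (k : ℝ) ^ 2) ^ q * ‖u.coeff k‖ ^ 2 := by
  have h : ‖Sob.toL2 q u‖ ^ (2 : ENNReal).toReal = _ := lp.norm_rpow_eq_tsum (by norm_num) _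
  have h2 : ‖u‖ = ‖Sob.toL2 q u‖ := rfl
  rw [h2]
  simp only [ENNReal.toReal_ofNat, Real.rpow_ofNat] at h
  rw [h]
  exact tsum_congr fun k => norm_weighted q k _

/-- The value at `x ∈ S¹` of the Fourier series `∑ₖ û(k) exp(2πikx)`; for `q > 1/2` this is the
continuous function represented by `u ∈ H^q(S¹)`. -/
def Sob.eval {q : ℝ} (u : Sob q) (x : UnitAddCircle) : ℂ :=
  ∑' k : ℤ, u.coeff k * fourier k x

/-! ### Fourier multipliers -/

/-- The symbol `p : ℤ → ℂ` is of order `r`. -/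
def HasOrder (p : ℤ → ℂ) (r : ℝ) : Prop :=
  ∃ C > 0, ∀ k : ℤ, ‖p k‖ ≤ C * (1 + (k : ℝ) ^ 2) ^ (r / 2)

theorem HasOrder.term_bound {p : ℤ → ℂ} {r C : ℝ}
    (hp : ∀ k : ℤ, ‖p k‖ ≤ C * (1 + (k : ℝ) ^ 2) ^ (r / 2)) (q : ℝ) (k : ℤ) (z : ℂ) :
    (1 + (k : ℝ) ^ 2) ^ (q - r) * ‖p k * z‖ ^ 2
      ≤ C ^ 2 * ((1 + (k : ℝ) ^ 2) ^ q * ‖z‖ ^ 2) := by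
  have h1 : ‖p k‖ ^ 2 ≤ C ^ 2 * (1 + (k : ℝ) ^ 2) ^ r := by
    rw [← weight_sq r k, ← mul_pow]
    exact pow_le_pow_left₀ (norm_nonneg _) (hp k) 2
  have h2 : (1 + (k : ℝ) ^ 2) ^ q = (1 + (k : ℝ) ^ 2) ^ (q - r) * (1 + (k : ℝ) ^ 2) ^ r := by
    rw [← Real.rpow_add (by positivity)]; simp
  rw [norm_mul, mul_pow, h2]
  have h3 := mul_le_mul_of_nonneg_left h1
    (mul_nonneg (weight_pos (q - r) k).le (sq_nonneg ‖z‖))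
  nlinarith [h3]

/-- The Fourier multiplier `op(p(k))` with symbol `p` of order `r`, `e_k ↦ p(k) e_k`, as a bounded
operator `H^q(S¹) → H^{q-r}(S¹)`. -/
def multiplier {p : ℤ → ℂ} {r : ℝ} (hp : HasOrder p r) (q : ℝ) : Sob q →L[ℂ] Sob (q - r) :=
  LinearMap.mkContinuousOfExistsBound
    { toFun := fun u => Sob.mk (fun k => p k * u.coeff k) (by
        obtain ⟨C, -, hC⟩ := hp
        exact Summable.of_nonneg_of_le (fun k => by positivity)
          (fun k => HasOrder.term_bound hC q k _) (u.summable.mul_left (C ^ 2)))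
      map_add' := fun u v => Sob.ext fun k => by simp [mul_add]
      map_smul' := fun c u => Sob.ext fun k => by simp [mul_left_comm] }
    (by
      obtain ⟨C, hC0, hC⟩ := hp
      refine ⟨C, fun u => ?_⟩
      refine le_of_sq_le_sq ?_ (by positivity)
      rw [mul_pow, Sob.norm_sq, Sob.norm_sq, ← tsum_mul_left]
      exact Summable.tsum_le_tsum (fun k => HasOrder.term_bound hC q k _)
        (Sob.summable _) (u.summable.mul_left (C ^ 2)))

theorem multiplier_coeff {p : ℤ → ℂ} {r : ℝ} (hp : HasOrder p r) (q : ℝ) (u : Sob q) (k : ℤ) :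
    (multiplier hp q u).coeff k = p k * u.coeff k := rfl

/-! ### Pointwise values and derivatives -/

theorem summable_weight {t : ℝ} (ht : 1 / 2 < t) :
    Summable fun k : ℤ => (1 + (k : ℝ) ^ 2) ^ (-t) := by
  have h : Summable fun k : ℤ => |(k : ℝ)| ^ (-(2 * t)) := by
    have h0 := Real.summable_abs_int_rpow (b := 2 * t) (by linarith)
    exact h0
  refine Summable.of_norm_bounded_eventually h ?_
  have hfin : {k : ℤ | k = 0}.Finite := by simp
  filter_upwards [hfin.compl_mem_cofinite] with k hk
  have hk0 : (k : ℝ) ≠ 0 := by exact_mod_cast hk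
  have hpos : 0 < |(k : ℝ)| := abs_pos.2 hk0
  rw [Real.norm_of_nonneg (weight_pos _ _).le]
  have e1 : |(k : ℝ)| ^ (-(2 * t)) = ((k : ℝ) ^ 2) ^ (-t) := by
    rw [← sq_abs, ← Real.rpow_natCast, ← Real.rpow_mul hpos.le]
    congr 1
    push_cast
    ring
  rw [e1]
  exact Real.rpow_le_rpow_of_nonpos (by positivity) (by linarith) (by linarith)

/-- Cauchy--Schwarz: for `q - s > 1/2` the sequence `(1 + k²)^{s/2} û(k)` is absolutely summable,
with sum controlled by the norm of `H^q`. -/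
theorem Sob.exists_l1_bound {q s : ℝ} (h : 1 / 2 < q - s) :
    ∃ C : ℝ, 0 ≤ C ∧ ∀ u : Sob q,
      Summable (fun k : ℤ => (1 + (k : ℝ) ^ 2) ^ (s / 2) * ‖u.coeff k‖) ∧
        ∑' k : ℤ, (1 + (k : ℝ) ^ 2) ^ (s / 2) * ‖u.coeff k‖ ≤ C * ‖u‖ := by
  refine ⟨(∑' k : ℤ, (1 + (k : ℝ) ^ 2) ^ (-(q - s))) ^ (1 / (2 : ℝ)), ?_, fun u => ?_⟩
  · exact Real.rpow_nonneg (tsum_nonneg fun k => (weight_pos _ _).le) _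
  have hA : ∀ k : ℤ, ((1 + (k : ℝ) ^ 2) ^ (-(q - s) / 2)) ^ (2 : ℝ)
      = (1 + (k : ℝ) ^ 2) ^ (-(q - s)) := fun k => by
    rw [Real.rpow_two, weight_sq]
  have hB : ∀ k : ℤ, ((1 + (k : ℝ) ^ 2) ^ (q / 2) * ‖u.coeff k‖) ^ (2 : ℝ)
      = (1 + (k : ℝ) ^ 2) ^ q * ‖u.coeff k‖ ^ 2 := fun k => by
    rw [Real.rpow_two, mul_pow, weight_sq]
  have hAB : ∀ k : ℤ, (1 + (k : ℝ) ^ 2) ^ (-(q - s) / 2) *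
      ((1 + (k : ℝ) ^ 2) ^ (q / 2) * ‖u.coeff k‖)
        = (1 + (k : ℝ) ^ 2) ^ (s / 2) * ‖u.coeff k‖ := fun k => by
    rw [← mul_assoc, ← Real.rpow_add (by positivity)]
    congr 2
    ring
  have key := Real.summable_and_inner_le_Lp_mul_Lq_tsum_of_nonneg
    (f := fun k : ℤ => (1 + (k : ℝ) ^ 2) ^ (-(q - s) / 2))
    (g := fun k : ℤ => (1 + (k : ℝ) ^ 2) ^ (q / 2) * ‖u.coeff k‖)
    Real.HolderConjugate.two_two (fun k => (weight_pos _ _).le)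
    (fun k => mul_nonneg (weight_pos _ _).le (norm_nonneg _))
    (by simp only [hA]; exact summable_weight h)
    (by simp only [hB]; exact u.summable)
  simp only [hA, hB, hAB, ← Sob.norm_sq] at key
  refine ⟨key.1, key.2.trans_eq ?_⟩
  rw [← Real.sqrt_eq_rpow (‖u‖ ^ 2), Real.sqrt_sq (norm_nonneg _)]

theorem Sob.summable_coeff {q : ℝ} (hq : 1 / 2 < q) (u : Sob q) :
    Summable fun k : ℤ => ‖u.coeff k‖ := by
  obtain ⟨C, -, hC⟩ := Sob.exists_l1_bound (q := q) (s := 0) (by linarith)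
  simpa using (hC u).1

theorem norm_fourier_apply (k : ℤ) (x : UnitAddCircle) : ‖(fourier k x : ℂ)‖ = 1 := by
  rw [fourier_apply]; exact Circle.norm_coe _

theorem Sob.summable_eval {q : ℝ} (hq : 1 / 2 < q) (u : Sob q) (x : UnitAddCircle) :
    Summable fun k : ℤ => u.coeff k * fourier k x := by
  refine Summable.of_norm ?_
  simpa [norm_mul, norm_fourier_apply, -fourier_apply] using u.summable_coeff hq

theorem Sob.eval_sub {q : ℝ} (hq : 1 / 2 < q) (u v : Sob q) (x : UnitAddCircle) :
    (u - v).eval x = u.eval x - v.eval x := by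
  unfold Sob.eval
  rw [← (u.summable_eval hq x).tsum_sub (v.summable_eval hq x)]
  exact tsum_congr fun k => by rw [Sob.coeff_sub]; ring

/-- The coefficients of `u` are the Fourier coefficients of the function it represents. -/
theorem Sob.fourierCoeff_eval {q : ℝ} (hq : 1 / 2 < q) (u : Sob q) (k : ℤ) :
    fourierCoeff u.eval k = u.coeff k := by
  have h1 : Summable fun j : ℤ => u.coeff j • (fourier j : C(UnitAddCircle, ℂ)) := by
    refine Summable.of_norm ?_
    simpa [norm_smul, fourier_norm] using u.summable_coeff hq
  have h2 : u.eval = ⇑(∑' j : ℤ, u.coeff j • (fourier j : C(UnitAddCircle, ℂ))) := by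
    funext x
    exact (ContinuousMap.hasSum_apply h1.hasSum x).tsum_eq
  let L : C(UnitAddCircle, ℂ) →L[ℂ] ℂ :=
    LinearMap.mkContinuous
      { toFun := fun f => fourierCoeff f k
        map_add' := fun f g => by
          have := fourierCoeff.add (f := f) (g := g)
            (f.continuous.integrable_of_hasCompactSupport
              (HasCompactSupport.of_compactSpace _))
            (g.continuous.integrable_of_hasCompactSupport
              (HasCompactSupport.of_compactSpace _))
          exact congrFun this k
        map_smul' := fun c f => fourierCoeff.const_smul _ c k } 1 (fun f => by
          show ‖fourierCoeff f k‖ ≤ 1 * ‖f‖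
          have h := MeasureTheory.norm_integral_le_of_norm_le_const
            (μ := AddCircle.haarAddCircle (T := (1 : ℝ)))
            (f := fun t : UnitAddCircle => (fourier (-k) t : ℂ) • f t) (C := ‖f‖)
            (Filter.Eventually.of_forall fun t => by
              rw [norm_smul, norm_fourier_apply, one_mul]; exact f.norm_coe_le_norm t)
          simpa [fourierCoeff] using h)
  have h3 := L.map_tsum h1
  have h4 : ∀ j : ℤ, L (u.coeff j • (fourier j : C(UnitAddCircle, ℂ)))
      = if j = k then u.coeff j else 0 := by
    intro j
    rw [map_smul]
    change u.coeff j • fourierCoeff (fourier j : C(UnitAddCircle, ℂ)) k = _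
    rw [fourierCoeff_fourier]
    by_cases hjk : j = k
    · subst hjk; simp
    · simp [hjk, Ne.symm hjk]
  rw [h2]
  change L _ = _
  rw [h3]
  simp only [h4]
  rw [tsum_ite_eq]

/-! ### Real Sobolev functions and lifts of circle maps -/

/-- The real-valued elements of `H^q(S¹)`, as a real subspace. -/
def realSubmodule (q : ℝ) : Submodule ℝ (Sob q) where
  carrier := {u | ∀ k, u.coeff (-k) = conj (u.coeff k)}
  zero_mem' := fun k => by simp
  add_mem' := fun {u v} hu hv k => by simp [hu k, hv k]
  smul_mem' := fun c u hu k => by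
    change (c : ℂ) * u.coeff (-k) = conj ((c : ℂ) * u.coeff k)
    simp [hu k]

/-- The real Hilbert space `H^q(S¹, ℝ)`. -/
abbrev RSob (q : ℝ) : Type := realSubmodule q

/-- The real function on the circle represented by `u ∈ H^q(S¹, ℝ)`, as a 1-periodic function. -/
def RSob.fn {q : ℝ} (u : RSob q) (x : ℝ) : ℝ := (u.1.eval (x : UnitAddCircle)).re

/-- The map `x ↦ x + u(x)` of the line. -/
def RSob.lift {q : ℝ} (u : RSob q) (x : ℝ) : ℝ := x + u.fn x

theorem RSob.coe_fn {q : ℝ} (u : RSob q) (x : ℝ) :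
    ((u.fn x : ℝ) : ℂ) = u.1.eval (x : UnitAddCircle) := by
  refine Complex.conj_eq_iff_re.1 ?_
  unfold Sob.eval
  rw [Complex.conj_tsum, ← (Equiv.neg ℤ).tsum_eq]
  refine tsum_congr fun k => ?_
  rw [map_mul, Equiv.neg_apply, u.2 k, fourier_neg, Complex.conj_conj, Complex.conj_conj]

theorem RSob.lift_add_one {q : ℝ} (u : RSob q) (x : ℝ) : u.lift (x + 1) = u.lift x + 1 := by
  have : ((x + 1 : ℝ) : UnitAddCircle) = (x : UnitAddCircle) := AddCircle.coe_add_period 1 x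
  unfold RSob.lift RSob.fn
  rw [this]
  ring

/-- The derivative of the function represented by `u`, by termwise differentiation. -/
def RSob.dfn {q : ℝ} (u : RSob q) (x : ℝ) : ℝ :=
  (∑' k : ℤ, u.1.coeff k * (2 * Real.pi * Complex.I * k / (1 : ℝ) * fourier k (x : UnitAddCircle))).re

theorem norm_deriv_term (k : ℤ) (z : ℂ) (x : UnitAddCircle) :
    ‖z * (2 * Real.pi * Complex.I * k / (1 : ℝ) * fourier k x)‖
      ≤ 2 * Real.pi * ((1 + (k : ℝ) ^ 2) ^ ((1 : ℝ) / 2) * ‖z‖) := by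
  have h : |(k : ℝ)| ≤ (1 + (k : ℝ) ^ 2) ^ ((1 : ℝ) / 2) := by
    rw [← Real.sqrt_eq_rpow]
    exact Real.abs_le_sqrt (by linarith)
  have e : ‖z * (2 * Real.pi * Complex.I * k / (1 : ℝ) * fourier k x)‖
      = 2 * Real.pi * (|(k : ℝ)| * ‖z‖) := by
    simp only [norm_mul, norm_div, norm_fourier_apply, Complex.norm_real, Complex.norm_I,
      Complex.norm_intCast, Complex.norm_ofNat, Real.norm_eq_abs, abs_of_pos Real.pi_pos]
    simp
    ring
  rw [e]
  gcongr

theorem RSob.summable_bound {q : ℝ} (hq : 3 / 2 < q) (u : RSob q) :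
    Summable fun k : ℤ => 2 * Real.pi * ((1 + (k : ℝ) ^ 2) ^ ((1 : ℝ) / 2) * ‖u.1.coeff k‖) := by
  obtain ⟨C, -, hC⟩ := Sob.exists_l1_bound (q := q) (s := 1) (by linarith)
  exact (hC u.1).1.mul_left _

theorem RSob.hasDerivAt_lift {q : ℝ} (hq : 3 / 2 < q) (u : RSob q) (x : ℝ) :
    HasDerivAt u.lift (1 + u.dfn x) x := by
  have h : HasDerivAt (fun y : ℝ => u.1.eval (y : UnitAddCircle)) _ x :=
    hasDerivAt_tsum (u.summable_bound hq)
      (fun k y => (hasDerivAt_fourier (1 : ℝ) k y).const_mul (u.1.coeff k))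
      (fun k y => norm_deriv_term k _ _)
      (u.1.summable_eval (by linarith) ((0 : ℝ) : UnitAddCircle)) x
  have h2 : HasDerivAt u.fn (u.dfn x) x := (Complex.reCLM.hasFDerivAt.comp_hasDerivAt x h)
  exact (hasDerivAt_id x).add h2

theorem RSob.continuous_dfn {q : ℝ} (hq : 3 / 2 < q) (u : RSob q) : Continuous u.dfn := by
  refine Complex.continuous_re.comp (continuous_tsum (fun k => ?_) (u.summable_bound hq)
    (fun k y => norm_deriv_term k _ _))
  have h1 : Continuous fun x : ℝ => (x : UnitAddCircle) := AddCircle.continuous_mk' 1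
  have h2 : Continuous fun x : ℝ => (fourier k (x : UnitAddCircle) : ℂ) :=
    (map_continuous (fourier k)).comp h1
  exact continuous_const.mul (continuous_const.mul h2)

theorem RSob.dfn_add_one {q : ℝ} (u : RSob q) (x : ℝ) : u.dfn (x + 1) = u.dfn x := by
  have : ((x + 1 : ℝ) : UnitAddCircle) = (x : UnitAddCircle) := AddCircle.coe_add_period 1 x
  unfold RSob.dfn
  rw [this]

theorem RSob.exists_dfn_bound {q : ℝ} (hq : 3 / 2 < q) :
    ∃ C : ℝ, 0 ≤ C ∧ ∀ (u v : RSob q) (x : ℝ), |u.dfn x - v.dfn x| ≤ C * ‖u - v‖ := by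
  obtain ⟨C, hC0, hC⟩ := Sob.exists_l1_bound (q := q) (s := 1) (by linarith)
  refine ⟨2 * Real.pi * C, by positivity, fun u v x => ?_⟩
  have hs : ∀ w : RSob q, Summable fun k : ℤ =>
      w.1.coeff k * (2 * Real.pi * Complex.I * k / (1 : ℝ) * fourier k (x : UnitAddCircle)) :=
    fun w => Summable.of_norm_bounded (w.summable_bound hq) fun k => norm_deriv_term k _ _
  have h1 : u.dfn x - v.dfn x = (u - v).dfn x := by
    unfold RSob.dfn
    rw [← Complex.sub_re, ← (hs u).tsum_sub (hs v)]
    congr 1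
    refine tsum_congr fun k => ?_
    rw [← sub_mul]
    rfl
  rw [h1]
  calc |(u - v).dfn x| ≤ ‖∑' k : ℤ, (u - v).1.coeff k *
          (2 * Real.pi * Complex.I * k / (1 : ℝ) * fourier k (x : UnitAddCircle))‖ :=
        Complex.abs_re_le_norm _
    _ ≤ ∑' k : ℤ, 2 * Real.pi * ((1 + (k : ℝ) ^ 2) ^ ((1 : ℝ) / 2) * ‖(u - v).1.coeff k‖) :=
        tsum_of_norm_bounded ((u - v).summable_bound hq).hasSum fun k => norm_deriv_term k _ _
    _ = 2 * Real.pi * ∑' k : ℤ, (1 + (k : ℝ) ^ 2) ^ ((1 : ℝ) / 2) * ‖(u - v).1.coeff k‖ :=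
        tsum_mul_left
    _ ≤ 2 * Real.pi * (C * ‖(u - v).1‖) := by
        have := (hC (u - v).1).2
        gcongr
    _ = 2 * Real.pi * C * ‖u - v‖ := by
        change 2 * Real.pi * (C * ‖u - v‖) = _
        ring

/-! ### The group `D^q(S¹)` and its manifold structure -/

/-- The `u ∈ H^q(S¹, ℝ)` for which `x ↦ x + u(x)` has positive derivative: the lifts to the line of
the elements of `D^q(S¹)`. -/
def diffLifts (q : ℝ) : Set (RSob q) := {u | ∀ x : ℝ, 0 < deriv u.lift x}

/-- `D^q(S¹)`, `q > 3/2`: the bijections `φ` of `S¹` which lift to `x ↦ x + u(x)` with `u` in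
`H^q(S¹, ℝ)` and with positive derivative, i.e. the orientation preserving `C¹` diffeomorphisms of
class `H^q` (the inverse of such a map is again of class `H^q`). -/
def DiffSob (q : ℝ) (_hq : 3 / 2 < q) : Type :=
  {φ : Equiv.Perm UnitAddCircle //
    ∃ u ∈ diffLifts q, ∀ x : ℝ, φ (x : UnitAddCircle) = ((u.lift x : ℝ) : UnitAddCircle)}

variable {q : ℝ}

instance (hq : 3 / 2 < q) : CoeFun (DiffSob q hq) fun _ => UnitAddCircle → UnitAddCircle :=
  ⟨fun φ => φ.1⟩

theorem DiffSob.ext {hq : 3 / 2 < q} {φ ψ : DiffSob q hq} (h : ∀ x, φ x = ψ x) : φ = ψ :=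
  Subtype.ext (Equiv.ext h)

theorem mem_diffLifts_iff (hq : 3 / 2 < q) (u : RSob q) :
    u ∈ diffLifts q ↔ ∀ x, 0 < 1 + u.dfn x :=
  forall_congr' fun x => by rw [(u.hasDerivAt_lift hq x).deriv]

theorem isOpen_diffLifts (hq : 3 / 2 < q) : IsOpen (diffLifts q) := by
  obtain ⟨C, hC0, hC⟩ := RSob.exists_dfn_bound (q := q) hq
  rw [Metric.isOpen_iff]
  intro u hu
  rw [mem_diffLifts_iff hq] at hu
  obtain ⟨x0, -, hx0⟩ := (isCompact_Icc (a := (0 : ℝ)) (b := 1)).exists_isMinOn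
    (Set.nonempty_Icc.2 zero_le_one) (u.continuous_dfn hq).continuousOn
  have hper : Function.Periodic u.dfn 1 := u.dfn_add_one
  have hmin : ∀ x, u.dfn x0 ≤ u.dfn x := fun x => by
    obtain ⟨y, hy, hxy⟩ := hper.exists_mem_Ico₀ zero_lt_one x
    rw [hxy]
    exact hx0 (Set.Ico_subset_Icc_self hy)
  have hm := hu x0
  refine ⟨(1 + u.dfn x0) / (C + 1), by positivity, fun v hv => ?_⟩
  rw [mem_diffLifts_iff hq]
  intro x
  rw [Metric.mem_ball, dist_eq_norm, lt_div_iff₀ (by positivity)] at hv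
  have h1 := (abs_le.1 (hC v u x)).1
  have h2 := hmin x
  have h3 := norm_nonneg (v - u)
  nlinarith

theorem continuous_lift (hq : 3 / 2 < q) (u : RSob q) : Continuous u.lift :=
  continuous_iff_continuousAt.2 fun x => (u.hasDerivAt_lift hq x).continuousAt

theorem coe_int_eq_zero (n : ℤ) : ((n : ℝ) : UnitAddCircle) = 0 :=
  (AddCircle.coe_eq_zero_iff (1 : ℝ)).2 ⟨n, by simp⟩

theorem coe_eq_coe_iff (x y : ℝ) :
    (x : UnitAddCircle) = (y : UnitAddCircle) ↔ ∃ n : ℤ, y = x + n := by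
  constructor
  · intro h
    have h1 : ((y - x : ℝ) : UnitAddCircle) = 0 := by
      rw [AddCircle.coe_sub, h, sub_self]
    obtain ⟨n, hn⟩ := (AddCircle.coe_eq_zero_iff (1 : ℝ)).1 h1
    refine ⟨n, ?_⟩
    rw [zsmul_eq_mul, mul_one] at hn
    linarith
  · rintro ⟨n, rfl⟩
    rw [AddCircle.coe_add, coe_int_eq_zero, add_zero]

theorem lift_add_int (u : RSob q) (x : ℝ) (n : ℤ) : u.lift (x + n) = u.lift x + n := by
  have h : ((x + n : ℝ) : UnitAddCircle) = (x : UnitAddCircle) := by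
    rw [AddCircle.coe_add, coe_int_eq_zero, add_zero]
  unfold RSob.lift RSob.fn
  rw [h]
  ring

/-- The circle map induced by `x ↦ x + u(x)`. -/
def circleMap (u : RSob q) : UnitAddCircle → UnitAddCircle :=
  Function.Periodic.lift (f := fun x : ℝ => ((u.lift x : ℝ) : UnitAddCircle)) (c := (1 : ℝ))
    fun x => by
      change ((u.lift (x + 1) : ℝ) : UnitAddCircle) = _
      rw [u.lift_add_one]
      exact AddCircle.coe_add_period 1 _

theorem circleMap_coe (u : RSob q) (x : ℝ) :
    circleMap u (x : UnitAddCircle) = ((u.lift x : ℝ) : UnitAddCircle) := rfl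

theorem circleMap_bijective (hq : 3 / 2 < q) {u : RSob q} (hu : u ∈ diffLifts q) :
    Function.Bijective (circleMap u) := by
  have hmono : StrictMono u.lift := strictMono_of_deriv_pos hu
  constructor
  · intro a b
    induction a using QuotientAddGroup.induction_on with | H x => ?_
    induction b using QuotientAddGroup.induction_on with | H y => ?_
    intro h
    obtain ⟨n, hn⟩ := (coe_eq_coe_iff _ _).1 h
    rw [← lift_add_int] at hn
    exact (coe_eq_coe_iff x y).2 ⟨n, hmono.injective hn⟩
  · intro b
    induction b using QuotientAddGroup.induction_on with | H y => ?_
    have h0 : u.lift (⌊y - u.lift 0⌋ : ℤ) ≤ y := by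
      have := lift_add_int u 0 ⌊y - u.lift 0⌋
      rw [zero_add] at this
      rw [this]
      linarith [Int.floor_le (y - u.lift 0)]
    have h1 : y ≤ u.lift ((⌊y - u.lift 0⌋ + 1 : ℤ)) := by
      have := lift_add_int u 0 (⌊y - u.lift 0⌋ + 1)
      rw [zero_add] at this
      rw [this]
      push_cast
      linarith [Int.lt_floor_add_one (y - u.lift 0)]
    have hle : ((⌊y - u.lift 0⌋ : ℤ) : ℝ) ≤ ((⌊y - u.lift 0⌋ + 1 : ℤ) : ℝ) := by
      push_cast; linarith
    obtain ⟨x, -, hx⟩ := intermediate_value_Icc hle (continuous_lift hq u).continuousOn ⟨h0, h1⟩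
    exact ⟨(x : UnitAddCircle), by rw [circleMap_coe, hx]⟩

/-- The diffeomorphism of the circle with lift `x ↦ x + u(x)`. -/
def diffOfLift (hq : 3 / 2 < q) (u : diffLifts q) : DiffSob q hq :=
  ⟨Equiv.ofBijective (circleMap u.1) (circleMap_bijective hq u.2), u.1, u.2, fun _ => rfl⟩

theorem diffOfLift_coe (hq : 3 / 2 < q) (u : diffLifts q) (x : ℝ) :
    diffOfLift hq u (x : UnitAddCircle) = ((u.1.lift x : ℝ) : UnitAddCircle) := rfl

theorem diffOfLift_surjective (hq : 3 / 2 < q) : Function.Surjective (diffOfLift (q := q) hq) := by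
  rintro ⟨φ, u, hu, h⟩
  refine ⟨⟨u, hu⟩, DiffSob.ext fun a => ?_⟩
  induction a using QuotientAddGroup.induction_on with | H x => ?_
  exact (h x).symm

/-- The topology of `D^q(S¹)`: the quotient topology from the open set of lifts in `H^q(S¹, ℝ)`. -/
instance (hq : 3 / 2 < q) : TopologicalSpace (DiffSob q hq) :=
  TopologicalSpace.coinduced (diffOfLift hq) inferInstance

theorem continuous_diffOfLift (hq : 3 / 2 < q) : Continuous (diffOfLift (q := q) hq) :=
  continuous_coinduced_rng

/-- The constant function `c` as an element of `H^q(S¹, ℝ)`. -/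
def constFn (q : ℝ) (c : ℝ) : RSob q :=
  ⟨Sob.mk (Pi.single 0 (c : ℂ)) (summable_of_ne_finset_zero (s := {0}) fun k hk => by
      have : k ≠ 0 := by simpa using hk
      simp [this]), fun k => by
    by_cases hk : k = 0
    · subst hk; simp
    · simp [hk]⟩

theorem coeff_constFn (c : ℝ) (k : ℤ) : (constFn q c).1.coeff k = if k = 0 then (c : ℂ) else 0 := by
  change (Pi.single 0 (c : ℂ) : ℤ → ℂ) k = _
  rw [Pi.single_apply]

theorem fn_constFn (c x : ℝ) : (constFn q c).fn x = c := by
  unfold RSob.fn Sob.eval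
  simp only [coeff_constFn, ite_mul, zero_mul]
  rw [tsum_ite_eq]
  simp

theorem lift_add_constFn (hq : 3 / 2 < q) (u : RSob q) (c x : ℝ) :
    (u + constFn q c).lift x = u.lift x + c := by
  have h := Sob.eval_sub (q := q) (by linarith) (u + constFn q c).1 (constFn q c).1
    (x : UnitAddCircle)
  have h1 : (u + constFn q c).1 - (constFn q c).1 = u.1 := by
    change (u.1 + (constFn q c).1) - (constFn q c).1 = u.1
    abel
  rw [h1] at h
  have h2 : u.fn x = (u + constFn q c).fn x - (constFn q c).fn x := by
    unfold RSob.fn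
    rw [h, Complex.sub_re]
  rw [fn_constFn] at h2
  unfold RSob.lift
  linarith

theorem eq_of_lift_eq (hq : 3 / 2 < q) {u v : RSob q} (h : ∀ x, u.lift x = v.lift x) : u = v := by
  refine Subtype.ext (Sob.ext fun k => ?_)
  rw [← Sob.fourierCoeff_eval (by linarith) u.1, ← Sob.fourierCoeff_eval (by linarith) v.1]
  congr 1
  funext a
  induction a using QuotientAddGroup.induction_on with | H x => ?_
  have h1 : u.fn x = v.fn x := by
    have := h x
    unfold RSob.lift at this
    linarith
  exact (u.coe_fn x).symm.trans ((congrArg Complex.ofReal h1).trans (v.coe_fn x))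

theorem add_constFn_mem (hq : 3 / 2 < q) {u : RSob q} (hu : u ∈ diffLifts q) (c : ℝ) :
    u + constFn q c ∈ diffLifts q := by
  intro x
  have h : (u + constFn q c).lift = fun x => u.lift x + c := funext (lift_add_constFn hq u c)
  rw [h, deriv_add_const]
  exact hu x

/-- Two lifts define the same diffeomorphism iff they differ by an integer constant. -/
theorem diffOfLift_eq_iff (hq : 3 / 2 < q) (u v : diffLifts q) :
    diffOfLift hq u = diffOfLift hq v ↔ ∃ n : ℤ, v.1 = u.1 + constFn q n := by
  constructor
  · intro h
    have h1 : ∀ x : ℝ, ∃ n : ℤ, v.1.lift x = u.1.lift x + n := fun x => by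
      rw [← coe_eq_coe_iff, ← diffOfLift_coe hq, ← diffOfLift_coe hq, h]
    choose n hn using h1
    have hcont : Continuous fun x : ℝ => ((n x : ℤ) : ℝ) := by
      have : (fun x : ℝ => ((n x : ℤ) : ℝ)) = fun x => v.1.lift x - u.1.lift x := by
        funext x; rw [hn x]; ring
      rw [this]
      exact (continuous_lift hq _).sub (continuous_lift hq _)
    have hcn : Continuous n := Int.isClosedEmbedding_coe_real.continuous_iff.2 hcont
    have hconst : ∀ x, n x = n 0 := fun x => PreconnectedSpace.constant inferInstance hcn
    refine ⟨n 0, eq_of_lift_eq hq fun x => ?_⟩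
    rw [lift_add_constFn hq, hn x, hconst x]
  · rintro ⟨n, hn⟩
    refine DiffSob.ext fun a => ?_
    induction a using QuotientAddGroup.induction_on with | H x => ?_
    change ((u.1.lift x : ℝ) : UnitAddCircle) = ((v.1.lift x : ℝ) : UnitAddCircle)
    rw [hn, lift_add_constFn hq, coe_eq_coe_iff]
    exact ⟨n, rfl⟩

theorem isOpenMap_diffOfLift (hq : 3 / 2 < q) : IsOpenMap (diffOfLift (q := q) hq) := by
  intro O hO
  rw [isOpen_coinduced]
  have h : diffOfLift hq ⁻¹' (diffOfLift hq '' O) = ⋃ n : ℤ,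
      (fun u : diffLifts q =>
        (⟨u.1 + constFn q n, add_constFn_mem hq u.2 n⟩ : diffLifts q)) ⁻¹' O := by
    ext u
    simp only [Set.mem_preimage, Set.mem_image, Set.mem_iUnion]
    constructor
    · rintro ⟨v, hv, hvu⟩
      obtain ⟨n, hn⟩ := (diffOfLift_eq_iff hq u v).1 hvu.symm
      refine ⟨n, ?_⟩
      convert hv using 1
      exact Subtype.ext hn.symm
    · rintro ⟨n, hn⟩
      exact ⟨_, hn, ((diffOfLift_eq_iff hq u _).2 ⟨n, rfl⟩).symm⟩
  rw [h]
  exact isOpen_iUnion fun n =>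
    hO.preimage ((continuous_subtype_val.add continuous_const).subtype_mk _)

/-- The mean `û(0)` of a real function. -/
def mean (u : RSob q) : ℝ := (u.1.coeff 0).re

theorem mean_add_constFn (u : RSob q) (c : ℝ) : mean (u + constFn q c) = mean u + c := by
  change (u.1.coeff 0 + (constFn q c).1.coeff 0).re = _
  rw [coeff_constFn]
  simp [mean]

theorem continuous_mean : Continuous (mean (q := q)) := by
  let L : RSob q →ₗ[ℝ] ℝ :=
    { toFun := mean
      map_add' := fun u v => by
        change (u.1.coeff 0 + v.1.coeff 0).re = _
        simp [mean]
      map_smul' := fun c u => by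
        change ((c : ℂ) * u.1.coeff 0).re = _
        simp [mean] }
  refine (L.mkContinuous 1 fun u => ?_).continuous
  have h1 : ‖u.1.coeff 0‖ ^ 2 ≤ ‖u.1‖ ^ 2 := by
    rw [Sob.norm_sq]
    have := u.1.summable.le_tsum 0 (fun k _ => by positivity)
    simpa using this
  rw [one_mul]
  calc ‖L u‖ ≤ ‖u.1.coeff 0‖ := Complex.abs_re_le_norm _
    _ ≤ ‖u.1‖ := le_of_sq_le_sq h1 (norm_nonneg _)

/-- The domain in `H^q(S¹, ℝ)` of the parametrisation of `D^q(S¹)` around the class of `u₀`. -/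
def paramDomain (u₀ : diffLifts q) : Set (diffLifts q) := {u | |mean u.1 - mean u₀.1| < 1 / 2}

theorem isOpen_paramDomain (u₀ : diffLifts q) : IsOpen (paramDomain u₀) :=
  isOpen_lt (((continuous_mean.comp continuous_subtype_val).sub continuous_const).abs)
    continuous_const

theorem injOn_paramDomain (hq : 3 / 2 < q) (u₀ : diffLifts q) :
    Set.InjOn (diffOfLift hq) (paramDomain u₀) := by
  intro u hu v hv h
  obtain ⟨n, hn⟩ := (diffOfLift_eq_iff hq u v).1 h
  have h1 : mean v.1 = mean u.1 + n := by rw [hn, mean_add_constFn]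
  have h2 : |(n : ℝ)| < 1 := by
    have hu' := abs_lt.1 (show |mean u.1 - mean u₀.1| < 1 / 2 from hu)
    have hv' := abs_lt.1 (show |mean v.1 - mean u₀.1| < 1 / 2 from hv)
    rw [abs_lt]
    constructor <;> linarith [hu'.1, hu'.2, hv'.1, hv'.2]
  have h3 : n = 0 := by
    have : |n| < 1 := by exact_mod_cast h2
    exact Int.abs_lt_one_iff.1 this
  refine Subtype.ext (eq_of_lift_eq hq fun x => ?_)
  rw [hn, lift_add_constFn hq, h3]
  simp

/-- The set of lifts as an open subset of `H^q(S¹, ℝ)`. -/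
def diffLiftsOpens (hq : 3 / 2 < q) : TopologicalSpace.Opens (RSob q) :=
  ⟨diffLifts q, isOpen_diffLifts hq⟩

/-- The local inverse of `u ↦ (x ↦ x + u(x) mod 1)` near the lift `u₀`: a chart of `D^q(S¹)` with
values in `H^q(S¹, ℝ)`. -/
def chart (hq : 3 / 2 < q) (u₀ : diffLifts q) : OpenPartialHomeomorph (DiffSob q hq) (RSob q) :=
  haveI : Nonempty (diffLifts q) := ⟨u₀⟩
  (OpenPartialHomeomorph.ofContinuousOpen ((injOn_paramDomain hq u₀).toPartialEquiv _ _)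
    (continuous_diffOfLift hq).continuousOn (isOpenMap_diffOfLift hq) (isOpen_paramDomain u₀)).symm
  ≫ₕ (diffLiftsOpens hq).openPartialHomeomorphSubtypeCoe ⟨u₀⟩

theorem mem_chart_source (hq : 3 / 2 < q) (u₀ : diffLifts q) :
    diffOfLift hq u₀ ∈ (chart hq u₀).source := by
  have h : u₀ ∈ paramDomain u₀ := by
    change |mean u₀.1 - mean u₀.1| < 1 / 2
    simp
  refine ⟨⟨u₀, h, rfl⟩, ?_⟩
  exact Set.mem_univ _

theorem chart_diffOfLift (hq : 3 / 2 < q) (u₀ : diffLifts q) {φ : DiffSob q hq}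
    (hφ : φ ∈ (chart hq u₀).source) :
    ∃ v : diffLifts q, v.1 = chart hq u₀ φ ∧ diffOfLift hq v = φ := by
  have : Nonempty (diffLifts q) := ⟨u₀⟩
  refine ⟨((injOn_paramDomain hq u₀).toPartialEquiv _ _).symm φ, rfl, ?_⟩
  exact ((injOn_paramDomain hq u₀).toPartialEquiv _ _).right_inv hφ.1

instance (hq : 3 / 2 < q) : ChartedSpace (RSob q) (DiffSob q hq) where
  atlas := Set.range (chart hq)
  chartAt φ := chart hq (diffOfLift_surjective hq φ).choose
  mem_chart_source φ := by
    have h := mem_chart_source hq (diffOfLift_surjective hq φ).choose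
    rwa [(diffOfLift_surjective hq φ).choose_spec] at h
  chart_mem_atlas φ := ⟨_, rfl⟩

instance (hq : 3 / 2 < q) : IsManifold 𝓘(ℝ, RSob q) ∞ (DiffSob q hq) := by
  refine isManifold_of_contDiffOn _ _ _ ?_
  rintro _ _ ⟨u₀, rfl⟩ ⟨u₁, rfl⟩
  have key : ContDiffOn ℝ ∞ ((chart hq u₀).symm ≫ₕ chart hq u₁)
      ((chart hq u₀).symm ≫ₕ chart hq u₁).source := by
    set T := (chart hq u₀).symm ≫ₕ chart hq u₁ with hT
    have hTn : ∀ b ∈ T.source, ∃ n : ℤ, T b = b + constFn q n := by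
      intro b hb
      have hb1 : b ∈ (chart hq u₀).target := hb.1
      have hb2 : (chart hq u₀).symm b ∈ (chart hq u₁).source := hb.2
      obtain ⟨v, hv, hv'⟩ := chart_diffOfLift hq u₀ ((chart hq u₀).map_target hb1)
      obtain ⟨w, hw, hw'⟩ := chart_diffOfLift hq u₁ hb2
      rw [(chart hq u₀).right_inv hb1] at hv
      obtain ⟨n, hn⟩ := (diffOfLift_eq_iff hq v w).1 (hv'.trans hw'.symm)
      refine ⟨n, ?_⟩
      have hTb : T b = chart hq u₁ ((chart hq u₀).symm b) := rfl
      rw [hTb, ← hw, hn, hv]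
    intro a ha
    obtain ⟨n, hn⟩ := hTn a ha
    have hcont : ContinuousAt (fun b => mean (T b) - mean b) a :=
      (continuous_mean.continuousAt.comp (T.continuousAt ha)).sub continuous_mean.continuousAt
    have hval : mean (T a) - mean a = n := by rw [hn, mean_add_constFn]; ring
    have hev : ∀ᶠ b in nhds a, T b = b + constFn q n := by
      have h1 := hcont.eventually (Metric.ball_mem_nhds _ one_pos)
      filter_upwards [h1, T.open_source.mem_nhds ha] with b hb hbs
      obtain ⟨m, hm⟩ := hTn b hbs
      have h2 : mean (T b) - mean b = m := by rw [hm, mean_add_constFn]; ring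
      simp only [h2, hval, Real.dist_eq] at hb
      have h3 : |m - n| < 1 := by exact_mod_cast hb
      have h4 : m = n := by have := Int.abs_lt_one_iff.1 h3; omega
      rw [hm, h4]
    have hsm : ContDiffAt ℝ ∞ (fun b : RSob q => b + constFn q n) a :=
      contDiffAt_id.add contDiffAt_const
    exact (hsm.congr_of_eventuallyEq hev).contDiffWithinAt
  simpa using key

/-! ### Conjugation by right translations -/

/-- `w = R_ψ u`, i.e. `w = u ∘ ψ` as functions on the circle. -/
def IsRightTranslate (ψ : Equiv.Perm UnitAddCircle) {s : ℝ} (u w : Sob s) : Prop :=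
  ∀ x : UnitAddCircle, w.eval x = u.eval (ψ x)

/-- `T = P_φ = R_φ ∘ P ∘ R_{φ⁻¹}`: for every `v` the function `w = v ∘ φ⁻¹` belongs to `H^q(S¹)`
and `T v = (P w) ∘ φ`. -/
def IsConjugate {s : ℝ} {hq : 3 / 2 < q} (P : Sob q →L[ℂ] Sob s) (φ : DiffSob q hq)
    (T : Sob q →L[ℂ] Sob s) : Prop :=
  ∀ v : Sob q, ∃ w : Sob q,
    IsRightTranslate φ.1.symm v w ∧ IsRightTranslate φ.1 (P w) (T v)

end

end CircleSobolev

/-! The constant p(0) commutes with every conjugation, and P - p(0) factors as B ∘ d/dx, where B has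
the symbol a(k) = (p(k) - p(0)) / (2πik) of order r - 1. For φ(x) = x + u(x), the change of
variables in the Fourier integral absorbs the derivative of φ: R_φ B (d/dx) R_{φ⁻¹} v (x) = ∑ₖ a(k)
∫ exp(2πik(x + u(x) - y - u(y))) v'(y) dy. Here u occurs only in an exponential. Differentiating in
a direction h multiplies the k-th kernel by 2πik (h(x) - h(y)). This is the commutator of
multiplication by h with the same kind of operator, of symbol 2πik a(k) (`hasDerivAt_conjOp`). The
n-th derivative is therefore an n-fold commutator of the operator with symbol a(k)(2πik)^n, applied
to v'.

Undoing the conjugation (`Dif.comms_rt`) turns it into R_φ [g₁, [g₂, … [gₙ, op(a(k)(2πik)^n)]]] w'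
with gⱼ = hⱼ ∘ φ⁻¹ and w = v ∘ φ⁻¹. The Fourier coefficients of such a commutator are controlled by
the n-th differences of the symbol (`afc_comms_le`). These are again of order r - 1, so the n powers
of k gained by differentiation are lost again, and the commutator is bounded into H^{q-r} by the H^q
norms of the gⱼ and the H^{q-1} norm of w' (`exists_sobN_comms_le`). The passage between φ and the
identity costs only locally uniform bounds of R_φ on H^{q-r} and of R_{φ⁻¹} on H^q
(`exists_local_rtBound`). They are direct in L² and H¹, follow by interpolation in between, and by
the chain rule and a product estimate above. For φ⁻¹ one also needs 1/φ' in H^{q-1}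
(`exists_reciprocal_bound`).

The hypothesis on p bounds the differences Δ^n(k^{n-1} p(k)). A discrete Leibniz rule trades factors
k for differences and gives Δ^j p(k) = O((1+|k|)^{r-j}) for j ≥ 1 (`symAt_of_diagonal`).

To avoid differentiating infinite sums, a is cut off to finitely supported symbols with uniform
symbol constants (`exists_symbols`). The operators are then finite sums, differentiable by
inspection, with all derivatives bounded uniformly in the cutoff. A coefficientwise limit keeps
these bounds, and the bound of order n + 2 makes the Taylor remainder of order n quadratic in
operator norm, so the limit is smooth (`exists_contDiffOn_limit`). The limit is P_φ - p(0);
uniqueness of the conjugate transfers smoothness from lifts to charts. -/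

namespace CircleSobolev

noncomputable section

open scoped ENNReal NNReal

/-! ### Weighted sequences with values in `[0, ∞]` -/

/-- The `ℓ²` norm of a sequence with values in `[0, ∞]`. -/
def l2 (α : ℤ → ℝ≥0∞) : ℝ≥0∞ := (∑' k, α k ^ 2) ^ (1 / 2 : ℝ)

theorem l2_sq (α : ℤ → ℝ≥0∞) : l2 α ^ 2 = ∑' k, α k ^ 2 := by
  rw [l2, ← ENNReal.rpow_natCast, ← ENNReal.rpow_mul]
  norm_num

theorem le_of_sq_le_sq_ennreal {a b : ℝ≥0∞} (h : a ^ 2 ≤ b ^ 2) : a ≤ b :=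
  (ENNReal.pow_le_pow_left_iff two_ne_zero).1 h

theorem l2_le_iff {α : ℤ → ℝ≥0∞} {C : ℝ≥0∞} :
    l2 α ≤ C ↔ ∀ K : Finset ℤ, ∑ k ∈ K, α k ^ 2 ≤ C ^ 2 := by
  rw [← ENNReal.pow_le_pow_left_iff two_ne_zero, l2_sq]
  constructor
  · intro h K
    exact (ENNReal.sum_le_tsum K).trans h
  · intro h
    rw [ENNReal.tsum_eq_iSup_sum]
    exact iSup_le h

theorem l2_mono {α β : ℤ → ℝ≥0∞} (h : ∀ k, α k ≤ β k) : l2 α ≤ l2 β :=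
  ENNReal.rpow_le_rpow (ENNReal.tsum_le_tsum fun k => pow_le_pow_left' (h k) 2) (by norm_num)

theorem le_l2 (α : ℤ → ℝ≥0∞) (k : ℤ) : α k ≤ l2 α := by
  refine le_of_sq_le_sq_ennreal ?_
  rw [l2_sq]
  exact ENNReal.le_tsum k

/-- Sums viewed as integrals for counting measure inherit the Minkowski and Hölder inequalities. -/
theorem l2_eq_lintegral (α : ℤ → ℝ≥0∞) :
    l2 α = (∫⁻ k, α k ^ (2 : ℝ) ∂MeasureTheory.Measure.count) ^ (1 / 2 : ℝ) := by
  rw [MeasureTheory.lintegral_count, l2]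
  simp

theorem l2_add_le (α β : ℤ → ℝ≥0∞) : l2 (fun k => α k + β k) ≤ l2 α + l2 β := by
  simp only [l2_eq_lintegral]
  exact ENNReal.lintegral_Lp_add_le (measurable_of_countable _).aemeasurable
    (measurable_of_countable _).aemeasurable (by norm_num)

theorem tsum_mul_le_l2 (α β : ℤ → ℝ≥0∞) : ∑' k, α k * β k ≤ l2 α * l2 β := by
  simp only [l2_eq_lintegral]
  rw [← MeasureTheory.lintegral_count]
  exact ENNReal.lintegral_mul_le_Lp_mul_Lq _ Real.HolderConjugate.two_two
    (measurable_of_countable _).aemeasurable (measurable_of_countable _).aemeasurable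

theorem l2_zero : l2 (fun _ => 0) = 0 := by simp [l2]

theorem l2_const_mul (c : ℝ≥0∞) (α : ℤ → ℝ≥0∞) : l2 (fun k => c * α k) = c * l2 α := by
  have h : l2 (fun k => c * α k) ^ 2 = (c * l2 α) ^ 2 := by
    rw [mul_pow, l2_sq, l2_sq, ← ENNReal.tsum_mul_left]
    exact tsum_congr fun k => mul_pow _ _ _
  exact le_antisymm (le_of_sq_le_sq_ennreal h.le) (le_of_sq_le_sq_ennreal h.ge)

theorem l2_shift (α : ℤ → ℝ≥0∞) (i : ℤ) : l2 (fun k => α (k - i)) = l2 α := by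
  unfold l2
  congr 1
  exact (Equiv.subRight i).tsum_eq fun k => α k ^ 2

theorem l2_finset_sum_le {ι : Type*} (s : Finset ι) (F : ι → ℤ → ℝ≥0∞) :
    l2 (fun k => ∑ i ∈ s, F i k) ≤ ∑ i ∈ s, l2 (F i) := by
  classical
  induction s using Finset.induction_on with
  | empty => simp [l2_zero]
  | insert a s ha ih =>
    simp only [Finset.sum_insert ha]
    exact (l2_add_le _ _).trans (by gcongr)

/-- Fatou's lemma for the `ℓ²` norm. -/
theorem l2_le_of_tendsto {ι : Type*} {L : Filter ι} [L.NeBot] {F : ι → ℤ → ℝ≥0∞}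
    {α : ℤ → ℝ≥0∞} {C : ℝ≥0∞} (h : ∀ k, Filter.Tendsto (fun n => F n k) L (nhds (α k)))
    (hC : ∀ᶠ n in L, l2 (F n) ≤ C) : l2 α ≤ C := by
  rw [l2_le_iff]
  intro K
  refine le_of_tendsto (tendsto_finsetSum K fun k _ => ENNReal.Tendsto.pow (n := 2) (h k)) ?_
  filter_upwards [hC] with n hn
  exact l2_le_iff.1 hn K

theorem l2_tsum_le {ι : Type*} (F : ι → ℤ → ℝ≥0∞) :
    l2 (fun k => ∑' i, F i k) ≤ ∑' i, l2 (F i) := by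
  refine l2_le_of_tendsto (L := Filter.atTop) (F := fun (s : Finset ι) k => ∑ i ∈ s, F i k)
    (fun k => ENNReal.summable.hasSum) (Filter.Eventually.of_forall fun s => ?_)
  exact (l2_finset_sum_le s F).trans (ENNReal.sum_le_tsum s)

/-- Convolution of sequences. -/
def conv (α β : ℤ → ℝ≥0∞) (k : ℤ) : ℝ≥0∞ := ∑' i, α i * β (k - i)

/-- Young's inequality: a convolution is a superposition of translates, each with the same ℓ² norm.
-/
theorem l2_conv_le (α β : ℤ → ℝ≥0∞) : l2 (conv α β) ≤ (∑' i, α i) * l2 β := by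
  refine (l2_tsum_le fun i k => α i * β (k - i)).trans ?_
  simp only [l2_const_mul, l2_shift, ENNReal.tsum_mul_right]
  exact le_rfl

theorem conv_comm (α β : ℤ → ℝ≥0∞) : conv α β = conv β α := by
  funext k
  unfold conv
  rw [← (Equiv.subLeft k).tsum_eq]
  refine tsum_congr fun i => ?_
  simp [mul_comm]

theorem tsum_conv (α β : ℤ → ℝ≥0∞) : ∑' k, conv α β k = (∑' i, α i) * ∑' i, β i := by
  unfold conv
  rw [ENNReal.tsum_comm, ← ENNReal.tsum_mul_right]
  refine tsum_congr fun i => ?_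
  rw [ENNReal.tsum_mul_left]
  congr 1
  exact (Equiv.subRight i).tsum_eq β

theorem l2_conv_le' (α β : ℤ → ℝ≥0∞) : l2 (conv α β) ≤ l2 α * ∑' i, β i := by
  rw [conv_comm, mul_comm]
  exact l2_conv_le β α

/-! ### Sobolev weights, the embedding into ℓ¹, and the product estimate. -/

/-- The Sobolev weight `(1 + k²)^{s/2}`. -/
def wt (s : ℝ) (k : ℤ) : ℝ≥0∞ := ENNReal.ofReal ((1 + (k : ℝ) ^ 2) ^ (s / 2))

theorem wt_ne_top (s : ℝ) (k : ℤ) : wt s k ≠ ⊤ := ENNReal.ofReal_ne_top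

theorem wt_ne_zero (s : ℝ) (k : ℤ) : wt s k ≠ 0 :=
  (ENNReal.ofReal_pos.2 (weight_pos _ _)).ne'

theorem wt_add (s t : ℝ) (k : ℤ) : wt (s + t) k = wt s k * wt t k := by
  unfold wt
  rw [← ENNReal.ofReal_mul (weight_pos _ _).le, ← Real.rpow_add (by positivity), add_div]

theorem wt_zero (k : ℤ) : wt 0 k = 1 := by simp [wt]

theorem wt_mono {s t : ℝ} (h : s ≤ t) (k : ℤ) : wt s k ≤ wt t k :=
  ENNReal.ofReal_le_ofReal
    (Real.rpow_le_rpow_of_exponent_le (by nlinarith [sq_nonneg (k : ℝ)]) (by linarith))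

theorem wt_at_zero (s : ℝ) : wt s 0 = 1 := by simp [wt]

theorem one_le_wt {s : ℝ} (h : 0 ≤ s) (k : ℤ) : 1 ≤ wt s k := by
  rw [← wt_zero k]
  exact wt_mono h k

theorem wt_sq (s : ℝ) (k : ℤ) : wt s k ^ 2 = wt (2 * s) k := by
  rw [sq, ← wt_add, two_mul]

theorem wt_le_of_abs_le {s : ℝ} (hs : 0 ≤ s) {i k : ℤ} (h : |(k : ℝ)| ≤ 2 * |(i : ℝ)|) :
    wt s k ≤ 2 ^ s * wt s i := by
  have h2 : (2 : ℝ≥0∞) ^ s = ENNReal.ofReal (2 ^ s) := by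
    rw [← ENNReal.ofReal_rpow_of_pos two_pos]
    simp
  unfold wt
  rw [h2, ← ENNReal.ofReal_mul (by positivity)]
  refine ENNReal.ofReal_le_ofReal ?_
  have h4 : (2 : ℝ) ^ s = 4 ^ (s / 2) := by
    rw [show (4 : ℝ) = 2 ^ (2 : ℝ) by norm_num, ← Real.rpow_mul (by norm_num)]
    congr 1
    ring
  rw [h4, ← Real.mul_rpow (by norm_num) (by positivity)]
  refine Real.rpow_le_rpow (by positivity) ?_ (by positivity)
  have := sq_le_sq' (by linarith [abs_nonneg (k : ℝ), abs_nonneg (i : ℝ)]) h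
  rw [mul_pow, sq_abs, sq_abs] at this
  linarith

theorem wt_le_of_abs_le_abs {s : ℝ} (hs : s ≤ 0) {i k : ℤ} (h : |(i : ℝ)| ≤ |(k : ℝ)|) :
    wt s k ≤ wt s i := by
  refine ENNReal.ofReal_le_ofReal ?_
  refine Real.rpow_le_rpow_of_nonpos (by positivity) ?_ (by linarith)
  have := sq_le_sq.2 h
  linarith

/-- The weighted `ℓ²` norm. -/
def wl2 (s : ℝ) (α : ℤ → ℝ≥0∞) : ℝ≥0∞ := l2 fun k => wt s k * α k

theorem wl2_mono {s : ℝ} {α β : ℤ → ℝ≥0∞} (h : ∀ k, α k ≤ β k) : wl2 s α ≤ wl2 s β :=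
  l2_mono fun k => by gcongr; exact h k

theorem wl2_mono_left {s t : ℝ} (h : s ≤ t) (α : ℤ → ℝ≥0∞) : wl2 s α ≤ wl2 t α :=
  l2_mono fun k => by gcongr; exact wt_mono h k

theorem wl2_const_mul (s : ℝ) (c : ℝ≥0∞) (α : ℤ → ℝ≥0∞) :
    wl2 s (fun k => c * α k) = c * wl2 s α := by
  unfold wl2
  rw [← l2_const_mul]
  congr 1
  funext k
  ring

theorem wl2_add_le (s : ℝ) (α β : ℤ → ℝ≥0∞) :
    wl2 s (fun k => α k + β k) ≤ wl2 s α + wl2 s β := by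
  refine le_trans (le_of_eq ?_) (l2_add_le _ _)
  unfold wl2
  congr 1
  funext k
  ring

theorem wl2_le_of_tendsto {ι : Type*} {L : Filter ι} [L.NeBot] {s : ℝ} {F : ι → ℤ → ℝ≥0∞}
    {α : ℤ → ℝ≥0∞} {C : ℝ≥0∞} (h : ∀ k, Filter.Tendsto (fun n => F n k) L (nhds (α k)))
    (hC : ∀ᶠ n in L, wl2 s (F n) ≤ C) : wl2 s α ≤ C :=
  l2_le_of_tendsto (F := fun n k => wt s k * F n k)
    (fun k => ENNReal.Tendsto.const_mul (h k) (Or.inr (wt_ne_top s k))) hC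

/-- The constant in the embedding of `H^a` into the sequences with summable coefficients. -/
def embC (a : ℝ) : ℝ≥0∞ := l2 (wt (-a))

theorem embC_ne_top {a : ℝ} (ha : 1 / 2 < a) : embC a ≠ ⊤ := by
  refine ENNReal.rpow_ne_top_of_nonneg (by norm_num) ?_
  have h := summable_weight ha
  have h1 : ∀ k : ℤ, wt (-a) k ^ 2 = ENNReal.ofReal ((1 + (k : ℝ) ^ 2) ^ (-a)) := fun k => by
    rw [wt_sq, wt]
    congr 2
    ring
  simp only [h1]
  rw [← ENNReal.ofReal_tsum_of_nonneg (fun k => (weight_pos _ _).le) h]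
  exact ENNReal.ofReal_ne_top

theorem tsum_wt_le (a s : ℝ) (α : ℤ → ℝ≥0∞) :
    ∑' k, wt s k * α k ≤ embC a * wl2 (s + a) α := by
  refine le_trans (le_of_eq ?_) (tsum_mul_le_l2 _ _)
  refine tsum_congr fun k => ?_
  rw [← mul_assoc, ← wt_add]
  congr 2
  ring

theorem tsum_le_wl2 (a : ℝ) (α : ℤ → ℝ≥0∞) : ∑' k, α k ≤ embC a * wl2 a α := by
  have := tsum_wt_le a 0 α
  simpa [wt_zero] using this

/-- The constant in the product estimate `H^s · H^a ⊆ H^s`. -/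
def prodC (s a : ℝ) : ℝ≥0∞ := 2 ^ s * (2 * embC a)

theorem prodC_ne_top {s a : ℝ} (hs : 0 ≤ s) (ha : 1 / 2 < a) : prodC s a ≠ ⊤ := by
  unfold prodC
  exact ENNReal.mul_ne_top (ENNReal.rpow_ne_top_of_nonneg hs (by simp))
    (ENNReal.mul_ne_top (by simp) (embC_ne_top ha))

/-- The larger of the two frequencies i and k - i is comparable to k or exceeds it, so it can carry
the weight. If it is i, the other factor is summed in ℓ¹. If it is k - i, its weight is split as s =
(s - a) + a; since s ≤ a, the part s - a is largest at the smaller frequency and moves to i, where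
it makes α summable. -/
theorem wl2_conv_le {s a : ℝ} (hs : 0 ≤ s) (hsa : s ≤ a) (α β : ℤ → ℝ≥0∞) :
    wl2 s (conv α β) ≤ prodC s a * (wl2 s α * wl2 a β) := by
  set α1 : ℤ → ℝ≥0∞ := fun k => wt s k * α k with hα1
  set α2 : ℤ → ℝ≥0∞ := fun k => wt (s - a) k * α k with hα2
  set β1 : ℤ → ℝ≥0∞ := fun k => wt a k * β k with hβ1
  have key : ∀ k, wt s k * conv α β k ≤ 2 ^ s * (conv α1 β k + conv α2 β1 k) := by
    intro k
    unfold conv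
    rw [← ENNReal.tsum_mul_left, ← ENNReal.tsum_add, ← ENNReal.tsum_mul_left]
    refine ENNReal.tsum_le_tsum fun i => ?_
    rcases le_total |((k - i : ℤ) : ℝ)| |(i : ℝ)| with h | h
    · have h1 : |(k : ℝ)| ≤ 2 * |(i : ℝ)| := by
        have := abs_add_le ((k - i : ℤ) : ℝ) (i : ℝ)
        push_cast at this h ⊢
        rw [sub_add_cancel] at this
        linarith
      calc wt s k * (α i * β (k - i)) ≤ (2 ^ s * wt s i) * (α i * β (k - i)) := by
            gcongr; exact wt_le_of_abs_le hs h1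
        _ = 2 ^ s * (α1 i * β (k - i)) := by rw [hα1]; ring
        _ ≤ _ := by gcongr; exact le_self_add
    · have h1 : |(k : ℝ)| ≤ 2 * |((k - i : ℤ) : ℝ)| := by
        have := abs_add_le ((k - i : ℤ) : ℝ) (i : ℝ)
        push_cast at this h ⊢
        rw [sub_add_cancel] at this
        linarith
      have h2 : wt s (k - i) = wt (s - a) (k - i) * wt a (k - i) := by
        rw [← wt_add]; congr 1; ring
      have h3 : wt (s - a) (k - i) ≤ wt (s - a) i := wt_le_of_abs_le_abs (by linarith) h
      calc wt s k * (α i * β (k - i)) ≤ (2 ^ s * wt s (k - i)) * (α i * β (k - i)) := by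
            gcongr; exact wt_le_of_abs_le hs h1
        _ ≤ (2 ^ s * (wt (s - a) i * wt a (k - i))) * (α i * β (k - i)) := by
            rw [h2]; gcongr
        _ = 2 ^ s * (α2 i * β1 (k - i)) := by rw [hα2, hβ1]; ring
        _ ≤ _ := by gcongr; exact le_add_self
  have e1 : l2 (conv α1 β) ≤ wl2 s α * (embC a * wl2 a β) :=
    (l2_conv_le' _ _).trans (by gcongr; exacts [le_rfl, tsum_le_wl2 a β])
  have e2 : l2 (conv α2 β1) ≤ (embC a * wl2 s α) * wl2 a β := by
    refine (l2_conv_le _ _).trans ?_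
    gcongr
    · have := tsum_wt_le a (s - a) α
      rwa [sub_add_cancel] at this
    · exact le_rfl
  calc wl2 s (conv α β) ≤ l2 (fun k => 2 ^ s * (conv α1 β k + conv α2 β1 k)) := l2_mono key
    _ = 2 ^ s * l2 (fun k => conv α1 β k + conv α2 β1 k) := l2_const_mul _ _
    _ ≤ 2 ^ s * (wl2 s α * (embC a * wl2 a β) + (embC a * wl2 s α) * wl2 a β) := by
        gcongr
        exact (l2_add_le _ _).trans (add_le_add e1 e2)
    _ = prodC s a * (wl2 s α * wl2 a β) := by unfold prodC; ring

end

end CircleSobolev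

/-! ### Sobolev norms, products and derivatives of continuous functions on the circle. -/

namespace CircleSobolev

noncomputable section

open scoped ENNReal NNReal

open AddCircle (haarAddCircle)

/-! ### Fourier coefficients of continuous functions -/

/-- The algebra of continuous complex functions on the circle. -/
abbrev CT : Type := C(UnitAddCircle, ℂ)

theorem integrable_circle {E : Type*} [NormedAddCommGroup E] {f : UnitAddCircle → E}
    (hf : Continuous f) : MeasureTheory.Integrable f (haarAddCircle (T := (1 : ℝ))) :=
  hf.integrable_of_hasCompactSupport (HasCompactSupport.of_compactSpace _)

theorem integral_circle_eq (f : UnitAddCircle → ℂ) (a : ℝ) :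
    ∫ x, f x ∂haarAddCircle = ∫ x in a..a + 1, f (x : UnitAddCircle) := by
  have h := fourierCoeff_eq_intervalIntegral f 0 a
  simpa [fourierCoeff] using h

/-- The mean of a continuous function on the circle. -/
def circleInt : CT →L[ℂ] ℂ :=
  LinearMap.mkContinuous
    { toFun := fun f => ∫ x, f x ∂haarAddCircle
      map_add' := fun f g => MeasureTheory.integral_add (integrable_circle f.continuous)
        (integrable_circle g.continuous)
      map_smul' := fun c f => MeasureTheory.integral_smul c _ } 1 (fun f => by
        have h := MeasureTheory.norm_integral_le_of_norm_le_const
          (μ := haarAddCircle (T := (1 : ℝ))) (f := f) (C := ‖f‖)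
          (Filter.Eventually.of_forall fun t => f.norm_coe_le_norm t)
        simpa using h)

theorem circleInt_apply (f : CT) : circleInt f = ∫ x, f x ∂haarAddCircle := rfl

/-- The exponential `e_k`. -/
abbrev expo (k : ℤ) : CT := fourier k

theorem expo_add (j k : ℤ) : expo (j + k) = expo j * expo k := by
  ext x
  exact fourier_add

theorem expo_zero : expo 0 = 1 := by
  ext x
  exact fourier_zero

theorem norm_expo (k : ℤ) : ‖expo k‖ = 1 := fourier_norm k

theorem norm_expo_apply (k : ℤ) (x : UnitAddCircle) : ‖expo k x‖ = 1 := norm_fourier_apply k x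

/-- The `k`-th Fourier coefficient. -/
def fc (k : ℤ) : CT →L[ℂ] ℂ := circleInt.comp (ContinuousLinearMap.mul ℂ CT (expo (-k)))

theorem fc_apply (k : ℤ) (f : CT) : fc k f = circleInt (expo (-k) * f) := rfl

theorem fc_eq_fourierCoeff (k : ℤ) (f : CT) : fc k f = fourierCoeff f k := rfl

theorem fc_expo (k j : ℤ) : fc k (expo j) = if j = k then 1 else 0 := by
  rw [fc_eq_fourierCoeff, fourierCoeff_fourier, Pi.single_apply]
  simp [eq_comm]

theorem fc_expo_mul (k j : ℤ) (f : CT) : fc k (expo j * f) = fc (k - j) f := by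
  rw [fc_apply, fc_apply, ← mul_assoc, ← expo_add]
  congr 3
  ring

/-- The sequence of the absolute values of the Fourier coefficients. -/
def afc (f : CT) (k : ℤ) : ℝ≥0∞ := ‖fc k f‖ₑ

theorem summable_fc {f : CT} (h : ∑' k, afc f k ≠ ⊤) : Summable fun k => ‖fc k f‖ := by
  have h1 : Summable fun k => ‖fc k f‖₊ := by
    rw [← ENNReal.tsum_coe_ne_top_iff_summable]
    exact h
  exact NNReal.summable_coe.2 h1

theorem hasSum_fc {f : CT} (h : ∑' k, afc f k ≠ ⊤) : HasSum (fun k => fc k f • expo k) f :=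
  hasSum_fourier_series_of_summable (summable_fc h).of_norm

theorem hasSum_map_fc {E : Type*} [NormedAddCommGroup E] [NormedSpace ℂ E] (L : CT →L[ℂ] E)
    {f : CT} (h : ∑' k, afc f k ≠ ⊤) : HasSum (fun k => fc k f • L (expo k)) (L f) := by
  have := L.hasSum (hasSum_fc h)
  simpa using this

theorem enorm_le_tsum_of_hasSum {ι E : Type*} [NormedAddCommGroup E] [CompleteSpace E]
    {f : ι → E} {a : E} (h : HasSum f a) : ‖a‖ₑ ≤ ∑' i, ‖f i‖ₑ := by
  rw [← h.tsum_eq]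
  exact enorm_tsum_le_tsum_enorm

theorem ext_fc {f g : CT} (hf : ∑' k, afc f k ≠ ⊤) (h : ∀ k, fc k f = fc k g) : f = g := by
  have hg : ∑' k, afc g k ≠ ⊤ := by
    have : afc g = afc f := funext fun k => by rw [afc, afc, h]
    rwa [this]
  refine (hasSum_fc hf).unique ?_
  simp only [h]
  exact hasSum_fc hg

theorem enorm_le_tsum_afc {f : CT} (h : ∑' k, afc f k ≠ ⊤) : ‖f‖ₑ ≤ ∑' k, afc f k := by
  refine (enorm_le_tsum_of_hasSum (hasSum_fc h)).trans (ENNReal.tsum_le_tsum fun k => ?_)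
  rw [enorm_smul, afc]
  have : ‖expo k‖ₑ = 1 := by rw [← ofReal_norm, norm_expo]; simp
  rw [this, mul_one]

/-- A continuous function with prescribed absolutely summable coefficients. -/
def ofCoeff (c : ℤ → ℂ) : CT := ∑' k, c k • expo k

theorem hasSum_ofCoeff {c : ℤ → ℂ} (hc : Summable fun k => ‖c k‖) :
    HasSum (fun k => c k • expo k) (ofCoeff c) := by
  refine Summable.hasSum (Summable.of_norm ?_)
  simpa [norm_smul, norm_expo] using hc

theorem fc_ofCoeff {c : ℤ → ℂ} (hc : Summable fun k => ‖c k‖) (k : ℤ) :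
    fc k (ofCoeff c) = c k := by
  have h := (fc k).hasSum (hasSum_ofCoeff hc)
  have h2 : (fun j => (fc k) (c j • expo j)) = fun j => if j = k then c j else 0 := by
    funext j
    rw [map_smul, fc_expo]
    simp
  rw [h2] at h
  rw [← h.tsum_eq, tsum_ite_eq]

/-! ### Sobolev norms of continuous functions -/

/-- The Sobolev norm `H^s`, with values in `[0, ∞]`. -/
def sobN (s : ℝ) (f : CT) : ℝ≥0∞ := wl2 s (afc f)

theorem sobN_mono {s t : ℝ} (h : s ≤ t) (f : CT) : sobN s f ≤ sobN t f := wl2_mono_left h _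

theorem tsum_afc_le (a : ℝ) (f : CT) : ∑' k, afc f k ≤ embC a * sobN a f := tsum_le_wl2 a _

theorem tsum_afc_ne_top {a : ℝ} (ha : 1 / 2 < a) {f : CT} (hf : sobN a f ≠ ⊤) :
    ∑' k, afc f k ≠ ⊤ :=
  ne_top_of_le_ne_top (ENNReal.mul_ne_top (embC_ne_top ha) hf) (tsum_afc_le a f)

theorem enorm_le_sobN {a : ℝ} (ha : 1 / 2 < a) (f : CT) : ‖f‖ₑ ≤ embC a * sobN a f := by
  by_cases hf : sobN a f = ⊤
  -- For an infinite norm the bound is vacuous only if the constant is nonzero, because 0 · ∞ = 0 in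
  -- `ℝ≥0∞`.
  · rw [hf, ENNReal.mul_top]
    · exact le_top
    · intro h0
      have h1 : ∀ k, wt (-a) k ≤ 0 := fun k => h0 ▸ le_l2 _ k
      exact wt_ne_zero _ 0 (le_antisymm (h1 0) zero_le)
  · exact (enorm_le_tsum_afc (tsum_afc_ne_top ha hf)).trans (tsum_afc_le a f)

theorem sobN_add_le (s : ℝ) (f g : CT) : sobN s (f + g) ≤ sobN s f + sobN s g := by
  refine le_trans (wl2_mono fun k => ?_) (wl2_add_le s _ _)
  rw [afc, map_add]
  exact enorm_add_le _ _

theorem sobN_smul (s : ℝ) (c : ℂ) (f : CT) : sobN s (c • f) = ‖c‖ₑ * sobN s f := by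
  unfold sobN
  rw [← wl2_const_mul]
  congr 1
  funext k
  rw [afc, map_smul, enorm_smul, afc]

theorem sobN_zero (s : ℝ) : sobN s (0 : CT) = 0 := by
  simp [sobN, wl2, afc, l2_zero]

theorem sobN_sum_le {ι : Type*} (s : ℝ) (t : Finset ι) (F : ι → CT) :
    sobN s (∑ i ∈ t, F i) ≤ ∑ i ∈ t, sobN s (F i) := by
  classical
  induction t using Finset.induction_on with
  | empty => simp [sobN_zero]
  | insert a t ha ih =>
    rw [Finset.sum_insert ha, Finset.sum_insert ha]
    exact (sobN_add_le _ _ _).trans (by gcongr)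

/-- Lower semicontinuity from Fatou's lemma. It carries estimates from trigonometric polynomials to
general functions without any convergence in H^s. -/
theorem sobN_le_of_tendsto_fc {ι : Type*} {L : Filter ι} [L.NeBot] {s : ℝ} {F : ι → CT} {f : CT}
    {C : ℝ≥0∞} (h : ∀ k, Filter.Tendsto (fun n => fc k (F n)) L (nhds (fc k f)))
    (hC : ∀ᶠ n in L, sobN s (F n) ≤ C) : sobN s f ≤ C :=
  wl2_le_of_tendsto (fun k => (continuous_enorm.tendsto _).comp (h k)) hC

theorem sobN_le_of_tendsto {ι : Type*} {L : Filter ι} [L.NeBot] {s : ℝ} {F : ι → CT} {f : CT}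
    {C : ℝ≥0∞} (h : Filter.Tendsto F L (nhds f)) (hC : ∀ᶠ n in L, sobN s (F n) ≤ C) :
    sobN s f ≤ C :=
  sobN_le_of_tendsto_fc (fun k => ((fc k).continuous.tendsto f).comp h) hC

theorem sobN_le_tsum {ι : Type*} {s : ℝ} {F : ι → CT} {f : CT} (h : HasSum F f) :
    sobN s f ≤ ∑' i, sobN s (F i) :=
  sobN_le_of_tendsto (L := Filter.atTop) h
    (Filter.Eventually.of_forall fun t => (sobN_sum_le s t F).trans (ENNReal.sum_le_tsum t))

theorem sobN_expo (s : ℝ) (j : ℤ) : sobN s (expo j) = wt s j := by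
  have h : (fun k => wt s k * afc (expo j) k) = fun k => if k = j then wt s j else 0 := by
    funext k
    rw [afc, fc_expo]
    by_cases hk : k = j
    · subst hk; simp
    · simp [hk, Ne.symm hk]
  unfold sobN wl2 l2
  rw [h, tsum_eq_single j fun k hk => by simp [hk], ← ENNReal.rpow_natCast, ← ENNReal.rpow_mul]
  norm_num

theorem sobN_one (s : ℝ) : sobN s (1 : CT) = 1 := by
  rw [← expo_zero, sobN_expo, wt_at_zero]

/-- Fourier coefficients of products. -/
theorem fc_mul {g : CT} (hg : ∑' k, afc g k ≠ ⊤) (f : CT) (k : ℤ) :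
    HasSum (fun i => fc i g * fc (k - i) f) (fc k (g * f)) := by
  -- Only g is expanded in its Fourier series, so f need not have summable coefficients.
  have h := hasSum_map_fc ((fc k).comp ((ContinuousLinearMap.mul ℂ CT).flip f)) hg
  have e : (fun i => fc i g * fc (k - i) f) = fun i => fc i g • fc k (expo i * f) :=
    funext fun i => by rw [fc_expo_mul, smul_eq_mul]
  rw [e]
  exact h

theorem afc_mul_le {g : CT} (hg : ∑' k, afc g k ≠ ⊤) (f : CT) (k : ℤ) :
    afc (g * f) k ≤ conv (afc g) (afc f) k := by
  refine (enorm_le_tsum_of_hasSum (fc_mul hg f k)).trans (ENNReal.tsum_le_tsum fun i => ?_)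
  rw [enorm_mul, afc, afc]

theorem tsum_afc_mul_le {g : CT} (hg : ∑' k, afc g k ≠ ⊤) (f : CT) :
    ∑' k, afc (g * f) k ≤ (∑' k, afc g k) * ∑' k, afc f k := by
  rw [← tsum_conv]
  exact ENNReal.tsum_le_tsum fun k => afc_mul_le hg f k

theorem sobN_mul_le {s a : ℝ} (hs : 0 ≤ s) (hsa : s ≤ a) (ha : 1 / 2 < a) (f : CT) {g : CT}
    (hg : sobN a g ≠ ⊤) : sobN s (f * g) ≤ prodC s a * (sobN s f * sobN a g) := by
  refine le_trans (wl2_mono fun k => ?_) (wl2_conv_le hs hsa (afc f) (afc g))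
  rw [mul_comm, conv_comm]
  exact afc_mul_le (tsum_afc_ne_top ha hg) f k

/-! ### Parseval -/

theorem sobN_zero_sq (f : CT) : sobN 0 f ^ 2 = ∫⁻ x, ‖f x‖ₑ ^ 2 ∂haarAddCircle := by
  have h := hasSum_sq_fourierCoeff (ContinuousMap.toLp (E := ℂ) 2 haarAddCircle ℂ f)
  simp only [fourierCoeff_toLp] at h
  have h2 : ∫ t, ‖(ContinuousMap.toLp (E := ℂ) 2 haarAddCircle ℂ f) t‖ ^ 2 ∂haarAddCircle
      = ∫ t, ‖f t‖ ^ 2 ∂haarAddCircle := by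
    refine MeasureTheory.integral_congr_ae ?_
    filter_upwards [ContinuousMap.coeFn_toLp (p := 2) (𝕜 := ℂ)
      (haarAddCircle (T := (1 : ℝ))) f] with x hx
    rw [hx]
  rw [h2] at h
  have e : ∀ z : ℂ, ‖z‖ₑ ^ 2 = ENNReal.ofReal (‖z‖ ^ 2) := fun z => by
    rw [← ofReal_norm, ENNReal.ofReal_pow (norm_nonneg _)]
  unfold sobN wl2
  rw [l2_sq]
  simp only [wt_zero, one_mul, afc, e, fc_eq_fourierCoeff]
  rw [← ENNReal.ofReal_tsum_of_nonneg (fun k => by positivity) h.summable, h.tsum_eq,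
    MeasureTheory.ofReal_integral_eq_lintegral_ofReal]
  · exact integrable_circle (by fun_prop)
  · exact Filter.Eventually.of_forall fun x => by positivity

/-- By Parseval the H⁰ norm is the L² norm, on which a bounded factor acts pointwise. -/
theorem sobN_zero_mul_le (f g : CT) : sobN 0 (g * f) ≤ ‖g‖ₑ * sobN 0 f := by
  refine le_of_sq_le_sq_ennreal ?_
  rw [mul_pow, sobN_zero_sq, sobN_zero_sq, ← MeasureTheory.lintegral_const_mul']
  · refine MeasureTheory.lintegral_mono fun x => ?_
    rw [ContinuousMap.mul_apply, enorm_mul, mul_pow]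
    have : ‖g x‖ₑ ≤ ‖g‖ₑ := enorm_le_iff_norm_le.2 (g.norm_coe_le_norm x)
    gcongr
  · simp

theorem sobN_zero_le_norm (f : CT) : sobN 0 f ≤ ‖f‖ₑ := by
  have := sobN_zero_mul_le 1 f
  rwa [mul_one, sobN_one, mul_one] at this

/-! ### Derivatives -/

/-- `2πik` -/
def tpi (k : ℤ) : ℂ := 2 * Real.pi * Complex.I * k

theorem norm_tpi (k : ℤ) : ‖tpi k‖ = 2 * Real.pi * |(k : ℝ)| := by
  unfold tpi
  simp [abs_of_pos Real.pi_pos]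

/-- `f'` is the derivative of `f`. -/
def IsDer (f f' : CT) : Prop :=
  ∀ x : ℝ, HasDerivAt (fun y : ℝ => f (y : UnitAddCircle)) (f' (x : UnitAddCircle)) x

theorem IsDer.mul {f f' g g' : CT} (hf : IsDer f f') (hg : IsDer g g') :
    IsDer (f * g) (f' * g + f * g') := fun x => by
  exact (hf x).mul (hg x)

theorem IsDer.smul {f f' : CT} (hf : IsDer f f') (c : ℂ) : IsDer (c • f) (c • f') := fun x => by
  simpa using (hf x).const_mul c

theorem IsDer.sum {ι : Type*} {t : Finset ι} {f f' : ι → CT} (h : ∀ i ∈ t, IsDer (f i) (f' i)) :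
    IsDer (∑ i ∈ t, f i) (∑ i ∈ t, f' i) := fun x => by
  simpa using HasDerivAt.fun_sum fun i hi => h i hi x

theorem isDer_expo (k : ℤ) : IsDer (expo k) (tpi k • expo k) := fun x => by
  simpa [tpi] using hasDerivAt_fourier (1 : ℝ) k x

theorem IsDer.circleInt_eq_zero {f f' : CT} (h : IsDer f f') : circleInt f' = 0 := by
  rw [circleInt_apply, integral_circle_eq f' 0,
    intervalIntegral.integral_eq_sub_of_hasDerivAt (fun x _ => h x)]
  · have : ((0 + 1 : ℝ) : UnitAddCircle) = ((0 : ℝ) : UnitAddCircle) :=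
      AddCircle.coe_add_period 1 0
    rw [this, sub_self]
  · exact (f'.continuous.comp (AddCircle.continuous_mk' 1)).intervalIntegrable _ _

theorem tpi_neg (k : ℤ) : tpi (-k) = -tpi k := by
  unfold tpi
  push_cast
  ring

/-- Integration by parts: the derivative of e_{-k} f has mean zero. -/
theorem IsDer.fc_eq {f f' : CT} (h : IsDer f f') (k : ℤ) : fc k f' = tpi k * fc k f := by
  have h1 := ((isDer_expo (-k)).mul h).circleInt_eq_zero
  rw [map_add, smul_mul_assoc, map_smul, tpi_neg] at h1
  change -tpi k • fc k f + fc k f' = 0 at h1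
  rw [smul_eq_mul] at h1
  linear_combination h1

theorem isDer_of_fc {f f' : CT} (hf : ∑' k, afc f k ≠ ⊤) (hf' : ∑' k, afc f' k ≠ ⊤)
    (h : ∀ k, fc k f' = tpi k * fc k f) : IsDer f f' := by
  intro x
  have hs := hasSum_fc hf
  have hs' := hasSum_fc hf'
  have e : ∀ y : UnitAddCircle, HasSum (fun k => fc k f * expo k y) (f y) := fun y => by
    simpa using (ContinuousMap.evalCLM ℂ y).hasSum hs
  have e' : ∀ y : UnitAddCircle, HasSum (fun k => fc k f' * expo k y) (f' y) := fun y => by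
    simpa using (ContinuousMap.evalCLM ℂ y).hasSum hs'
  have h1 := hasDerivAt_tsum (𝕜 := ℝ) (F := ℂ) (g := fun k (y : ℝ) => fc k f * expo k (y : UnitAddCircle))
    (g' := fun k (y : ℝ) => fc k f' * expo k (y : UnitAddCircle)) (y₀ := 0)
    (summable_fc hf') (fun k y => by
      have := (isDer_expo k y).const_mul (fc k f)
      simp only [ContinuousMap.smul_apply, smul_eq_mul] at this
      rw [h]
      convert! this using 1
      ring) (fun k y => by rw [norm_mul, norm_expo_apply, mul_one]) (e _).summable x
  simp only [(e _).tsum_eq, (e' _).tsum_eq] at h1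
  exact h1

theorem wt_succ_le (s : ℝ) (k : ℤ) : wt (s + 1) k ≤ wt s k + wt s k * ‖tpi k‖ₑ := by
  rw [wt_add, ← mul_one_add]
  gcongr
  rw [← ofReal_norm, norm_tpi, ← ENNReal.ofReal_one, ← ENNReal.ofReal_add zero_le_one
    (by positivity)]
  refine ENNReal.ofReal_le_ofReal ?_
  rw [← Real.sqrt_eq_rpow]
  refine Real.sqrt_le_iff.2 ⟨by positivity, ?_⟩
  have h1 : (1 : ℝ) ≤ 2 * Real.pi := by linarith [Real.pi_gt_three]
  have h2 := mul_le_mul_of_nonneg_right h1 (abs_nonneg (k : ℝ))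
  nlinarith [abs_nonneg (k : ℝ), sq_abs (k : ℝ)]

theorem wt_mul_tpi_le (s : ℝ) (k : ℤ) :
    wt s k * ‖tpi k‖ₑ ≤ ENNReal.ofReal (2 * Real.pi) * wt (s + 1) k := by
  rw [wt_add, mul_left_comm]
  gcongr
  rw [← ofReal_norm, norm_tpi, wt, ← ENNReal.ofReal_mul (by positivity)]
  refine ENNReal.ofReal_le_ofReal ?_
  gcongr
  rw [← Real.sqrt_eq_rpow]
  exact Real.abs_le_sqrt (by linarith)

/-- Since (1 + k²)^{1/2} ≤ 1 + 2π|k|, one order of regularity is paid for by one derivative. With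
`IsDer.sobN_der_le` this drives the inductions on the order. -/
theorem IsDer.sobN_succ_le {f f' : CT} (h : IsDer f f') (s : ℝ) :
    sobN (s + 1) f ≤ sobN s f + sobN s f' := by
  refine le_trans (l2_mono fun k => ?_) (l2_add_le _ _)
  calc wt (s + 1) k * afc f k ≤ (wt s k + wt s k * ‖tpi k‖ₑ) * afc f k := by
        gcongr; exact wt_succ_le s k
    _ = wt s k * afc f k + wt s k * afc f' k := by
        rw [afc, afc, h.fc_eq, enorm_mul]; ring

theorem IsDer.sobN_der_le {f f' : CT} (h : IsDer f f') (s : ℝ) :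
    sobN s f' ≤ ENNReal.ofReal (2 * Real.pi) * sobN (s + 1) f := by
  unfold sobN
  rw [← wl2_const_mul]
  refine l2_mono fun k => ?_
  calc wt s k * afc f' k = wt s k * ‖tpi k‖ₑ * afc f k := by
        rw [afc, afc, h.fc_eq, enorm_mul]; ring
    _ ≤ (ENNReal.ofReal (2 * Real.pi) * wt (s + 1) k) * afc f k := by
        exact mul_le_mul_left (wt_mul_tpi_le s k) _
    _ = _ := by ring

/-! ### Trigonometric polynomials -/

/-- The trigonometric polynomial `∑_{k ∈ S} c_k e_k`. -/
def trig (S : Finset ℤ) (c : ℤ → ℂ) : CT := ∑ k ∈ S, c k • expo k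

theorem fc_trig (S : Finset ℤ) (c : ℤ → ℂ) (k : ℤ) :
    fc k (trig S c) = if k ∈ S then c k else 0 := by
  unfold trig
  rw [map_sum]
  simp [fc_expo]

theorem isDer_trig (S : Finset ℤ) (c : ℤ → ℂ) :
    IsDer (trig S c) (trig S fun k => tpi k * c k) := by
  have h := IsDer.sum (t := S) fun k _ => (isDer_expo k).smul (c k)
  have e : (∑ k ∈ S, c k • tpi k • expo k) = trig S fun k => tpi k * c k := by
    refine Finset.sum_congr rfl fun k _ => ?_
    rw [smul_smul, mul_comm]
  rwa [e] at h

theorem tsum_afc_trig (S : Finset ℤ) (c : ℤ → ℂ) : ∑' k, afc (trig S c) k ≠ ⊤ := by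
  rw [tsum_eq_sum (s := S) (fun k hk => by rw [afc, fc_trig]; simp [hk])]
  exact ENNReal.sum_ne_top.2 fun k _ => enorm_ne_top

theorem sobN_trig_fc_le (s : ℝ) (S : Finset ℤ) (f : CT) :
    sobN s (trig S fun k => fc k f) ≤ sobN s f := by
  refine wl2_mono fun k => ?_
  rw [afc, fc_trig]
  split_ifs
  · exact le_rfl
  · simp

theorem tendsto_trig_fc {f : CT} (hf : ∑' k, afc f k ≠ ⊤) :
    Filter.Tendsto (fun S => trig S fun k => fc k f) Filter.atTop (nhds f) := hasSum_fc hf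

end

end CircleSobolev

/-! ### Right translations in H^s for 0 ≤ s ≤ 1. -/

namespace CircleSobolev

noncomputable section

open scoped ENNReal NNReal

open AddCircle (haarAddCircle)

/-! ### Diffeomorphisms of the circle -/

theorem integral_circle_eq' {E : Type*} [NormedAddCommGroup E] [NormedSpace ℝ E]
    (f : UnitAddCircle → E) (a : ℝ) :
    ∫ x, f x ∂haarAddCircle = ∫ x in a..a + 1, f (x : UnitAddCircle) := by
  rw [UnitAddCircle.intervalIntegral_preimage, AddCircle.integral_haarAddCircle]
  simp

/-- A `C¹` diffeomorphism of the circle with a lift to the line. -/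
structure Dif where
  /-- the map -/
  toMap : C(UnitAddCircle, UnitAddCircle)
  /-- the derivative -/
  d : C(UnitAddCircle, ℝ)
  /-- the lift -/
  lift : ℝ → ℝ
  lift_coe : ∀ x : ℝ, ((lift x : ℝ) : UnitAddCircle) = toMap (x : UnitAddCircle)
  hasDeriv : ∀ x : ℝ, HasDerivAt lift (d (x : UnitAddCircle)) x
  lift_add_one : ∀ x, lift (x + 1) = lift x + 1
  d_pos : ∀ x, 0 < d x

/-- The embedding of real into complex continuous functions. -/
def ofRealCT (f : C(UnitAddCircle, ℝ)) : CT := ⟨fun x => (f x : ℂ), by fun_prop⟩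

@[simp] theorem ofRealCT_apply (f : C(UnitAddCircle, ℝ)) (x : UnitAddCircle) :
    ofRealCT f x = (f x : ℂ) := rfl

namespace Dif

variable (D : Dif)

/-- The derivative as a complex function. -/
def dC : CT := ofRealCT D.d

/-- The right translate `f ∘ D`. -/
def rt (f : CT) : CT := f.comp D.toMap

@[simp] theorem rt_apply (f : CT) (x : UnitAddCircle) : D.rt f x = f (D.toMap x) := rfl

theorem rt_add (f g : CT) : D.rt (f + g) = D.rt f + D.rt g := rfl

theorem rt_sub (f g : CT) : D.rt (f - g) = D.rt f - D.rt g := rfl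

theorem rt_mul (f g : CT) : D.rt (f * g) = D.rt f * D.rt g := rfl

theorem rt_smul (c : ℂ) (f : CT) : D.rt (c • f) = c • D.rt f := rfl

theorem continuous_rt : Continuous D.rt := ContinuousMap.continuous_precomp D.toMap

theorem isDer_rt {f f' : CT} (h : IsDer f f') : IsDer (D.rt f) (D.rt f' * D.dC) := by
  intro x
  have h1 := (h (D.lift x)).scomp x (D.hasDeriv x)
  have e : ((fun y : ℝ => f (y : UnitAddCircle)) ∘ D.lift)
      = fun y : ℝ => D.rt f (y : UnitAddCircle) := by
    funext y
    rw [Function.comp_apply, D.lift_coe, rt_apply]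
  rw [e, D.lift_coe] at h1
  convert! h1 using 1
  simp [dC, mul_comm]

/-- Substitution along the lift: the image of one period [0, 1] is the period starting at the lift
of 0, and integrals over periods agree. -/
theorem integral_rt {E : Type*} [NormedAddCommGroup E] [NormedSpace ℝ E]
    {F : UnitAddCircle → E} (hF : Continuous F) :
    ∫ x, D.d x • F (D.toMap x) ∂haarAddCircle = ∫ x, F x ∂haarAddCircle := by
  rw [integral_circle_eq' _ 0, integral_circle_eq' F (D.lift 0), ← D.lift_add_one]
  simp only [← D.lift_coe]
  have hc : Continuous fun x : ℝ => D.d (x : UnitAddCircle) :=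
    D.d.continuous.comp (AddCircle.continuous_mk' 1)
  exact intervalIntegral.integral_deriv_smul_comp (g := fun y : ℝ => F (y : UnitAddCircle))
    (fun x _ => D.hasDeriv x) hc.continuousOn (hF.comp (AddCircle.continuous_mk' 1))

/-- Bounds on the derivative from above and from below. -/
def Bdd (M : ℝ) : Prop := ∀ x, D.d x ≤ M ∧ 1 ≤ M * D.d x

variable {D}

theorem Bdd.pos {M : ℝ} (h : D.Bdd M) : 0 < M := by
  have h1 := D.d_pos 0
  linarith [(h 0).1]

end Dif

theorem sobN_zero_sq' (f : CT) :
    sobN 0 f ^ 2 = ENNReal.ofReal (∫ x, ‖f x‖ ^ 2 ∂haarAddCircle) := by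
  rw [sobN_zero_sq, MeasureTheory.ofReal_integral_eq_lintegral_ofReal]
  · refine MeasureTheory.lintegral_congr fun x => ?_
    rw [← ofReal_norm, ENNReal.ofReal_pow (norm_nonneg _)]
  · exact integrable_circle (by fun_prop)
  · exact Filter.Eventually.of_forall fun x => by positivity

namespace Dif

variable {D : Dif}

/-- The factor M · D' ≥ 1 may be inserted under the integral; it supplies the Jacobian for the
change of variables. -/
theorem Bdd.sobN_zero_rt_sq_le {M : ℝ} (h : D.Bdd M) (f : CT) :
    sobN 0 (D.rt f) ^ 2 ≤ ENNReal.ofReal M * sobN 0 f ^ 2 := by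
  rw [sobN_zero_sq', sobN_zero_sq', ← ENNReal.ofReal_mul h.pos.le]
  refine ENNReal.ofReal_le_ofReal ?_
  rw [← D.integral_rt (F := fun x => ‖f x‖ ^ 2) (by fun_prop), ← MeasureTheory.integral_const_mul]
  refine MeasureTheory.integral_mono (integrable_circle (by fun_prop))
    (integrable_circle (by fun_prop)) fun x => ?_
  have h1 := (h x).2
  have h2 : 0 ≤ ‖f (D.toMap x)‖ ^ 2 := by positivity
  simp only [rt_apply, smul_eq_mul]
  nlinarith

theorem Bdd.enorm_dC_le {M : ℝ} (h : D.Bdd M) : ‖D.dC‖ₑ ≤ ENNReal.ofReal M := by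
  rw [← ofReal_norm]
  refine ENNReal.ofReal_le_ofReal ((ContinuousMap.norm_le _ h.pos.le).2 fun x => ?_)
  rw [dC, ofRealCT_apply, Complex.norm_real, Real.norm_of_nonneg (D.d_pos x).le]
  exact (h x).1

/-- The constant in the estimates of right translations in `H^s`, `0 ≤ s ≤ 1`. -/
def baseC (M : ℝ) : ℝ≥0∞ :=
  (1 + ENNReal.ofReal M * ENNReal.ofReal (2 * Real.pi)) * (1 + ENNReal.ofReal M)

theorem baseC_ne_top (M : ℝ) : baseC M ≠ ⊤ := by
  unfold baseC
  finiteness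

theorem Bdd.sobN_zero_rt_le' {M : ℝ} (h : D.Bdd M) (f : CT) :
    sobN 0 (D.rt f) ≤ (1 + ENNReal.ofReal M) * sobN 0 f := by
  refine le_of_sq_le_sq_ennreal ((h.sobN_zero_rt_sq_le f).trans ?_)
  rw [mul_pow]
  gcongr
  calc ENNReal.ofReal M ≤ 1 + ENNReal.ofReal M := le_add_self
    _ = (1 + ENNReal.ofReal M) * 1 := by rw [mul_one]
    _ ≤ (1 + ENNReal.ofReal M) * (1 + ENNReal.ofReal M) := by gcongr; exact le_self_add
    _ = _ := (sq _).symm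

theorem Bdd.sobN_zero_rt_le {M : ℝ} (h : D.Bdd M) (f : CT) :
    sobN 0 (D.rt f) ≤ baseC M * sobN 0 f := by
  refine (h.sobN_zero_rt_le' f).trans ?_
  gcongr
  unfold baseC
  calc (1 + ENNReal.ofReal M) = 1 * (1 + ENNReal.ofReal M) := (one_mul _).symm
    _ ≤ _ := by gcongr; exact le_self_add

/-- Chain rule: in L² the factor D' costs only its sup norm, so at order one no Sobolev bound on D'
is needed. -/
theorem Bdd.sobN_one_rt_le {M : ℝ} (h : D.Bdd M) {f f' : CT} (hf : IsDer f f') :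
    sobN 1 (D.rt f) ≤ baseC M * sobN 1 f := by
  have h1 := (D.isDer_rt hf).sobN_succ_le 0
  have h2 := hf.sobN_der_le 0
  rw [zero_add] at h1 h2
  calc sobN 1 (D.rt f) ≤ sobN 0 (D.rt f) + sobN 0 (D.rt f' * D.dC) := h1
    _ ≤ (1 + ENNReal.ofReal M) * sobN 1 f
        + ENNReal.ofReal M * ((1 + ENNReal.ofReal M) *
          (ENNReal.ofReal (2 * Real.pi) * sobN 1 f)) := by
        refine add_le_add ((h.sobN_zero_rt_le' f).trans ?_) ?_
        · gcongr
          exact sobN_mono zero_le_one f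
        · rw [mul_comm (D.rt f')]
          refine (sobN_zero_mul_le _ _).trans ?_
          refine mul_le_mul' h.enorm_dC_le ((h.sobN_zero_rt_le' f').trans ?_)
          gcongr
    _ = _ := by unfold baseC; ring

end Dif

/-! ### Interpolation -/

/-- The integral `∫₀^∞ σ^{-s} / (1 + σ) dσ`. -/
def kap (s : ℝ) : ℝ := ∫ σ in Set.Ioi (0 : ℝ), σ ^ (-s) / (1 + σ)

theorem integrableOn_kap {s : ℝ} (h0 : 0 < s) (h1 : s < 1) :
    MeasureTheory.IntegrableOn (fun σ : ℝ => σ ^ (-s) / (1 + σ)) (Set.Ioi 0) := by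
  rw [← Set.Ioc_union_Ioi_eq_Ioi zero_le_one]
  have hm : MeasureTheory.AEStronglyMeasurable (fun σ : ℝ => σ ^ (-s) / (1 + σ))
      MeasureTheory.volume := by
    refine Measurable.aestronglyMeasurable ?_
    fun_prop
  refine MeasureTheory.IntegrableOn.union ?_ ?_
  · have h2 := intervalIntegral.intervalIntegrable_rpow' (a := 0) (b := 1) (r := -s) (by linarith)
    rw [intervalIntegrable_iff_integrableOn_Ioc_of_le zero_le_one] at h2
    refine MeasureTheory.Integrable.mono' h2 hm.restrict ?_
    refine (MeasureTheory.ae_restrict_iff' measurableSet_Ioc).2 (Filter.Eventually.of_forall ?_)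
    intro σ hσ
    have hp : 0 < σ := hσ.1
    rw [Real.norm_of_nonneg (by positivity)]
    exact div_le_self (by positivity) (by linarith)
  · have h2 := integrableOn_Ioi_rpow_of_lt (a := -s - 1) (c := 1) (by linarith) one_pos
    refine MeasureTheory.Integrable.mono' h2 hm.restrict ?_
    refine (MeasureTheory.ae_restrict_iff' measurableSet_Ioi).2 (Filter.Eventually.of_forall ?_)
    intro σ hσ
    have hp : 0 < σ := lt_trans one_pos hσ
    rw [Real.norm_of_nonneg (by positivity), Real.rpow_sub hp, Real.rpow_one]
    gcongr
    linarith

theorem kap_pos {s : ℝ} (h0 : 0 < s) (h1 : s < 1) : 0 < kap s := by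
  refine (MeasureTheory.setIntegral_pos_iff_support_of_nonneg_ae ?_ (integrableOn_kap h0 h1)).2 ?_
  · refine (MeasureTheory.ae_restrict_iff' measurableSet_Ioi).2 (Filter.Eventually.of_forall ?_)
    intro σ hσ
    have hp : 0 < σ := hσ
    change 0 ≤ σ ^ (-s) / (1 + σ)
    positivity
  · have : Function.support (fun σ : ℝ => σ ^ (-s) / (1 + σ)) ∩ Set.Ioi 0 = Set.Ioi 0 := by
      refine Set.inter_eq_right.2 fun σ hσ => ?_
      have hp : 0 < σ := hσ
      have : 0 < σ ^ (-s) / (1 + σ) := by positivity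
      exact this.ne'
    rw [this]
    simp

/-- The weight of the `K`-functional between `H⁰` and `H¹`. -/
def theta (τ : ℝ) (k : ℤ) : ℝ≥0∞ :=
  ENNReal.ofReal (τ * (1 + (k : ℝ) ^ 2) / (1 + τ * (1 + (k : ℝ) ^ 2)))

/-- The substitution σ = (1 + k²) τ makes the integral homogeneous in 1 + k². This recovers the H^s
weight as a superposition of the weights of the K-functional. -/
theorem lintegral_theta {s : ℝ} (h0 : 0 < s) (h1 : s < 1) (k : ℤ) :
    ∫⁻ τ in Set.Ioi (0 : ℝ), ENNReal.ofReal (τ ^ (-s - 1)) * theta τ k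
      = ENNReal.ofReal (kap s) * wt s k ^ 2 := by
  set W : ℝ := 1 + (k : ℝ) ^ 2 with hW
  have hW0 : 0 < W := by positivity
  have e1 : ∀ τ ∈ Set.Ioi (0 : ℝ), ENNReal.ofReal (τ ^ (-s - 1)) * theta τ k
      = ENNReal.ofReal (W ^ (1 + s) * ((fun σ : ℝ => σ ^ (-s) / (1 + σ)) (W * τ))) := by
    intro τ hτ
    have hp : 0 < τ := hτ
    rw [theta, ← hW, ← ENNReal.ofReal_mul (by positivity)]
    congr 1
    simp only
    rw [Real.mul_rpow hW0.le hp.le, Real.rpow_sub hp, Real.rpow_one, Real.rpow_add hW0,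
      Real.rpow_one, Real.rpow_neg hW0.le]
    have : W ^ s ≠ 0 := by positivity
    field_simp
  rw [MeasureTheory.setLIntegral_congr_fun measurableSet_Ioi e1,
    ← MeasureTheory.ofReal_integral_eq_lintegral_ofReal]
  · rw [MeasureTheory.integral_const_mul,
      MeasureTheory.integral_comp_mul_left_Ioi (fun σ : ℝ => σ ^ (-s) / (1 + σ)) 0 hW0, mul_zero,
      smul_eq_mul, wt_sq, wt, ← hW, ← ENNReal.ofReal_mul (kap_pos h0 h1).le]
    congr 1
    rw [Real.rpow_add hW0, Real.rpow_one, show 2 * s / 2 = s by ring]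
    unfold kap
    field_simp
  · refine MeasureTheory.Integrable.const_mul ?_ _
    refine (MeasureTheory.integrableOn_Ioi_comp_mul_left_iff
      (fun σ : ℝ => σ ^ (-s) / (1 + σ)) 0 hW0).2 ?_
    rw [mul_zero]
    exact integrableOn_kap h0 h1
  · refine (MeasureTheory.ae_restrict_iff' measurableSet_Ioi).2 (Filter.Eventually.of_forall ?_)
    intro τ hτ
    have hp : 0 < τ := hτ
    change 0 ≤ W ^ (1 + s) * ((W * τ) ^ (-s) / (1 + W * τ))
    positivity

/-- The quadratic `K`-functional between `H⁰` and `H¹`. -/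
def kfun (τ : ℝ) (f : CT) : ℝ≥0∞ := ∑' k, theta τ k * afc f k ^ 2

/-- The intermediate norm is an average of K-functionals, so any bound uniform in τ for `kfun` is a
bound in H^s. -/
theorem lintegral_kfun {s : ℝ} (h0 : 0 < s) (h1 : s < 1) (f : CT) :
    ∫⁻ τ in Set.Ioi (0 : ℝ), ENNReal.ofReal (τ ^ (-s - 1)) * kfun τ f
      = ENNReal.ofReal (kap s) * sobN s f ^ 2 := by
  unfold kfun sobN wl2
  rw [l2_sq, ← ENNReal.tsum_mul_left]
  simp only [← ENNReal.tsum_mul_left, ← mul_assoc]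
  rw [MeasureTheory.lintegral_tsum]
  · refine tsum_congr fun k => ?_
    rw [MeasureTheory.lintegral_mul_const, lintegral_theta h0 h1]
    · ring
    · unfold theta
      fun_prop
  · intro k
    refine Measurable.aemeasurable ?_
    unfold theta
    fun_prop

/-- For each frequency, `theta` is the minimum of |a|² + τ(1 + k²)|b|² over a + b = 1. Every
splitting therefore dominates the K-functional. -/
theorem kfun_add_le {τ : ℝ} (hτ : 0 < τ) (f g : CT) :
    kfun τ (f + g) ≤ sobN 0 f ^ 2 + ENNReal.ofReal τ * sobN 1 g ^ 2 := by
  unfold kfun sobN wl2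
  rw [l2_sq, l2_sq, ← ENNReal.tsum_mul_left, ← ENNReal.tsum_add]
  refine ENNReal.tsum_le_tsum fun k => ?_
  set W : ℝ := 1 + (k : ℝ) ^ 2 with hW
  have hW0 : 0 < W := by positivity
  have e : ∀ z : ℂ, ‖z‖ₑ ^ 2 = ENNReal.ofReal (‖z‖ ^ 2) := fun z => by
    rw [← ofReal_norm, ENNReal.ofReal_pow (norm_nonneg _)]
  have hw : wt 1 k ^ 2 = ENNReal.ofReal W := by
    rw [wt_sq, wt, ← hW]
    simp
  rw [wt_zero, one_mul, mul_pow, hw, theta, afc, afc, afc, map_add, e, e, e,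
    ← ENNReal.ofReal_mul (by positivity), ← ENNReal.ofReal_mul (by positivity),
    ← ENNReal.ofReal_mul (by positivity), ← ENNReal.ofReal_add (by positivity) (by positivity)]
  refine ENNReal.ofReal_le_ofReal ?_
  have h1 : ‖fc k f + fc k g‖ ^ 2 ≤ (‖fc k f‖ + ‖fc k g‖) ^ 2 :=
    pow_le_pow_left₀ (norm_nonneg _) (norm_add_le _ _) 2
  rw [div_mul_eq_mul_div, div_le_iff₀ (by positivity)]
  set a := ‖fc k f‖
  set b := ‖fc k g‖
  set x := τ * W with hx
  have hx0 : 0 < x := by positivity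
  have h2 : x * ‖fc k f + fc k g‖ ^ 2 ≤ x * (a + b) ^ 2 := by gcongr
  have e2 : τ * (W * b ^ 2) = x * b ^ 2 := by rw [hx]; ring
  rw [e2]
  -- The difference (1 + x)(a² + x b²) - x(a + b)² is exactly (a - x b)².
  nlinarith [sq_nonneg (a - x * b)]

/-- The minimising splitting multiplies each coefficient by τW/(1 + τW) and 1/(1 + τW), with W = 1 +
k². It stays within trigonometric polynomials, where the H⁰ and H¹ bounds are available. -/
theorem kfun_trig (τ : ℝ) (hτ : 0 < τ) (S : Finset ℤ) (c : ℤ → ℂ) :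
    ∃ c0 c1 : ℤ → ℂ, trig S c = trig S c0 + trig S c1 ∧
      sobN 0 (trig S c0) ^ 2 + ENNReal.ofReal τ * sobN 1 (trig S c1) ^ 2 = kfun τ (trig S c) := by
  have hW : ∀ k : ℤ, 0 < 1 + τ * (1 + (k : ℝ) ^ 2) := fun k => by positivity
  refine ⟨fun k => ((τ * (1 + (k : ℝ) ^ 2) / (1 + τ * (1 + (k : ℝ) ^ 2)) : ℝ) : ℂ) * c k,
    fun k => ((1 / (1 + τ * (1 + (k : ℝ) ^ 2)) : ℝ) : ℂ) * c k, ?_, ?_⟩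
  · unfold trig
    rw [← Finset.sum_add_distrib]
    refine Finset.sum_congr rfl fun k _ => ?_
    ext x
    simp only [ContinuousMap.add_apply, ContinuousMap.smul_apply, smul_eq_mul]
    rw [← add_mul, ← add_mul, ← Complex.ofReal_add, ← add_div, add_comm, div_self (hW k).ne',
      Complex.ofReal_one, one_mul]
  · unfold kfun sobN wl2
    rw [l2_sq, l2_sq, ← ENNReal.tsum_mul_left, ← ENNReal.tsum_add]
    refine tsum_congr fun k => ?_
    simp only [afc, fc_trig]
    split_ifs
    · set W : ℝ := 1 + (k : ℝ) ^ 2 with hW'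
      have hW0 : 0 < W := by positivity
      have e : ∀ z : ℂ, ‖z‖ₑ ^ 2 = ENNReal.ofReal (‖z‖ ^ 2) := fun z => by
        rw [← ofReal_norm, ENNReal.ofReal_pow (norm_nonneg _)]
      have hw : wt 1 k ^ 2 = ENNReal.ofReal W := by
        rw [wt_sq, wt, ← hW']
        simp
      rw [wt_zero, one_mul, mul_pow, hw, theta, e, e, e, ← hW', norm_mul, norm_mul,
        Complex.norm_real, Complex.norm_real, Real.norm_of_nonneg (by positivity),
        Real.norm_of_nonneg (by positivity),
        ← ENNReal.ofReal_mul (by positivity), ← ENNReal.ofReal_mul (by positivity),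
        ← ENNReal.ofReal_mul (by positivity), ← ENNReal.ofReal_add (by positivity) (by positivity)]
      congr 1
      field_simp
      ring
    · simp

/-- Real interpolation: translating an optimal splitting gives a competitor for the translate, whose
two parts are bounded by the cases s = 0 and s = 1 with the same constant `baseC`. Integration in τ
gives 0 < s < 1. -/
theorem Dif.Bdd.sobN_rt_trig_le {D : Dif} {M s : ℝ} (h : D.Bdd M) (hs : 0 ≤ s) (hs1 : s ≤ 1)
    (S : Finset ℤ) (c : ℤ → ℂ) : sobN s (D.rt (trig S c)) ≤ Dif.baseC M * sobN s (trig S c) := by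
  rcases hs.eq_or_lt with rfl | h0
  · exact h.sobN_zero_rt_le _
  rcases hs1.eq_or_lt with rfl | h1
  · exact h.sobN_one_rt_le (isDer_trig S c)
  have key : ∀ τ ∈ Set.Ioi (0 : ℝ), ENNReal.ofReal (τ ^ (-s - 1)) * kfun τ (D.rt (trig S c))
      ≤ Dif.baseC M ^ 2 * (ENNReal.ofReal (τ ^ (-s - 1)) * kfun τ (trig S c)) := by
    intro τ hτ
    obtain ⟨c0, c1, e1, e2⟩ := kfun_trig τ hτ S c
    rw [mul_left_comm]
    gcongr
    rw [← e2, e1, D.rt_add]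
    refine (kfun_add_le hτ _ _).trans ?_
    have i0 := pow_le_pow_left' (h.sobN_zero_rt_le (trig S c0)) 2
    have i1 := pow_le_pow_left' (h.sobN_one_rt_le (isDer_trig S c1)) 2
    rw [mul_pow] at i0 i1
    calc _ ≤ Dif.baseC M ^ 2 * sobN 0 (trig S c0) ^ 2
          + ENNReal.ofReal τ * (Dif.baseC M ^ 2 * sobN 1 (trig S c1) ^ 2) := by gcongr
      _ = _ := by ring
  have h2 := MeasureTheory.setLIntegral_mono' (μ := MeasureTheory.volume) measurableSet_Ioi key
  rw [MeasureTheory.lintegral_const_mul' _ _ (ENNReal.pow_ne_top (Dif.baseC_ne_top M)),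
    lintegral_kfun h0 h1, lintegral_kfun h0 h1, mul_left_comm,
    ENNReal.mul_le_mul_iff_right (ENNReal.ofReal_pos.2 (kap_pos h0 h1)).ne'
      ENNReal.ofReal_ne_top, ← mul_pow] at h2
  exact le_of_sq_le_sq_ennreal h2

end

end CircleSobolev

/-! ### Right translations of higher order, and reciprocals in H^a. -/

namespace CircleSobolev

noncomputable section

open scoped ENNReal NNReal

open AddCircle (haarAddCircle)

/-! ### Right translations in Sobolev spaces of arbitrary order -/

/-- Right translation by `D` is bounded by `C` for the norm of `H^s`. -/
def RtBound (D : Dif) (s : ℝ) (C : ℝ≥0∞) : Prop :=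
  ∀ (S : Finset ℤ) (c : ℤ → ℂ), sobN s (D.rt (trig S c)) ≤ C * sobN s (trig S c)

/-- Partial Fourier sums converge uniformly when the coefficients are summable, and lower
semicontinuity does the rest. -/
theorem RtBound.sobN_rt_le {D : Dif} {s : ℝ} {C : ℝ≥0∞} (h : RtBound D s C) {f : CT}
    (hf : ∑' k, afc f k ≠ ⊤) : sobN s (D.rt f) ≤ C * sobN s f := by
  refine sobN_le_of_tendsto (L := Filter.atTop)
    ((D.continuous_rt.tendsto f).comp (tendsto_trig_fc hf)) (Filter.Eventually.of_forall fun S => ?_)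
  exact (h S _).trans (by gcongr; exact sobN_trig_fc_le s S f)

/-- (f ∘ D)' = (f' ∘ D) D', where D' multiplies H^s because it lies in H^a with a ≥ s and a > 1/2.
-/
theorem RtBound.succ {D : Dif} {s a : ℝ} {C M : ℝ≥0∞} (h : RtBound D s C) (hs : 0 ≤ s)
    (hsa : s ≤ a) (ha : 1 / 2 < a) (hM : M ≠ ⊤) (hd : sobN a D.dC ≤ M) :
    RtBound D (s + 1) (C + prodC s a * (C * ENNReal.ofReal (2 * Real.pi) * M)) := by
  intro S c
  have hder := isDer_trig S c
  set f := trig S c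
  set f' := trig S fun k => tpi k * c k
  calc sobN (s + 1) (D.rt f) ≤ sobN s (D.rt f) + sobN s (D.rt f' * D.dC) :=
        (D.isDer_rt hder).sobN_succ_le s
    _ ≤ C * sobN (s + 1) f + prodC s a * (C * (ENNReal.ofReal (2 * Real.pi) * sobN (s + 1) f) * M) := by
        refine add_le_add ((h S c).trans ?_) ?_
        · gcongr
          exact sobN_mono (by linarith) f
        · refine (sobN_mul_le hs hsa ha _ (ne_top_of_le_ne_top hM hd)).trans ?_
          gcongr
          refine (h S _).trans ?_
          gcongr
          exact hder.sobN_der_le s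
    _ = _ := by ring

/-- The diffeomorphisms with given bounds for the derivative. -/
def Dif.Ctrl (D : Dif) (a M : ℝ) : Prop := D.Bdd M ∧ sobN a D.dC ≤ ENNReal.ofReal M

/-- Induction on the integer part of the order, each step spending one derivative. For s ≤ q the
order s - 1 does not exceed q - 1, the regularity of D'. The constant depends on D only through M.
-/
theorem exists_rtBound {q : ℝ} (hq : 3 / 2 < q) (M : ℝ) (n : ℕ) :
    ∀ s : ℝ, 0 ≤ s → s ≤ n + 1 → s ≤ q →
      ∃ C : ℝ≥0∞, C ≠ ⊤ ∧ ∀ D : Dif, D.Ctrl (q - 1) M → RtBound D s C := by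
  have base : ∀ s : ℝ, 0 ≤ s → s ≤ 1 →
      ∃ C : ℝ≥0∞, C ≠ ⊤ ∧ ∀ D : Dif, D.Ctrl (q - 1) M → RtBound D s C := fun s h0 h1 =>
    ⟨Dif.baseC M, Dif.baseC_ne_top M, fun D hD S c => hD.1.sobN_rt_trig_le h0 h1 S c⟩
  induction n with
  | zero =>
    intro s h0 h1 _
    exact base s h0 (by simpa using h1)
  | succ n ih =>
    intro s h0 h1 h2
    rcases le_total s 1 with h3 | h3
    · exact base s h0 h3
    · push_cast at h1
      obtain ⟨C, hC, h⟩ := ih (s - 1) (by linarith) (by linarith) (by linarith)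
      refine ⟨C + prodC (s - 1) (q - 1) * (C * ENNReal.ofReal (2 * Real.pi) * ENNReal.ofReal M),
        ?_, fun D hD => ?_⟩
      · have := prodC_ne_top (s := s - 1) (a := q - 1) (by linarith) (by linarith)
        finiteness
      · have := (h D hD).succ (a := q - 1) (by linarith) (by linarith) (by linarith)
          ENNReal.ofReal_ne_top hD.2
        rwa [sub_add_cancel] at this

/-- `E` is the inverse of `D`. -/
structure Dif.IsInv (D E : Dif) : Prop where
  right : ∀ x, D.toMap (E.toMap x) = x
  left : ∀ x, E.toMap (D.toMap x) = x
  d_mul : ∀ x, E.d x * D.d (E.toMap x) = 1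

theorem Dif.IsInv.bdd {D E : Dif} (h : D.IsInv E) {M : ℝ} (hD : D.Bdd M) : E.Bdd M := by
  intro x
  have h1 := hD (E.toMap x)
  have h2 := h.d_mul x
  have h3 := E.d_pos x
  constructor <;> nlinarith

/-- The derivative of the inverse is a right translate by that same inverse, so its regularity is
itself a question about translation by E. -/
theorem Dif.IsInv.dC_eq {D E : Dif} (h : D.IsInv E) {g : CT} (hg : g * D.dC = 1) :
    E.dC = E.rt g := by
  ext x
  have h1 : g (E.toMap x) * D.dC (E.toMap x) = 1 := by
    rw [← ContinuousMap.mul_apply, hg, ContinuousMap.one_apply]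
  have h2 : E.dC x * D.dC (E.toMap x) = 1 := by
    have := h.d_mul x
    change (E.d x : ℂ) * (D.d (E.toMap x) : ℂ) = 1
    exact_mod_cast this
  have h3 : D.dC (E.toMap x) ≠ 0 := right_ne_zero_of_mul_eq_one h2
  exact mul_right_cancel₀ h3 (h2.trans h1.symm)

/-- The estimates for E involve E' = (1/D') ∘ E. The apparent circle is broken because E' is needed
only at an order that the induction hypothesis already covers. -/
theorem exists_rtBound_inv {q : ℝ} (hq : 3 / 2 < q) (M : ℝ) (n : ℕ) :
    ∀ s : ℝ, 0 ≤ s → s ≤ n + 1 → s ≤ q →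
      ∃ C : ℝ≥0∞, C ≠ ⊤ ∧ ∀ D E : Dif, D.Bdd M → D.IsInv E →
        (∃ g : CT, g * D.dC = 1 ∧ sobN (q - 1) g ≤ ENNReal.ofReal M) → RtBound E s C := by
  have base : ∀ s : ℝ, 0 ≤ s → s ≤ 1 →
      ∃ C : ℝ≥0∞, C ≠ ⊤ ∧ ∀ D E : Dif, D.Bdd M → D.IsInv E →
        (∃ g : CT, g * D.dC = 1 ∧ sobN (q - 1) g ≤ ENNReal.ofReal M) → RtBound E s C :=
    fun s h0 h1 => ⟨Dif.baseC M, Dif.baseC_ne_top M,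
      fun D E hD hE _ S c => (hE.bdd hD).sobN_rt_trig_le h0 h1 S c⟩
  induction n with
  | zero =>
    intro s h0 h1 _
    exact base s h0 (by simpa using h1)
  | succ n ih =>
    intro s h0 h1 h2
    rcases le_total s 1 with h3 | h3
    · exact base s h0 h3
    · push_cast at h1
      -- This order for E' is at most n + 1, so the induction hypothesis applies; at most q - 1,
      -- where 1/D' is controlled; at least s - 1 and greater than 1/2, so the product estimate
      -- applies.
      set a : ℝ := min ((n : ℝ) + 1) (q - 1) with ha
      have hn : (0 : ℝ) ≤ n := Nat.cast_nonneg n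
      have ha2 : 1 / 2 < a := lt_min (by linarith) (by linarith)
      have haq : a ≤ q - 1 := min_le_right _ _
      obtain ⟨C, hC, h⟩ := ih (s - 1) (by linarith) (by linarith) (by linarith)
      obtain ⟨C', hC', h'⟩ := ih a (by linarith) (min_le_left _ _) (by linarith)
      refine ⟨C + prodC (s - 1) a * (C * ENNReal.ofReal (2 * Real.pi) * (C' * ENNReal.ofReal M)),
        ?_, fun D E hD hE hg => ?_⟩
      · have := prodC_ne_top (s := s - 1) (a := a) (by linarith) (by linarith)
        finiteness
      · have hbd : sobN a E.dC ≤ C' * ENNReal.ofReal M := by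
          obtain ⟨g, hg1, hg2⟩ := hg
          rw [hE.dC_eq hg1]
          refine ((h' D E hD hE ⟨g, hg1, hg2⟩).sobN_rt_le
            (tsum_afc_ne_top (a := q - 1) (by linarith)
              (ne_top_of_le_ne_top ENNReal.ofReal_ne_top hg2))).trans ?_
          gcongr
          exact (sobN_mono haq g).trans hg2
        have := (h D E hD hE hg).succ (a := a) (by linarith)
          (le_min (by linarith) (by linarith)) ha2 (by finiteness) hbd
        rwa [sub_add_cancel] at this

/-! ### Reciprocals -/

/-- The frequencies of `f` are at most `n` in absolute value. -/
def Spec (n : ℕ) (f : CT) : Prop := ∀ k : ℤ, (n : ℤ) < |k| → fc k f = 0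

theorem Spec.mul {m n : ℕ} {f g : CT} (hf : Spec m f) (hg : Spec n g) (hs : ∑' k, afc f k ≠ ⊤) :
    Spec (m + n) (f * g) := by
  intro k hk
  rw [← (fc_mul hs g k).tsum_eq]
  have : ∀ i, fc i f * fc (k - i) g = 0 := fun i => by
    by_cases h : (m : ℤ) < |i|
    · rw [hf i h, zero_mul]
    · rw [hg (k - i) ?_, mul_zero]
      have := abs_sub_abs_le_abs_sub k i
      push_cast at hk
      omega
  simp [this]

theorem exists_spec_trig (S : Finset ℤ) (c : ℤ → ℂ) : ∃ n, Spec n (trig S c) := by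
  refine ⟨∑ k ∈ S, k.natAbs, fun k hk => ?_⟩
  rw [fc_trig, if_neg]
  intro hkS
  have : k.natAbs ≤ ∑ k ∈ S, k.natAbs :=
    Finset.single_le_sum (f := Int.natAbs) (fun i _ => Nat.zero_le _) hkS
  rw [Int.abs_eq_natAbs] at hk
  omega

theorem spec_one : Spec 0 (1 : CT) := by
  intro k hk
  rw [← expo_zero, fc_expo, if_neg]
  rintro rfl
  simp at hk

theorem tsum_afc_one : ∑' k, afc (1 : CT) k ≠ ⊤ := by
  refine tsum_afc_ne_top (a := 1) (by norm_num) ?_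
  rw [sobN_one]
  simp

theorem spec_pow {n : ℕ} {f : CT} (hf : Spec n f) (hs : ∑' k, afc f k ≠ ⊤) (j : ℕ) :
    Spec (j * n) (f ^ j) ∧ ∑' k, afc (f ^ j) k ≠ ⊤ := by
  induction j with
  | zero => simpa using ⟨spec_one, tsum_afc_one⟩
  | succ j ih =>
    rw [pow_succ, Nat.succ_mul]
    exact ⟨ih.1.mul hf ih.2, ne_top_of_le_ne_top (ENNReal.mul_ne_top ih.2 hs)
      (tsum_afc_mul_le ih.2 f)⟩

theorem Spec.sobN_le {n : ℕ} {f : CT} (hf : Spec n f) {s : ℝ} (hs : 0 ≤ s) :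
    sobN s f ≤ wt s n * sobN 0 f := by
  unfold sobN
  rw [← wl2_const_mul]
  refine l2_mono fun k => ?_
  by_cases h : (n : ℤ) < |k|
  · rw [afc, hf k h]
    simp
  · rw [wt_zero, one_mul]
    refine mul_le_mul' ?_ le_rfl
    refine ENNReal.ofReal_le_ofReal (Real.rpow_le_rpow (by positivity) ?_ (by positivity))
    have h1 : |(k : ℝ)| ≤ n := by exact_mod_cast not_lt.1 h
    have h2 := pow_le_pow_left₀ (abs_nonneg (k : ℝ)) h1 2
    rw [sq_abs] at h2
    push_cast
    linarith

/-- The j-th power has frequencies at most jn, so its H^s norm grows like its sup norm to the power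
j, up to a polynomial factor in j. -/
theorem Spec.sobN_pow_le {n : ℕ} {f : CT} (hf : Spec n f) (hfs : ∑' k, afc f k ≠ ⊤) {s : ℝ}
    (hs : 0 ≤ s) (j : ℕ) : sobN s (f ^ j) ≤ wt s (j * n : ℕ) * ‖f‖ₑ ^ j := by
  refine ((spec_pow hf hfs j).1.sobN_le hs).trans ?_
  gcongr
  refine (sobN_zero_le_norm _).trans ?_
  rw [← ofReal_norm, ← ofReal_norm, ← ENNReal.ofReal_pow (norm_nonneg _)]
  exact ENNReal.ofReal_le_ofReal (norm_pow_le _ _)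

/-- A submultiplicative multiple of the norm of `H^a`. -/
def algN (a : ℝ) (f : CT) : ℝ≥0∞ := (prodC a a + 1) * sobN a f

theorem algN_mul_le {a : ℝ} (ha : 1 / 2 < a) (f g : CT) (hg : sobN a g ≠ ⊤) :
    algN a (f * g) ≤ algN a f * algN a g := by
  unfold algN
  calc (prodC a a + 1) * sobN a (f * g)
      ≤ (prodC a a + 1) * (prodC a a * (sobN a f * sobN a g)) := by
        gcongr
        exact sobN_mul_le (by linarith) le_rfl ha f hg
    _ ≤ (prodC a a + 1) * ((prodC a a + 1) * (sobN a f * sobN a g)) := by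
        gcongr
        exact le_self_add
    _ = _ := by ring

theorem sobN_le_algN (a : ℝ) (f : CT) : sobN a f ≤ algN a f := by
  unfold algN
  rw [add_mul, one_mul]
  exact le_add_self

theorem sobN_pow_ne_top {a : ℝ} (ha : 1 / 2 < a) {f : CT} (hf : sobN a f ≠ ⊤) (j : ℕ) :
    sobN a (f ^ j) ≠ ⊤ := by
  induction j with
  | zero => simp [sobN_one]
  | succ j ih =>
    rw [pow_succ]
    refine ne_top_of_le_ne_top ?_ (sobN_mul_le (by linarith) le_rfl ha _ hf)
    have := prodC_ne_top (s := a) (by linarith) ha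
    finiteness

theorem algN_pow_le {a : ℝ} (ha : 1 / 2 < a) {f : CT} (hf : sobN a f ≠ ⊤) (j : ℕ) :
    algN a (f ^ j) ≤ (prodC a a + 1) * algN a f ^ j := by
  induction j with
  | zero => simp [algN, sobN_one]
  | succ j ih =>
    rw [pow_succ, pow_succ, ← mul_assoc]
    exact (algN_mul_le ha _ _ hf).trans (by gcongr)

/-- In the binomial expansion, powers of t are measured by the sup norm with polynomial loss, and
powers of e by the algebra norm. Only ‖t‖ plus the algebra norm of e has to be less than 1, even
when the H^a norm of t is large. -/
theorem sobN_add_pow_le {a : ℝ} (ha : 1 / 2 < a) {n : ℕ} {t e : CT} (ht : Spec n t)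
    (hts : ∑' k, afc t k ≠ ⊤) (he : sobN a e ≠ ⊤) (m : ℕ) :
    sobN a ((t + e) ^ m)
      ≤ (prodC a a + 1) ^ 2 * (wt a (m * n : ℕ) * (‖t‖ₑ + algN a e) ^ m) := by
  have h0 : (0 : ℝ) ≤ a := by linarith
  rw [add_pow t e]
  refine (sobN_sum_le _ _ _).trans ?_
  rw [add_pow ‖t‖ₑ, Finset.mul_sum, Finset.mul_sum]
  refine Finset.sum_le_sum fun j hj => ?_
  have hjm : j ≤ m := Nat.lt_succ_iff.1 (Finset.mem_range.1 hj)
  have e1 : t ^ j * e ^ (m - j) * (m.choose j : CT) = (m.choose j : ℂ) • (t ^ j * e ^ (m - j)) := by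
    ext x
    simp [mul_comm]
  rw [e1, sobN_smul]
  have hw : wt a (j * n : ℕ) ≤ wt a (m * n : ℕ) := by
    refine ENNReal.ofReal_le_ofReal (Real.rpow_le_rpow (by positivity) ?_ (by positivity))
    push_cast
    gcongr
  have h1 : algN a (t ^ j) ≤ (prodC a a + 1) * (wt a (m * n : ℕ) * ‖t‖ₑ ^ j) := by
    unfold algN
    gcongr
    exact (ht.sobN_pow_le hts h0 j).trans (by gcongr)
  have h2 : sobN a (t ^ j * e ^ (m - j)) ≤ ((prodC a a + 1) * (wt a (m * n : ℕ) * ‖t‖ₑ ^ j))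
      * ((prodC a a + 1) * algN a e ^ (m - j)) :=
    (sobN_le_algN a _).trans ((algN_mul_le ha _ _ (sobN_pow_ne_top ha he _)).trans
      (mul_le_mul' h1 (algN_pow_le ha he _)))
  have h3 : ‖(m.choose j : ℂ)‖ₑ = (m.choose j : ℝ≥0∞) := by
    rw [← ofReal_norm, Complex.norm_natCast, ENNReal.ofReal_natCast]
  rw [h3]
  calc _ ≤ (m.choose j : ℝ≥0∞) * (((prodC a a + 1) * (wt a (m * n : ℕ) * ‖t‖ₑ ^ j))
      * ((prodC a a + 1) * algN a e ^ (m - j))) := by gcongr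
    _ = _ := by ring

theorem tsum_wt_mul_pow_ne_top {a : ℝ} (ha : 0 ≤ a) (n : ℕ) {ρ : ℝ≥0∞} (hρ : ρ < 1) :
    ∑' m : ℕ, wt a (m * n : ℕ) * ρ ^ m ≠ ⊤ := by
  lift ρ to ℝ≥0 using (hρ.trans ENNReal.one_lt_top).ne
  have hρ1 : (ρ : ℝ) < 1 := by exact_mod_cast hρ
  set k := ⌈a⌉₊ with hk
  have hka : a ≤ k := Nat.le_ceil a
  have key : ∀ m : ℕ, wt a (m * n : ℕ) * (ρ : ℝ≥0∞) ^ m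
      ≤ ENNReal.ofReal (((1 + n : ℝ) ^ a) * (((m + 1 : ℕ) : ℝ) ^ k * (ρ : ℝ) ^ m)) := by
    intro m
    have e : (ρ : ℝ≥0∞) ^ m = ENNReal.ofReal ((ρ : ℝ) ^ m) := by
      rw [ENNReal.ofReal_pow (NNReal.coe_nonneg ρ), ENNReal.ofReal_coe_nnreal]
    rw [wt, e, ← ENNReal.ofReal_mul (by positivity), ← mul_assoc]
    refine ENNReal.ofReal_le_ofReal ?_
    gcongr
    have hm : (0 : ℝ) ≤ m := Nat.cast_nonneg m
    have hn : (0 : ℝ) ≤ n := Nat.cast_nonneg n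
    calc (1 + (((m * n : ℕ) : ℤ) : ℝ) ^ 2) ^ (a / 2)
        ≤ (((1 + n : ℝ) * (m + 1)) ^ (2 : ℝ)) ^ (a / 2) := by
          refine Real.rpow_le_rpow (by positivity) ?_ (by positivity)
          push_cast
          rw [Real.rpow_two]
          have h5 : (0 : ℝ) ≤ m * n := by positivity
          nlinarith
      _ = (1 + n : ℝ) ^ a * (m + 1 : ℝ) ^ a := by
          rw [← Real.rpow_mul (by positivity), ← Real.mul_rpow (by positivity) (by positivity)]
          congr 1
          ring
      _ ≤ (1 + n : ℝ) ^ a * (((m + 1 : ℕ) : ℝ)) ^ k := by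
          push_cast
          gcongr
          rw [← Real.rpow_natCast]
          exact Real.rpow_le_rpow_of_exponent_le (by linarith) hka
  have hs : Summable fun m : ℕ => ((1 + n : ℝ) ^ a) * (((m + 1 : ℕ) : ℝ) ^ k * (ρ : ℝ) ^ m) := by
    refine Summable.mul_left _ ?_
    by_cases h0 : (ρ : ℝ) = 0
    · refine summable_of_ne_finset_zero (s := {0}) fun m hm => ?_
      have : m ≠ 0 := by simpa using hm
      simp [h0, this]
    · have h1 := summable_pow_mul_geometric_of_norm_lt_one (R := ℝ) k
        (r := (ρ : ℝ)) (by rwa [Real.norm_of_nonneg (NNReal.coe_nonneg ρ)])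
      have h2 := ((summable_nat_add_iff 1).2 h1).mul_right ((ρ : ℝ)⁻¹)
      refine h2.congr fun m => ?_
      rw [pow_succ]
      field_simp
  refine ne_top_of_le_ne_top ?_ (ENNReal.tsum_le_tsum key)
  rw [← ENNReal.ofReal_tsum_of_nonneg (fun m => by positivity) hs]
  exact ENNReal.ofReal_ne_top

/-- The tails of a convergent series tend to zero. This supplies the polynomial part in the
reciprocal argument. -/
theorem tendsto_sobN_sub_trig {s : ℝ} {f : CT} (hf : sobN s f ≠ ⊤) :
    Filter.Tendsto (fun S => sobN s (f - trig S fun k => fc k f)) Filter.atTop (nhds 0) := by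
  have h1 : ∑' k, (wt s k * afc f k) ^ 2 ≠ ⊤ := by
    rw [← l2_sq]
    exact ENNReal.pow_ne_top hf
  have h2 := ENNReal.tendsto_tsum_compl_atTop_zero h1
  have h3 := (ENNReal.continuous_rpow_const (y := 1 / 2)).tendsto 0 |>.comp h2
  rw [ENNReal.zero_rpow_of_pos (by norm_num)] at h3
  refine h3.congr fun S => ?_
  rw [Function.comp_apply, sobN, wl2, l2]
  congr 1
  refine (tsum_subtype {k | k ∉ S} (fun k => (wt s k * afc f k) ^ 2)).trans ?_
  refine tsum_congr fun k => ?_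
  simp only [afc, map_sub, fc_trig]
  by_cases hk : k ∈ S <;> simp [Set.indicator, hk]

/-- Reciprocals of positive functions of class `H^a`, `a > 1/2`, are of class `H^a`, with locally
uniform bounds. -/
theorem exists_reciprocal_bound {a : ℝ} (ha : 1 / 2 < a) {f₀ : C(UnitAddCircle, ℝ)}
    (hpos : ∀ x, 0 < f₀ x) (hf₀ : sobN a (ofRealCT f₀) ≠ ⊤) :
    ∃ ε : ℝ≥0∞, 0 < ε ∧ ∃ M : ℝ≥0∞, M ≠ ⊤ ∧ ∀ f : CT, sobN a (f - ofRealCT f₀) ≤ ε →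
      ∃ g : CT, g * f = 1 ∧ sobN a g ≤ M := by
  obtain ⟨x0, hx0⟩ : ∃ x0, ∀ x, f₀ x0 ≤ f₀ x := by
    obtain ⟨x0, -, h⟩ := isCompact_univ.exists_isMinOn Set.univ_nonempty f₀.continuous.continuousOn
    exact ⟨x0, fun x => h (Set.mem_univ x)⟩
  -- Scaling by the maximum of f₀ puts 1 - f₀/c in [0, 1), so the reciprocal is a Neumann series
  -- convergent in sup norm.
  set c : ℝ := ‖f₀‖ with hc
  have hle : ∀ x, f₀ x ≤ c := fun x => (le_abs_self _).trans (f₀.norm_coe_le_norm x)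
  have hc0 : 0 < c := (hpos x0).trans_le (hle x0)
  set g₀ : CT := 1 - ((c⁻¹ : ℝ) : ℂ) • ofRealCT f₀ with hg₀
  set ρ₀ : ℝ := 1 - f₀ x0 / c with hρ₀
  have hρ₀0 : 0 ≤ ρ₀ := by
    rw [hρ₀, sub_nonneg, div_le_one hc0]
    exact hle x0
  have hρ₀1 : ρ₀ < 1 := by
    have := div_pos (hpos x0) hc0
    linarith
  have hg₀n : ‖g₀‖ ≤ ρ₀ := by
    refine (ContinuousMap.norm_le _ hρ₀0).2 fun x => ?_
    have e : g₀ x = ((1 - f₀ x / c : ℝ) : ℂ) := by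
      simp [hg₀]
      ring
    have h1 : f₀ x / c ≤ 1 := (div_le_one hc0).2 (hle x)
    rw [e, Complex.norm_real, Real.norm_of_nonneg (by linarith), hρ₀]
    have := div_le_div_of_nonneg_right (hx0 x) hc0.le
    linarith
  have hg₀s : sobN a g₀ ≠ ⊤ := by
    have e : g₀ = 1 + (-((c⁻¹ : ℝ) : ℂ)) • ofRealCT f₀ := by
      ext x
      simp [hg₀, sub_eq_add_neg]
    rw [e]
    refine ne_top_of_le_ne_top ?_ (sobN_add_le _ _ _)
    rw [sobN_one, sobN_smul]
    finiteness
  -- One condition serves two ends: it keeps ‖t‖ + (prodC + 1)(δ + δ) below 1, where ‖t‖ ≤ ρ₀ + embC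
  -- · δ, and it keeps the sup norm of t + e below 1.
  obtain ⟨δ, hδ0, hδ⟩ : ∃ δ : ℝ≥0∞, 0 < δ ∧
      ENNReal.ofReal ρ₀ + (embC a + (prodC a a + 1)) * δ + (prodC a a + 1) * δ < 1 := by
    have hK := prodC_ne_top (s := a) (by linarith) ha
    have hE := embC_ne_top ha
    have ht : Filter.Tendsto (fun δ : ℝ≥0∞ => ENNReal.ofReal ρ₀ + (embC a + (prodC a a + 1)) * δ
        + (prodC a a + 1) * δ) (nhds 0) (nhds (ENNReal.ofReal ρ₀
          + (embC a + (prodC a a + 1)) * 0 + (prodC a a + 1) * 0)) := by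
      refine Filter.Tendsto.add (Filter.Tendsto.add tendsto_const_nhds ?_) ?_
      · exact ENNReal.Tendsto.const_mul Filter.tendsto_id (Or.inr (by finiteness))
      · exact ENNReal.Tendsto.const_mul Filter.tendsto_id (Or.inr (by finiteness))
    have h1 : ENNReal.ofReal ρ₀ + (embC a + (prodC a a + 1)) * 0 + (prodC a a + 1) * 0 < 1 := by
      simpa using hρ₀1
    have h2 := ht.eventually (gt_mem_nhds h1)
    rw [ENNReal.nhds_zero_basis.eventually_iff] at h2
    obtain ⟨η, hη, h⟩ := h2
    obtain ⟨δ, hδ0, hδ1⟩ := exists_between hη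
    exact ⟨δ, hδ0, h hδ1⟩
  obtain ⟨S, hS⟩ : ∃ S : Finset ℤ, sobN a (g₀ - trig S fun k => fc k g₀) ≤ δ :=
    ((tendsto_sobN_sub_trig hg₀s).eventually (ge_mem_nhds hδ0)).exists
  set t := trig S fun k => fc k g₀ with ht
  obtain ⟨n, hn⟩ := exists_spec_trig S fun k => fc k g₀
  have hts := tsum_afc_trig S fun k => fc k g₀
  have htn : ‖t‖ₑ ≤ ENNReal.ofReal ρ₀ + embC a * δ := by
    have e : t = g₀ - (g₀ - t) := (sub_sub_cancel _ _).symm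
    rw [e]
    refine (enorm_sub_le).trans (add_le_add ?_ ((enorm_le_sobN ha _).trans (by gcongr)))
    rw [← ofReal_norm]
    exact ENNReal.ofReal_le_ofReal hg₀n
  set ρ : ℝ≥0∞ := ‖t‖ₑ + (prodC a a + 1) * (δ + δ) with hρ
  have hρ1 : ρ < 1 := by
    refine lt_of_le_of_lt ?_ hδ
    rw [hρ]
    calc _ ≤ ENNReal.ofReal ρ₀ + embC a * δ + (prodC a a + 1) * (δ + δ) := by gcongr
      _ = _ := by ring
  refine ⟨δ * ENNReal.ofReal c, ENNReal.mul_pos hδ0.ne' (ENNReal.ofReal_pos.2 hc0).ne',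
    ‖((c⁻¹ : ℝ) : ℂ)‖ₑ * ∑' m : ℕ, (prodC a a + 1) ^ 2 * (wt a (m * n : ℕ) * ρ ^ m), ?_,
    fun f hf => ?_⟩
  · rw [ENNReal.tsum_mul_left]
    have := tsum_wt_mul_pow_ne_top (a := a) (by linarith) n hρ1
    have hK := prodC_ne_top (s := a) (by linarith) ha
    finiteness
  have hcc : ‖((c⁻¹ : ℝ) : ℂ)‖ₑ * ENNReal.ofReal c = 1 := by
    rw [← ofReal_norm, Complex.norm_real, Real.norm_of_nonneg (by positivity),
      ← ENNReal.ofReal_mul (by positivity), inv_mul_cancel₀ hc0.ne', ENNReal.ofReal_one]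
  -- Only e depends on f. The polynomial t, its degree n and the ratio ρ are fixed by f₀, which
  -- makes the bound uniform near f₀.
  set e : CT := (g₀ - t) + (-((c⁻¹ : ℝ) : ℂ)) • (f - ofRealCT f₀) with he
  have hes : sobN a e ≤ δ + δ := by
    refine (sobN_add_le _ _ _).trans (add_le_add hS ?_)
    rw [sobN_smul, enorm_neg]
    calc _ ≤ ‖((c⁻¹ : ℝ) : ℂ)‖ₑ * (δ * ENNReal.ofReal c) := by gcongr
      _ = δ * (‖((c⁻¹ : ℝ) : ℂ)‖ₑ * ENNReal.ofReal c) := by ring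
      _ = δ := by rw [hcc, mul_one]
  have hδt : δ ≠ ⊤ := by
    rintro rfl
    have : (prodC a a + 1) * ⊤ = (⊤ : ℝ≥0∞) := ENNReal.mul_top (by simp)
    rw [this] at hδ
    simp at hδ
  have hest : sobN a e ≠ ⊤ := ne_top_of_le_ne_top (by finiteness) hes
  have hsum : t + e = 1 - ((c⁻¹ : ℝ) : ℂ) • f := by
    ext x
    simp [he, hg₀]
    ring
  have hpow : ∀ m : ℕ, sobN a ((t + e) ^ m)
      ≤ (prodC a a + 1) ^ 2 * (wt a (m * n : ℕ) * ρ ^ m) := fun m => by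
    refine (sobN_add_pow_le ha hn hts hest m).trans ?_
    have : ‖t‖ₑ + algN a e ≤ ρ := by
      rw [hρ, algN]
      gcongr
    gcongr
  have hnorm : ‖t + e‖ < 1 := by
    have h1 : ‖t + e‖ₑ < 1 := by
      refine lt_of_le_of_lt ?_ hδ
      calc ‖t + e‖ₑ ≤ ‖g₀‖ₑ + ‖((c⁻¹ : ℝ) : ℂ) • (f - ofRealCT f₀)‖ₑ := by
            have e3 : t + e = g₀ - ((c⁻¹ : ℝ) : ℂ) • (f - ofRealCT f₀) := by
              ext x
              simp [he]
              ring
            rw [e3]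
            exact enorm_sub_le
        _ ≤ ENNReal.ofReal ρ₀ + embC a * δ := by
            refine add_le_add ?_ ((enorm_le_sobN ha _).trans ?_)
            · rw [← ofReal_norm]
              exact ENNReal.ofReal_le_ofReal hg₀n
            · gcongr
              rw [sobN_smul]
              calc _ ≤ ‖((c⁻¹ : ℝ) : ℂ)‖ₑ * (δ * ENNReal.ofReal c) := by gcongr
                _ = δ * (‖((c⁻¹ : ℝ) : ℂ)‖ₑ * ENNReal.ofReal c) := by ring
                _ = δ := by rw [hcc, mul_one]
        _ ≤ ENNReal.ofReal ρ₀ + (embC a + (prodC a a + 1)) * δ := by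
            gcongr
            exact le_self_add
        _ ≤ _ := le_self_add
    rw [← ofReal_norm, ← ENNReal.ofReal_one, ENNReal.ofReal_lt_ofReal_iff one_pos] at h1
    exact h1
  have hgeo := (summable_geometric_of_norm_lt_one hnorm).hasSum
  refine ⟨((c⁻¹ : ℝ) : ℂ) • ∑' m : ℕ, (t + e) ^ m, ?_, ?_⟩
  · have h1 := geom_series_mul_neg (t + e) hnorm
    rw [hsum, sub_sub_cancel, ← hsum] at h1
    rw [smul_mul_assoc, ← mul_smul_comm]
    exact h1
  · rw [sobN_smul]
    gcongr
    exact (sobN_le_tsum hgeo).trans (ENNReal.tsum_le_tsum hpow)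

end

end CircleSobolev

/-! ### Translation between coefficient sequences and functions; locally uniform control of
diffeomorphisms. -/

namespace CircleSobolev

noncomputable section

open scoped ENNReal NNReal

open AddCircle (haarAddCircle)

/-! ### Sobolev classes and continuous functions -/

namespace Sob

variable {q : ℝ}

theorem enorm_eq (u : Sob q) : ‖u‖ₑ = wl2 q fun k => ‖u.coeff k‖ₑ := by
  have h : ‖u‖ₑ ^ 2 = (wl2 q fun k => ‖u.coeff k‖ₑ) ^ 2 := by
    unfold wl2
    rw [l2_sq, ← ofReal_norm, ← ENNReal.ofReal_pow (norm_nonneg _), Sob.norm_sq,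
      ENNReal.ofReal_tsum_of_nonneg (fun k => by positivity) u.summable]
    refine tsum_congr fun k => ?_
    dsimp only
    rw [mul_pow, wt_sq, wt, ← ofReal_norm, ← ENNReal.ofReal_pow (norm_nonneg _),
      ← ENNReal.ofReal_mul (by positivity)]
    congr 3
    ring
  exact le_antisymm (le_of_sq_le_sq_ennreal h.le) (le_of_sq_le_sq_ennreal h.ge)

/-- The element with prescribed coefficients of finite norm. -/
def ofSeq (a : ℤ → ℂ) (h : wl2 q (fun k => ‖a k‖ₑ) ≠ ⊤) : Sob q :=
  Sob.mk a (by
    have h1 : (wl2 q fun k => ‖a k‖ₑ) ^ 2 ≠ ⊤ := ENNReal.pow_ne_top h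
    unfold wl2 at h1
    rw [l2_sq] at h1
    have h2 := ENNReal.summable_toReal h1
    refine h2.congr fun k => ?_
    dsimp only
    rw [mul_pow, wt_sq, wt, ← ofReal_norm, ← ENNReal.ofReal_pow (norm_nonneg _),
      ← ENNReal.ofReal_mul (by positivity), ENNReal.toReal_ofReal (by positivity)]
    congr 2
    ring)

/-- The continuous function represented by `u`, for `q > 1/2`. -/
def toCT (u : Sob q) : CT := ofCoeff u.coeff

theorem fc_toCT (hq : 1 / 2 < q) (u : Sob q) (k : ℤ) : fc k u.toCT = u.coeff k :=
  fc_ofCoeff (u.summable_coeff hq) k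

theorem toCT_apply (hq : 1 / 2 < q) (u : Sob q) (x : UnitAddCircle) : u.toCT x = u.eval x := by
  have h := (ContinuousMap.evalCLM ℂ x).hasSum (hasSum_ofCoeff (u.summable_coeff hq))
  exact h.tsum_eq.symm

theorem sobN_toCT (hq : 1 / 2 < q) (u : Sob q) : sobN q u.toCT = ‖u‖ₑ := by
  rw [enorm_eq]
  unfold sobN
  congr 1
  funext k
  rw [afc, fc_toCT hq]

theorem tsum_afc_toCT (hq : 1 / 2 < q) (u : Sob q) : ∑' k, afc u.toCT k ≠ ⊤ :=
  tsum_afc_ne_top hq (by rw [sobN_toCT hq]; exact enorm_ne_top)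

theorem toCT_eq_of_fc (hq : 1 / 2 < q) (u : Sob q) {f : CT} (h : ∀ k, fc k f = u.coeff k) :
    u.toCT = f :=
  ext_fc (u.tsum_afc_toCT hq) fun k => by rw [fc_toCT hq, h]

theorem toCT_add (hq : 1 / 2 < q) (u v : Sob q) : (u + v).toCT = u.toCT + v.toCT :=
  toCT_eq_of_fc hq _ fun k => by rw [map_add, fc_toCT hq, fc_toCT hq, coeff_add]

theorem toCT_smul (hq : 1 / 2 < q) (c : ℂ) (u : Sob q) : (c • u).toCT = c • u.toCT :=
  toCT_eq_of_fc hq _ fun k => by rw [map_smul, fc_toCT hq, coeff_smul, smul_eq_mul]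

/-- The Sobolev class of a continuous function. -/
def ofCT (f : CT) (hf : sobN q f ≠ ⊤) : Sob q := ofSeq (fun k => fc k f) hf

theorem toCT_ofCT (hq : 1 / 2 < q) (f : CT) (hf : sobN q f ≠ ⊤) : (ofCT f hf).toCT = f :=
  toCT_eq_of_fc hq _ fun _ => rfl

/-- The derivative of `u`, for `q > 3/2`. -/
def derCT (u : Sob q) : CT := ofCoeff fun k => tpi k * u.coeff k

theorem summable_tpi_coeff (hq : 3 / 2 < q) (u : Sob q) :
    Summable fun k => ‖tpi k * u.coeff k‖ := by
  obtain ⟨C, -, hC⟩ := Sob.exists_l1_bound (q := q) (s := 1) (by linarith)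
  refine Summable.of_nonneg_of_le (fun k => norm_nonneg _) (fun k => ?_)
    ((hC u).1.mul_left (2 * Real.pi))
  rw [norm_mul, norm_tpi, mul_assoc]
  gcongr
  rw [← Real.sqrt_eq_rpow]
  exact Real.abs_le_sqrt (by linarith)

theorem fc_derCT (hq : 3 / 2 < q) (u : Sob q) (k : ℤ) : fc k u.derCT = tpi k * u.coeff k :=
  fc_ofCoeff (u.summable_tpi_coeff hq) k

theorem tsum_afc_derCT (hq : 3 / 2 < q) (u : Sob q) : ∑' k, afc u.derCT k ≠ ⊤ := by
  have h1 : Summable fun k => ‖tpi k * u.coeff k‖₊ :=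
    NNReal.summable_coe.1 (u.summable_tpi_coeff hq)
  have h2 : afc u.derCT = fun k => (‖tpi k * u.coeff k‖₊ : ℝ≥0∞) := funext fun k => by
    rw [afc, fc_derCT hq]
    rfl
  rw [h2]
  exact ENNReal.tsum_coe_ne_top_iff_summable.2 h1

theorem isDer_toCT (hq : 3 / 2 < q) (u : Sob q) : IsDer u.toCT u.derCT :=
  isDer_of_fc (u.tsum_afc_toCT (by linarith)) (u.tsum_afc_derCT hq)
    fun k => by rw [fc_derCT hq, fc_toCT (by linarith)]

theorem sobN_derCT_le (hq : 3 / 2 < q) (u : Sob q) :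
    sobN (q - 1) u.derCT ≤ ENNReal.ofReal (2 * Real.pi) * ‖u‖ₑ := by
  have := (u.isDer_toCT hq).sobN_der_le (q - 1)
  rwa [sub_add_cancel, sobN_toCT (by linarith)] at this

theorem derCT_eq_of_isDer (hq : 3 / 2 < q) (u : Sob q) {f' : CT} (h : IsDer u.toCT f') :
    u.derCT = f' :=
  ext_fc (u.tsum_afc_derCT hq) fun k => by rw [h.fc_eq, fc_derCT hq, fc_toCT (by linarith)]

theorem derCT_add (hq : 3 / 2 < q) (u v : Sob q) : (u + v).derCT = u.derCT + v.derCT :=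
  ext_fc (tsum_afc_derCT hq _) fun k => by
    rw [map_add, fc_derCT hq, fc_derCT hq, fc_derCT hq, coeff_add, mul_add]

theorem derCT_smul (hq : 3 / 2 < q) (c : ℂ) (u : Sob q) : (c • u).derCT = c • u.derCT :=
  ext_fc (tsum_afc_derCT hq _) fun k => by
    rw [map_smul, fc_derCT hq, fc_derCT hq, coeff_smul, smul_eq_mul, mul_left_comm]

end Sob

/-! ### Diffeomorphisms with a given lift -/

theorem eq_coe_of_circle (x : UnitAddCircle) : ∃ y : ℝ, (y : UnitAddCircle) = x := by
  induction x using QuotientAddGroup.induction_on with | H y => exact ⟨y, rfl⟩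

theorem continuous_circle_iff {X : Type*} [TopologicalSpace X] {f : UnitAddCircle → X} :
    Continuous f ↔ Continuous fun x : ℝ => f (x : UnitAddCircle) :=
  QuotientAddGroup.isOpenQuotientMap_mk.isQuotientMap.continuous_iff

namespace Dif

/-- The diffeomorphism with a given lift. -/
def ofLift (Φ d : ℝ → ℝ) (hd : ∀ x, HasDerivAt Φ (d x) x) (h1 : ∀ x, Φ (x + 1) = Φ x + 1)
    (hper : Function.Periodic d 1) (hc : Continuous d) (hpos : ∀ x, 0 < d x) : Dif where
  toMap := ⟨Function.Periodic.lift (f := fun x : ℝ => ((Φ x : ℝ) : UnitAddCircle)) (c := (1 : ℝ))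
      fun x => by
        change ((Φ (x + 1) : ℝ) : UnitAddCircle) = _
        rw [h1]
        exact AddCircle.coe_add_period 1 _, continuous_circle_iff.2
      ((AddCircle.continuous_mk' 1).comp
        (continuous_iff_continuousAt.2 fun x => (hd x).continuousAt))⟩
  d := ⟨hper.lift, continuous_circle_iff.2 hc⟩
  lift := Φ
  lift_coe _ := rfl
  hasDeriv := hd
  lift_add_one := h1
  d_pos x := by
    obtain ⟨y, rfl⟩ := eq_coe_of_circle x
    exact hpos y

theorem continuous_lift (D : Dif) : Continuous D.lift :=
  continuous_iff_continuousAt.2 fun x => (D.hasDeriv x).continuousAt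

theorem strictMono_lift (D : Dif) : StrictMono D.lift :=
  strictMono_of_deriv_pos fun x => by rw [(D.hasDeriv x).deriv]; exact D.d_pos _

theorem lift_add_nat (D : Dif) (x : ℝ) (n : ℕ) : D.lift (x + n) = D.lift x + n := by
  induction n with
  | zero => simp
  | succ n ih =>
    push_cast
    rw [← add_assoc, D.lift_add_one, ih]
    ring

theorem lift_surjective (D : Dif) : Function.Surjective D.lift := by
  intro y
  obtain ⟨n, hn⟩ := exists_nat_ge |y - D.lift 0|
  have h1 := D.lift_add_nat 0 n
  have h2 := D.lift_add_nat (-n) n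
  rw [neg_add_cancel] at h2
  rw [zero_add] at h1
  have h3 := abs_le.1 hn
  have hle : (-(n : ℝ)) ≤ n := by linarith [Nat.cast_nonneg (α := ℝ) n]
  obtain ⟨x, -, hx⟩ := intermediate_value_Icc hle D.continuous_lift.continuousOn
    (show y ∈ Set.Icc _ _ from ⟨by linarith [h3.1], by linarith [h3.2]⟩)
  exact ⟨x, hx⟩

/-- The lift is an increasing bijection of the line; its inverse is differentiable because the
derivative does not vanish, and commutes with integer translation. -/
theorem exists_inv (D : Dif) : ∃ E : Dif, D.IsInv E := by
  set e := D.strictMono_lift.orderIsoOfSurjective D.lift D.lift_surjective with he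
  have hel : ∀ y, D.lift (e.symm y) = y := fun y => e.apply_symm_apply y
  have her : ∀ x, e.symm (D.lift x) = x := fun x => e.symm_apply_apply x
  have hcont : Continuous e.symm := e.symm.continuous
  have h1 : ∀ y, e.symm (y + 1) = e.symm y + 1 := fun y => by
    apply D.strictMono_lift.injective
    rw [hel, D.lift_add_one, hel]
  have hd : ∀ y, HasDerivAt e.symm (D.d (e.symm y : ℝ))⁻¹ y := fun y =>
    HasDerivAt.of_local_left_inverse hcont.continuousAt (D.hasDeriv _) (D.d_pos _).ne'
      (Filter.Eventually.of_forall hel)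
  have hc : Continuous fun y => (D.d ((e.symm y : ℝ) : UnitAddCircle))⁻¹ :=
    (D.d.continuous.comp ((AddCircle.continuous_mk' 1).comp hcont)).inv₀ fun y => (D.d_pos _).ne'
  refine ⟨ofLift e.symm (fun y => (D.d ((e.symm y : ℝ) : UnitAddCircle))⁻¹) hd h1 (fun y => ?_) hc
    (fun y => inv_pos.2 (D.d_pos _)), ⟨fun x => ?_, fun x => ?_, fun x => ?_⟩⟩
  · simp only [h1]
    congr 2
    exact AddCircle.coe_add_period 1 _
  · obtain ⟨y, rfl⟩ := eq_coe_of_circle x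
    change D.toMap ((e.symm y : ℝ) : UnitAddCircle) = _
    rw [← D.lift_coe, hel]
  · obtain ⟨y, rfl⟩ := eq_coe_of_circle x
    rw [← D.lift_coe]
    change ((e.symm (D.lift y) : ℝ) : UnitAddCircle) = _
    rw [her]
  · obtain ⟨y, rfl⟩ := eq_coe_of_circle x
    change (D.d ((e.symm y : ℝ) : UnitAddCircle))⁻¹ * D.d ((e.symm y : ℝ) : UnitAddCircle) = 1
    exact inv_mul_cancel₀ (D.d_pos _).ne'

end Dif

section

variable {q : ℝ}

theorem RSob.toCT_coe (hq : 1 / 2 < q) (u : RSob q) (x : ℝ) :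
    u.1.toCT (x : UnitAddCircle) = (u.fn x : ℂ) := by
  rw [Sob.toCT_apply hq, u.coe_fn]

theorem RSob.derCT_coe (hq : 3 / 2 < q) (u : RSob q) (x : ℝ) :
    u.1.derCT (x : UnitAddCircle) = (u.dfn x : ℂ) := by
  have h1 := u.1.isDer_toCT hq x
  have h2 : HasDerivAt u.fn (u.dfn x) x := by
    have h := (u.hasDerivAt_lift hq x).sub (hasDerivAt_id x)
    rw [add_sub_cancel_left] at h
    refine h.congr_of_eventuallyEq (Filter.Eventually.of_forall fun y => ?_)
    change u.fn y = u.lift y - y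
    unfold RSob.lift
    ring
  have h3 := h2.ofReal_comp
  simp only [RSob.toCT_coe (by linarith : 1 / 2 < q)] at h1
  exact h1.unique h3

/-- The diffeomorphism with lift `x ↦ x + u(x)`. -/
def difOf (hq : 3 / 2 < q) (u : RSob q) (hu : u ∈ diffLifts q) : Dif :=
  Dif.ofLift u.lift (fun x => 1 + u.dfn x) (u.hasDerivAt_lift hq) u.lift_add_one
    (fun x => by simp only [u.dfn_add_one]) (continuous_const.add (u.continuous_dfn hq))
    ((mem_diffLifts_iff hq u).1 hu)

theorem difOf_dC (hq : 3 / 2 < q) (u : RSob q) (hu : u ∈ diffLifts q) :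
    (difOf hq u hu).dC = 1 + u.1.derCT := by
  ext x
  obtain ⟨y, rfl⟩ := eq_coe_of_circle x
  rw [ContinuousMap.add_apply, RSob.derCT_coe hq]
  change ((1 + u.dfn y : ℝ) : ℂ) = _
  simp

theorem Dif.bdd_of_norm_le {D : Dif} {M : ℝ} {g : CT} (hg : g * D.dC = 1) (h1 : ‖D.dC‖ ≤ M)
    (h2 : ‖g‖ ≤ M) : D.Bdd M := by
  intro x
  have e : ‖D.dC x‖ = D.d x := by
    rw [dC, ofRealCT_apply, Complex.norm_real, Real.norm_of_nonneg (D.d_pos x).le]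
  constructor
  · rw [← e]
    exact (D.dC.norm_coe_le_norm x).trans h1
  · have h3 : ‖g x‖ * D.d x = 1 := by
      rw [← e, ← norm_mul, ← ContinuousMap.mul_apply, hg, ContinuousMap.one_apply, norm_one]
    have h4 := mul_le_mul_of_nonneg_right ((g.norm_coe_le_norm x).trans h2) (D.d_pos x).le
    linarith

/-- Near u₀ a single number bounds everything the translation estimates ask for: the derivative and
its reciprocal, in H^{q-1} and in sup norm. -/
theorem exists_local_ctrl (hq : 3 / 2 < q) {u₀ : RSob q} (hu₀ : u₀ ∈ diffLifts q) :
    ∃ δ > 0, ∃ M : ℝ, ∀ u : RSob q, ‖u - u₀‖ < δ → ∃ hu : u ∈ diffLifts q,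
      (difOf hq u hu).Ctrl (q - 1) M ∧
      ∃ g : CT, g * (difOf hq u hu).dC = 1 ∧ sobN (q - 1) g ≤ ENNReal.ofReal M := by
  have ha : 1 / 2 < q - 1 := by linarith
  have hN : ∀ u : RSob q, sobN (q - 1) (1 + u.1.derCT) ≤ 1 + ENNReal.ofReal (2 * Real.pi) * ‖u‖ₑ :=
    fun u => (sobN_add_le _ _ _).trans
      (add_le_add (sobN_one _).le (u.1.sobN_derCT_le hq))
  obtain ⟨ε, hε, M₁, hM₁, h⟩ := exists_reciprocal_bound ha (difOf hq u₀ hu₀).d_pos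
    (ne_top_of_le_ne_top (by finiteness) ((difOf_dC hq u₀ hu₀) ▸ hN u₀ :
      sobN (q - 1) (difOf hq u₀ hu₀).dC ≤ _))
  obtain ⟨δ₁, hδ₁, hball⟩ := Metric.isOpen_iff.1 (isOpen_diffLifts hq) u₀ hu₀
  obtain ⟨δ₂, hδ₂, hδε⟩ : ∃ δ₂ : ℝ, 0 < δ₂ ∧ ENNReal.ofReal (2 * Real.pi) * ENNReal.ofReal δ₂ ≤ ε := by
    have ht : Filter.Tendsto (fun t : ℝ => ENNReal.ofReal (2 * Real.pi) * ENNReal.ofReal t)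
        (nhdsWithin 0 (Set.Ioi 0)) (nhds (ENNReal.ofReal (2 * Real.pi) * ENNReal.ofReal 0)) :=
      (ENNReal.Tendsto.const_mul ((ENNReal.continuous_ofReal.tendsto 0))
        (Or.inr ENNReal.ofReal_ne_top)).mono_left nhdsWithin_le_nhds
    rw [ENNReal.ofReal_zero, mul_zero] at ht
    obtain ⟨t, h1, h2⟩ := ((ht.eventually (ge_mem_nhds hε)).and self_mem_nhdsWithin).exists
    exact ⟨t, h2, h1⟩
  set B : ℝ≥0∞ := 1 + ENNReal.ofReal (2 * Real.pi) * ENNReal.ofReal (‖u₀‖ + δ₁) with hB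
  have hBt : B ≠ ⊤ := by finiteness
  -- B and M₁ bound the derivative and its reciprocal in H^{q-1}; multiplied by the embedding
  -- constant they bound the sup norms.
  set M : ℝ := (B + M₁ + embC (q - 1) * B + embC (q - 1) * M₁).toReal with hM
  have hE := embC_ne_top ha
  have hMM : ENNReal.ofReal M = B + M₁ + embC (q - 1) * B + embC (q - 1) * M₁ :=
    ENNReal.ofReal_toReal (by finiteness)
  have hle : ∀ {f : CT} , ‖f‖ₑ ≤ ENNReal.ofReal M → ‖f‖ ≤ M := fun {f} hf => by
    rw [← ofReal_norm] at hf
    exact (ENNReal.ofReal_le_ofReal_iff ENNReal.toReal_nonneg).1 hf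
  refine ⟨min δ₁ δ₂, lt_min hδ₁ hδ₂, M, fun u hu => ?_⟩
  have hud : u ∈ diffLifts q := hball (by
    rw [Metric.mem_ball, dist_eq_norm]
    exact hu.trans_le (min_le_left _ _))
  have hdN : sobN (q - 1) (difOf hq u hud).dC ≤ B := by
    rw [difOf_dC]
    refine (hN u).trans ?_
    rw [hB, ← ofReal_norm]
    gcongr
    have h1 : ‖u‖ ≤ ‖u₀‖ + ‖u - u₀‖ := by
      have := norm_add_le u₀ (u - u₀)
      rwa [add_sub_cancel] at this
    linarith [hu.trans_le (min_le_left _ _)]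
  obtain ⟨g, hg1, hg2⟩ := h (difOf hq u hud).dC (by
    have e : (difOf hq u hud).dC - ofRealCT (difOf hq u₀ hu₀).d = (u - u₀).1.derCT := by
      have e1 : ofRealCT (difOf hq u₀ hu₀).d = 1 + u₀.1.derCT := difOf_dC hq u₀ hu₀
      have e2 : u.1.derCT = u₀.1.derCT + (u - u₀).1.derCT := by
        rw [← Sob.derCT_add hq]
        congr 1
        exact (add_sub_cancel u₀.1 u.1).symm
      rw [difOf_dC, e1, e2]
      ring
    rw [e]
    refine ((u - u₀).1.sobN_derCT_le hq).trans (le_trans ?_ hδε)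
    gcongr
    rw [← ofReal_norm]
    exact ENNReal.ofReal_le_ofReal (hu.le.trans (min_le_right _ _)))
  refine ⟨hud, ⟨Dif.bdd_of_norm_le hg1 (hle ?_) (hle ?_), ?_⟩, g, hg1, ?_⟩
  · refine (enorm_le_sobN ha _).trans ?_
    rw [hMM]
    calc _ ≤ embC (q - 1) * B := by gcongr
      _ ≤ B + M₁ + embC (q - 1) * B := le_add_self
      _ ≤ _ := le_self_add
  · refine (enorm_le_sobN ha _).trans ?_
    rw [hMM]
    calc _ ≤ embC (q - 1) * M₁ := by gcongr
      _ ≤ _ := le_add_self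
  · rw [hMM, add_assoc, add_assoc]
    exact hdN.trans le_self_add
  · rw [hMM, add_assoc, add_assoc, add_left_comm]
    exact hg2.trans le_self_add

/-- Locally uniform bounds for right translations by diffeomorphisms and their inverses. -/
theorem exists_local_rtBound (hq : 3 / 2 < q) {s : ℝ} (hs : 0 ≤ s) (hsq : s ≤ q) {u₀ : RSob q}
    (hu₀ : u₀ ∈ diffLifts q) :
    ∃ δ > 0, ∃ C : ℝ≥0∞, C ≠ ⊤ ∧ ∀ u : RSob q, ‖u - u₀‖ < δ → ∃ hu : u ∈ diffLifts q,
      RtBound (difOf hq u hu) s C ∧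
        ∀ E, (difOf hq u hu).IsInv E → RtBound E q C := by
  obtain ⟨δ, hδ, M, h⟩ := exists_local_ctrl hq hu₀
  obtain ⟨n, hn⟩ := exists_nat_ge q
  obtain ⟨C₁, hC₁, h₁⟩ := exists_rtBound hq M n s hs (by linarith) hsq
  obtain ⟨C₂, hC₂, h₂⟩ := exists_rtBound_inv hq M n q (by linarith) (by linarith) le_rfl
  refine ⟨δ, hδ, C₁ + C₂, by finiteness, fun u hu => ?_⟩
  obtain ⟨hud, hc, hg⟩ := h u hu
  refine ⟨hud, fun S c => (h₁ _ hc S c).trans ?_, fun E hE S c =>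
    (h₂ _ E hc.1 hE hg S c).trans ?_⟩
  · gcongr
    exact le_self_add
  · gcongr
    exact le_add_self

end

end

end CircleSobolev

/-! ### From the derivatives of ξ^{n-1} p(ξ) to uniform discrete symbol estimates. -/

namespace CircleSobolev

noncomputable section

open scoped ENNReal NNReal

/-! ### Finite differences and derivatives -/

/-- The fundamental theorem for real absolutely continuous functions, applied to Re(cF) with |c| =
1. -/
theorem norm_sub_le_of_absolutelyContinuous {F : ℝ → ℂ} {a b B : ℝ} (hab : a ≤ b)
    (hF : AbsolutelyContinuousOnInterval F a b)
    (hB : ∀ᵐ x : ℝ, x ∈ Set.Icc a b → ‖deriv F x‖ ≤ B) : ‖F b - F a‖ ≤ B * (b - a) := by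
  have hBV := hF.boundedVariationOn
  have hdiff := hBV.ae_differentiableAt_of_mem_uIcc
  have key : ∀ c : ℂ, ‖c‖ = 1 → (c * (F b - F a)).re ≤ B * (b - a) := by
    intro c hc
    set g : ℝ → ℝ := fun x => (c * F x).re with hg
    have hgac : AbsolutelyContinuousOnInterval g a b := by
      rw [absolutelyContinuousOnInterval_iff] at hF ⊢
      intro ε hε
      obtain ⟨δ, hδ, h⟩ := hF ε hε
      refine ⟨δ, hδ, fun E hE hlen => lt_of_le_of_lt (Finset.sum_le_sum fun i _ => ?_) (h E hE hlen)⟩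
      rw [hg, Real.dist_eq, ← Complex.sub_re, ← mul_sub, dist_eq_norm]
      refine (Complex.abs_re_le_norm _).trans ?_
      rw [norm_mul, hc, one_mul]
    have h1 := hgac.integral_deriv_eq_sub
    have h2 : ‖∫ x in a..b, deriv g x‖ ≤ B * |b - a| := by
      refine intervalIntegral.norm_integral_le_of_norm_le_const_ae ?_
      filter_upwards [hdiff, hB] with x hx hBx hxm
      rw [Set.uIoc_of_le hab] at hxm
      have hxI : x ∈ Set.Icc a b := Set.Ioc_subset_Icc_self hxm
      have hd := (hx (by rwa [Set.uIcc_of_le hab])).hasDerivAt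
      have hd2 : HasDerivAt g (c * deriv F x).re x :=
        Complex.reCLM.hasFDerivAt.comp_hasDerivAt x (hd.const_mul c)
      rw [hd2.deriv, Real.norm_eq_abs]
      refine (Complex.abs_re_le_norm _).trans ?_
      rw [norm_mul, hc, one_mul]
      exact hBx hxI
    rw [h1, abs_of_nonneg (sub_nonneg.2 hab)] at h2
    rw [mul_sub, Complex.sub_re]
    exact (le_abs_self _).trans h2
  by_cases h0 : F b - F a = 0
  · rw [h0, norm_zero]
    have := key 1 norm_one
    simpa [h0] using this
  · have hn : (‖F b - F a‖ : ℂ) ≠ 0 := by simpa using h0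
    -- This rotation makes c(F b - F a) equal to its absolute value.
    have := key (conj (F b - F a) / ‖F b - F a‖) (by
      rw [norm_div, RCLike.norm_conj, Complex.norm_real, norm_norm,
        div_self (by simpa using h0)])
    rwa [div_mul_eq_mul_div, mul_comm, Complex.mul_conj, Complex.normSq_eq_norm_sq, ← Complex.ofReal_div,
      Complex.ofReal_re, sq, mul_div_assoc, div_self (by simpa using h0), mul_one] at this

theorem contDiff_fwdDiff {n : ℕ} {f : ℝ → ℂ} (hf : ContDiff ℝ n f) :
    ContDiff ℝ n (fwdDiff (1 : ℝ) f) := by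
  unfold fwdDiff
  fun_prop

theorem iteratedDeriv_fwdDiff {n : ℕ} {f : ℝ → ℂ} (hf : ContDiff ℝ n f) (x : ℝ) :
    iteratedDeriv n (fwdDiff (1 : ℝ) f) x = iteratedDeriv n f (x + 1) - iteratedDeriv n f x := by
  have h1 : ContDiff ℝ n fun z => f (z + 1) := by fun_prop
  have h2 : fwdDiff (1 : ℝ) f = (fun z => f (z + 1)) - f := rfl
  rw [h2, iteratedDeriv_sub h1.contDiffAt hf.contDiffAt, iteratedDeriv_comp_add_const]

/-- Each unit difference is exchanged for a derivative by the mean value inequality, widening the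
interval by one. -/
theorem norm_fwdDiff_iter_le (n : ℕ) : ∀ {f : ℝ → ℂ} {B x : ℝ}, ContDiff ℝ n f →
    (∀ y ∈ Set.Icc x (x + n), ‖iteratedDeriv n f y‖ ≤ B) → ‖(fwdDiff (1 : ℝ))^[n] f x‖ ≤ B := by
  induction n with
  | zero =>
    intro f B x _ h
    simpa using h x (by simp)
  | succ n ih =>
    intro f B x hf h
    rw [Function.iterate_succ_apply]
    have hf' : ContDiff ℝ n f := hf.of_le (by exact_mod_cast Nat.le_succ n)
    refine ih (contDiff_fwdDiff hf') fun y hy => ?_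
    rw [iteratedDeriv_fwdDiff hf']
    have hd : Differentiable ℝ (iteratedDeriv n f) :=
      hf.differentiable_iteratedDeriv n (by exact_mod_cast Nat.lt_succ_self n)
    have := Convex.norm_image_sub_le_of_norm_deriv_le (f := iteratedDeriv n f) (C := B)
      (s := Set.Icc y (y + 1)) (x := y) (y := y + 1) (fun z _ => hd z) (fun z hz => by
        rw [← iteratedDeriv_succ]
        refine h z ⟨hy.1.trans hz.1, ?_⟩
        push_cast
        linarith [hz.2, hy.2]) (convex_Icc _ _) (by simp) (by simp)
    simpa using this

theorem fwdDiff_iter_int (n : ℕ) (f : ℝ → ℂ) (k : ℤ) :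
    (fwdDiff (1 : ℤ))^[n] (fun k : ℤ => f k) k = (fwdDiff (1 : ℝ))^[n] f k := by
  induction n generalizing f with
  | zero => rfl
  | succ n ih =>
    rw [Function.iterate_succ_apply, Function.iterate_succ_apply, ← ih]
    have e : fwdDiff (1 : ℤ) (fun k : ℤ => f k) = fun k : ℤ => fwdDiff (1 : ℝ) f k := by
      funext j
      simp [fwdDiff]
    rw [e]

/-! ### Discrete symbol classes -/

/-- The weight `1 + |k|`. -/
def jw (k : ℤ) : ℝ := 1 + |(k : ℝ)|

theorem jw_pos (k : ℤ) : 0 < jw k := by unfold jw; positivity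

theorem one_le_jw (k : ℤ) : 1 ≤ jw k := by unfold jw; linarith [abs_nonneg (k : ℝ)]

theorem jw_succ_le (k : ℤ) : jw (k + 1) ≤ 2 * jw k := by
  unfold jw
  have := abs_add_le (k : ℝ) 1
  rw [abs_one] at this
  push_cast
  linarith [abs_nonneg (k : ℝ)]

theorem jw_le_succ (k : ℤ) : jw k ≤ 2 * jw (k + 1) := by
  unfold jw
  have := abs_sub ((k : ℝ) + 1) 1
  rw [abs_one, add_sub_cancel_right] at this
  push_cast
  linarith [abs_nonneg ((k : ℝ) + 1)]

theorem jw_succ_rpow_le (t : ℝ) (k : ℤ) : jw (k + 1) ^ t ≤ 2 ^ |t| * jw k ^ t := by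
  rcases le_total 0 t with h | h
  · rw [abs_of_nonneg h, ← Real.mul_rpow two_pos.le (jw_pos k).le]
    exact Real.rpow_le_rpow (jw_pos _).le (jw_succ_le k) h
  · rw [abs_of_nonpos h]
    have h1 := Real.rpow_le_rpow_of_nonpos (jw_pos k) (jw_le_succ k) h
    rw [Real.mul_rpow two_pos.le (jw_pos _).le] at h1
    have h2 : (2 : ℝ) ^ (-t) * 2 ^ t = 1 := by
      rw [← Real.rpow_add two_pos, neg_add_cancel, Real.rpow_zero]
    calc jw (k + 1) ^ t = (2 : ℝ) ^ (-t) * (2 ^ t * jw (k + 1) ^ t) := by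
          rw [← mul_assoc, h2, one_mul]
      _ ≤ _ := by gcongr

/-- The symbols of order `ρ`, with constants `K`. -/
def IsSym (ρ : ℝ) (K : ℕ → ℝ) (a : ℤ → ℂ) : Prop :=
  ∀ (j : ℕ) (k : ℤ), ‖(fwdDiff (1 : ℤ))^[j] a k‖ ≤ K j * jw k ^ (ρ - j)

theorem IsSym.fwdDiff {ρ : ℝ} {K : ℕ → ℝ} {a : ℤ → ℂ} (h : IsSym ρ K a) :
    IsSym (ρ - 1) (fun j => K (j + 1)) (fwdDiff 1 a) := fun j k => by
  have := h (j + 1) k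
  rw [Function.iterate_succ_apply] at this
  push_cast at this
  rwa [show ρ - (j + 1 : ℝ) = ρ - 1 - j by ring] at this

theorem fwdDiff_iter_shift (j : ℕ) (a : ℤ → ℂ) (k : ℤ) :
    (fwdDiff (1 : ℤ))^[j] (fun i => a (i + 1)) k = (fwdDiff (1 : ℤ))^[j] a (k + 1) := by
  induction j generalizing a with
  | zero => rfl
  | succ j ih =>
    rw [Function.iterate_succ_apply, Function.iterate_succ_apply, ← ih]
    rfl

theorem IsSym.nonneg {ρ : ℝ} {K : ℕ → ℝ} {a : ℤ → ℂ} (h : IsSym ρ K a) (j : ℕ) : 0 ≤ K j := by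
  have h1 := (norm_nonneg _).trans (h j 0)
  exact nonneg_of_mul_nonneg_left h1 (Real.rpow_pos_of_pos (jw_pos 0) _)

theorem IsSym.shift {ρ : ℝ} {K : ℕ → ℝ} {a : ℤ → ℂ} (h : IsSym ρ K a) :
    IsSym ρ (fun j => K j * 2 ^ |ρ - j|) fun i => a (i + 1) := fun j k => by
  rw [fwdDiff_iter_shift]
  refine (h j (k + 1)).trans ?_
  rw [mul_assoc]
  exact mul_le_mul_of_nonneg_left (jw_succ_rpow_le _ k) (h.nonneg j)

/-- Discrete Leibniz rule Δ(ab) = Δa · b(· + 1) + a · Δb, with shifts harmless for symbol classes.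
The constant is chosen before a and b, which later yields uniformity in the cutoff. -/
theorem exists_isSym_mul_aux (j : ℕ) : ∀ (ρ σ : ℝ) (K L : ℕ → ℝ), ∃ C : ℝ, ∀ a b : ℤ → ℂ,
    IsSym ρ K a → IsSym σ L b →
      ∀ k, ‖(fwdDiff (1 : ℤ))^[j] (fun i => a i * b i) k‖ ≤ C * jw k ^ (ρ + σ - j) := by
  induction j with
  | zero =>
    intro ρ σ K L
    refine ⟨K 0 * L 0, fun a b ha hb k => ?_⟩
    have h1 := ha 0 k
    have h2 := hb 0 k
    simp only [Function.iterate_zero, id, Nat.cast_zero, sub_zero] at h1 h2 ⊢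
    rw [norm_mul, Real.rpow_add (jw_pos k)]
    calc _ ≤ (K 0 * jw k ^ ρ) * (L 0 * jw k ^ σ) :=
          mul_le_mul h1 h2 (norm_nonneg _) ((norm_nonneg _).trans h1)
      _ = _ := by ring
  | succ j ih =>
    intro ρ σ K L
    obtain ⟨C₁, h₁⟩ := ih (ρ - 1) σ (fun j => K (j + 1)) (fun j => L j * 2 ^ |σ - j|)
    obtain ⟨C₂, h₂⟩ := ih ρ (σ - 1) K (fun j => L (j + 1))
    refine ⟨C₁ + C₂, fun a b ha hb k => ?_⟩
    have e : fwdDiff (1 : ℤ) (fun i => a i * b i)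
        = (fun i => fwdDiff 1 a i * b (i + 1)) + fun i => a i * fwdDiff 1 b i := by
      funext i
      simp only [fwdDiff, Pi.add_apply]
      ring
    rw [Function.iterate_succ_apply, e, fwdDiff_iter_add, Pi.add_apply]
    have e1 := h₁ _ _ ha.fwdDiff hb.shift k
    have e2 := h₂ _ _ ha hb.fwdDiff k
    push_cast
    rw [show ρ - 1 + σ - (j : ℝ) = ρ + σ - (j + 1) by ring] at e1
    rw [show ρ + (σ - 1) - (j : ℝ) = ρ + σ - (j + 1) by ring] at e2
    rw [add_mul]
    exact (norm_add_le _ _).trans (add_le_add e1 e2)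

theorem exists_isSym_mul (ρ σ : ℝ) (K L : ℕ → ℝ) : ∃ M : ℕ → ℝ, ∀ a b : ℤ → ℂ,
    IsSym ρ K a → IsSym σ L b → IsSym (ρ + σ) M fun i => a i * b i := by
  choose C hC using fun j => exists_isSym_mul_aux j ρ σ K L
  exact ⟨C, fun a b ha hb j k => hC j a b ha hb k⟩

/-- Division of an estimate by `k + m`. -/
theorem exists_bound_of_mul {X : ℤ → ℂ} {t C : ℝ} (m : ℕ)
    (h : ∀ k : ℤ, ‖((k : ℂ) + m) * X k‖ ≤ C * jw k ^ (t + 1)) :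
    ∃ C', ∀ k : ℤ, ‖X k‖ ≤ C' * jw k ^ t := by
  have hC : 0 ≤ C := by
    have h1 := (norm_nonneg _).trans (h 0)
    exact nonneg_of_mul_nonneg_left h1 (Real.rpow_pos_of_pos (jw_pos 0) _)
  -- The second summand covers the single point k = -m, where the factor k + m vanishes and gives no
  -- information.
  refine ⟨C * (m + 2) + ‖X (-m)‖ / jw (-m) ^ t, fun k => ?_⟩
  have hw : 0 < jw k ^ t := Real.rpow_pos_of_pos (jw_pos k) _
  by_cases hk : k = -m
  · subst hk
    rw [add_mul, div_mul_cancel₀ _ hw.ne']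
    have : 0 ≤ C * (m + 2) * jw (-m) ^ t := by positivity
    linarith
  · have h1 : (1 : ℝ) ≤ |(k : ℝ) + m| := by
      have : k + m ≠ 0 := fun h => hk (by omega)
      have := Int.one_le_abs this
      exact_mod_cast this
    have h2 : jw k ≤ (m + 2) * |(k : ℝ) + m| := by
      unfold jw
      have := abs_sub ((k : ℝ) + m) m
      rw [add_sub_cancel_right, Nat.abs_cast] at this
      nlinarith [Nat.cast_nonneg (α := ℝ) m]
    have h3 := h k
    rw [norm_mul, Real.rpow_add (jw_pos k), Real.rpow_one] at h3
    have e : ‖(k : ℂ) + m‖ = |(k : ℝ) + m| := by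
      rw [← Real.norm_eq_abs, ← Complex.norm_real]
      push_cast
      rfl
    rw [e] at h3
    have h4 : 0 < |(k : ℝ) + m| := by linarith
    have h5 : |(k : ℝ) + m| * ‖X k‖ ≤ |(k : ℝ) + m| * (C * (m + 2) * jw k ^ t) := by
      refine h3.trans ?_
      calc C * (jw k ^ t * jw k) ≤ C * (jw k ^ t * ((m + 2) * |(k : ℝ) + m|)) := by gcongr
        _ = _ := by ring
    refine (le_of_mul_le_mul_left h5 h4).trans ?_
    rw [add_mul]
    have : 0 ≤ ‖X (-m)‖ / jw (-m) ^ t * jw k ^ t :=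
      mul_nonneg (div_nonneg (norm_nonneg _) (Real.rpow_nonneg (jw_pos _).le _)) hw.le
    linarith

/-- The Leibniz rule terminates after two terms because k has constant first difference. -/
theorem fwdDiff_iter_mul_id (j : ℕ) : ∀ (G : ℤ → ℂ) (k : ℤ),
    (fwdDiff (1 : ℤ))^[j + 1] (fun i => (i : ℂ) * G i) k
      = ((k : ℂ) + (j + 1 : ℕ)) * (fwdDiff (1 : ℤ))^[j + 1] G k
        + (j + 1) * (fwdDiff (1 : ℤ))^[j] G k := by
  induction j with
  | zero =>
    intro G k
    simp only [zero_add, Function.iterate_one, Function.iterate_zero, id, fwdDiff]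
    push_cast
    ring
  | succ j ih =>
    intro G k
    have e : fwdDiff (1 : ℤ) (fun i => (i : ℂ) * G i)
        = (fun i : ℤ => (i : ℂ) * fwdDiff 1 G i) + fun i : ℤ => G (i + 1) := by
      funext i
      simp only [fwdDiff, Pi.add_apply]
      push_cast
      ring
    rw [Function.iterate_succ_apply, e, fwdDiff_iter_add, Pi.add_apply, ih, fwdDiff_iter_shift,
      Function.iterate_succ_apply (fwdDiff (1 : ℤ)) (j + 1) G]
    have e2 : (fwdDiff (1 : ℤ))^[j + 1] G (k + 1)
        = (fwdDiff (1 : ℤ))^[j + 1] G k + (fwdDiff (1 : ℤ))^[j + 1] (fwdDiff 1 G) k := by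
      rw [← Function.iterate_succ_apply, Function.iterate_succ_apply' _ (j + 1)]
      change _ = _ + (_ - _)
      ring
    rw [e2, ← Function.iterate_succ_apply (fwdDiff (1 : ℤ)) j G]
    push_cast
    ring

/-- `G` satisfies the `j`-th estimate of a symbol of order `ρ`. -/
def SymAt (ρ : ℝ) (j : ℕ) (G : ℤ → ℂ) : Prop :=
  ∃ C : ℝ, ∀ k, ‖(fwdDiff (1 : ℤ))^[j] G k‖ ≤ C * jw k ^ (ρ - j)

/-- Solve the Leibniz formula for (k + j + 1) Δ^{j+1} G and divide by k + j + 1. -/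
theorem SymAt.succ_of_mul {ρ : ℝ} {j : ℕ} {G : ℤ → ℂ}
    (h1 : SymAt (ρ + 1) (j + 1) fun i => (i : ℂ) * G i) (h2 : SymAt ρ j G) :
    SymAt ρ (j + 1) G := by
  obtain ⟨C₁, h1⟩ := h1
  obtain ⟨C₂, h2⟩ := h2
  refine exists_bound_of_mul (C := C₁ + (j + 1) * C₂) (j + 1) fun k => ?_
  have e := fwdDiff_iter_mul_id j G k
  have e1 := h1 k
  have e2 := h2 k
  rw [← sub_eq_iff_eq_add] at e
  rw [← e, add_mul C₁]
  push_cast at e1 ⊢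
  refine (norm_sub_le _ _).trans (add_le_add ?_ ?_)
  · rwa [show ρ - ((j : ℝ) + 1) + 1 = ρ + 1 - (j + 1) by ring]
  · rw [norm_mul, show ρ - ((j : ℝ) + 1) + 1 = ρ - j by ring, mul_assoc]
    have : ‖(j : ℂ) + 1‖ = j + 1 := by
      have := Complex.norm_natCast (j + 1)
      push_cast at this
      exact this
    rw [this]
    gcongr

theorem symAt_zero_of_mul {ρ : ℝ} {G : ℤ → ℂ}
    (h1 : SymAt (ρ + 1) 0 fun i => (i : ℂ) * G i) : SymAt ρ 0 G := by
  obtain ⟨C₁, h1⟩ := h1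
  simp only [Function.iterate_zero, id, Nat.cast_zero, sub_zero] at h1
  obtain ⟨C, hC⟩ := exists_bound_of_mul (X := G) 0 (by simpa using h1)
  exact ⟨C, by simpa using hC⟩

/-- The hypothesis controls Δ^{m+1}(k^m p) only. Each step uses the estimates for m + 1 and m to
trade one factor k for one more difference; at m = 0 this gives all differences of p of order at
least one. -/
theorem symAt_of_diagonal {ρ : ℝ} {p : ℤ → ℂ}
    (h : ∀ m : ℕ, SymAt (ρ + m) (m + 1) fun i => (i : ℂ) ^ m * p i) (d : ℕ) :
    ∀ m : ℕ, SymAt (ρ + m) (m + 1 + d) fun i => (i : ℂ) ^ m * p i := by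
  induction d with
  | zero => exact h
  | succ d ih =>
    intro m
    refine SymAt.succ_of_mul (j := m + 1 + d) ?_ (ih m)
    have := ih (m + 1)
    rw [show m + 1 + 1 + d = m + 1 + d + 1 by ring] at this
    push_cast at this
    rw [← add_assoc] at this
    convert this using 2 with i
    ring

theorem exists_isSym_of_symAt {ρ : ℝ} {G : ℤ → ℂ} (h : ∀ j, SymAt ρ j G) : ∃ K, IsSym ρ K G := by
  choose C hC using h
  exact ⟨C, hC⟩

theorem symAt_of_mul {ρ : ℝ} {G : ℤ → ℂ} (h : ∀ j, SymAt (ρ + 1) j fun i => (i : ℂ) * G i)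
    (j : ℕ) : SymAt ρ j G := by
  induction j with
  | zero => exact symAt_zero_of_mul (h 0)
  | succ j ih => exact (h (j + 1)).succ_of_mul ih

theorem one_add_sq_rpow_le {t : ℝ} (ht : 0 ≤ t) (ξ : ℝ) :
    (1 + ξ ^ 2) ^ (t / 2) ≤ (1 + |ξ|) ^ t := by
  have h : (1 + |ξ|) ^ t = ((1 + |ξ|) ^ (2 : ℝ)) ^ (t / 2) := by
    rw [← Real.rpow_mul (by positivity)]
    congr 1
    ring
  rw [h]
  refine Real.rpow_le_rpow (by positivity) ?_ (by positivity)
  rw [Real.rpow_two]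
  nlinarith [abs_nonneg ξ, sq_abs ξ]

/-- The first n differences are paid for by continuous derivatives. The last one only has an almost
everywhere derivative, and absolute continuity of the n-th derivative replaces the mean value
theorem. -/
theorem symAt_of_derivative {r : ℝ} (hr : 1 ≤ r) {p : ℝ → ℂ} {n : ℕ}
    (h1 : ContDiff ℝ n fun ξ : ℝ => (ξ : ℂ) ^ n * p ξ)
    (h2 : ∀ a b : ℝ, AbsolutelyContinuousOnInterval
      (iteratedDeriv n fun ξ : ℝ => (ξ : ℂ) ^ n * p ξ) a b)
    (h3 : ∃ C > 0, ∀ᵐ ξ : ℝ ∂MeasureTheory.volume,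
      ‖iteratedDeriv (n + 1) (fun ξ : ℝ => (ξ : ℂ) ^ n * p ξ) ξ‖
        ≤ C * (1 + ξ ^ 2) ^ ((r - 1) / 2)) :
    SymAt (r + n) (n + 1) fun i : ℤ => (i : ℂ) ^ n * p i := by
  obtain ⟨C, hC, h3⟩ := h3
  set f : ℝ → ℂ := fun ξ : ℝ => (ξ : ℂ) ^ n * p ξ with hf
  have hfe : (fun i : ℤ => (i : ℂ) ^ n * p i) = fun i : ℤ => f i := by
    funext i
    simp [hf]
  refine ⟨C * (n + 2) ^ (r - 1), fun k => ?_⟩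
  rw [hfe, fwdDiff_iter_int, Function.iterate_succ_apply]
  refine norm_fwdDiff_iter_le n (contDiff_fwdDiff h1) fun y hy => ?_
  rw [iteratedDeriv_fwdDiff h1]
  have h4 := norm_sub_le_of_absolutelyContinuous (by linarith : y ≤ y + 1) (h2 y (y + 1))
    (B := C * (n + 2) ^ (r - 1) * jw k ^ (r + n - (n + 1 : ℕ))) (by
      filter_upwards [h3] with x hx hxI
      rw [iteratedDeriv_succ] at hx
      refine hx.trans ?_
      push_cast
      rw [show r + n - ((n : ℝ) + 1) = r - 1 by ring, mul_assoc]
      gcongr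
      refine (one_add_sq_rpow_le (by linarith) x).trans ?_
      rw [← Real.mul_rpow (by positivity) (jw_pos k).le]
      refine Real.rpow_le_rpow (by positivity) ?_ (by linarith)
      have hx1 : |x| ≤ |(k : ℝ)| + (n + 1) := by
        have h5 : x = k + (x - k) := by ring
        rw [h5]
        refine (abs_add_le _ _).trans ?_
        gcongr
        rw [abs_le]
        constructor <;> linarith [hxI.1, hxI.2, hy.1, hy.2, Nat.cast_nonneg (α := ℝ) n]
      unfold jw
      nlinarith [abs_nonneg (k : ℝ), Nat.cast_nonneg (α := ℝ) n])
  simpa using h4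

theorem fwdDiff_iter_sub_const (j : ℕ) (a : ℤ → ℂ) (c : ℂ) (k : ℤ) :
    (fwdDiff (1 : ℤ))^[j + 1] (fun i => a i - c) k = (fwdDiff (1 : ℤ))^[j + 1] a k := by
  rw [Function.iterate_succ_apply, Function.iterate_succ_apply]
  have e : fwdDiff (1 : ℤ) (fun i => a i - c) = fwdDiff (1 : ℤ) a := by
    funext i
    simp [fwdDiff]
  rw [e]

/-- The symbol `(p(k) - p(0)) / (2πik)` is of order `r - 1`. -/
theorem exists_isSym_div {r : ℝ} (hr : 1 ≤ r) {p : ℝ → ℂ} (hord : HasOrder (fun k : ℤ => p k) r)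
    (hreg : ∀ n : ℕ, 1 ≤ n →
      ContDiff ℝ ((n - 1 : ℕ) : ℕ∞) (fun ξ : ℝ => (ξ : ℂ) ^ (n - 1) * p ξ) ∧
      (∀ a b : ℝ, AbsolutelyContinuousOnInterval
        (iteratedDeriv (n - 1) (fun ξ : ℝ => (ξ : ℂ) ^ (n - 1) * p ξ)) a b) ∧
      ∃ C > 0, ∀ᵐ ξ : ℝ ∂MeasureTheory.volume,
        ‖iteratedDeriv n (fun ξ : ℝ => (ξ : ℂ) ^ (n - 1) * p ξ) ξ‖
          ≤ C * (1 + ξ ^ 2) ^ ((r - 1) / 2)) :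
    ∃ K, IsSym (r - 1) K fun k : ℤ => (p k - p 0) / tpi k := by
  have hdiag : ∀ m : ℕ, SymAt (r + m) (m + 1) fun i : ℤ => (i : ℂ) ^ m * p i := fun m => by
    obtain ⟨h1, h2, h3⟩ := hreg (m + 1) (by omega)
    exact symAt_of_derivative hr (by exact_mod_cast h1) h2 h3
  -- The undifferenced estimate comes from the order of p; subtracting p(0) does not affect the
  -- higher ones.
  have hp : ∀ j, SymAt r j fun i : ℤ => p i - p 0 := by
    intro j
    cases j with
    | zero =>
      obtain ⟨C, hC, h⟩ := hord
      refine ⟨C + ‖p 0‖, fun k => ?_⟩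
      simp only [Function.iterate_zero, id, Nat.cast_zero, sub_zero]
      refine (norm_sub_le _ _).trans ?_
      rw [add_mul]
      refine add_le_add ((h k).trans ?_) ?_
      · gcongr
        exact one_add_sq_rpow_le (by linarith) k
      · have := Real.one_le_rpow (one_le_jw k) (by linarith : 0 ≤ r)
        nlinarith [norm_nonneg (p 0)]
    | succ j =>
      have h := symAt_of_diagonal hdiag j 0
      obtain ⟨C, hC⟩ := h
      refine ⟨C, fun k => ?_⟩
      rw [fwdDiff_iter_sub_const]
      have := hC k
      simpa [add_comm] using this
  refine exists_isSym_of_symAt (symAt_of_mul fun j => ?_)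
  obtain ⟨C, hC⟩ := hp j
  rw [sub_add_cancel]
  refine ⟨‖(2 * Real.pi * Complex.I)⁻¹‖ * C, fun k => ?_⟩
  -- At i = 0 both sides vanish: subtracting p(0) makes the convention x / 0 = 0 consistent with the
  -- identity.
  have e : (fun i : ℤ => (i : ℂ) * ((p i - p 0) / tpi i))
      = (2 * Real.pi * Complex.I)⁻¹ • fun i : ℤ => p i - p 0 := by
    funext i
    simp only [Pi.smul_apply, smul_eq_mul, tpi]
    by_cases hi : i = 0
    · subst hi; simp
    · have h1 : (i : ℂ) ≠ 0 := by exact_mod_cast hi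
      have h2 : (2 * Real.pi * Complex.I : ℂ) ≠ 0 := Complex.two_pi_I_ne_zero
      field_simp
  rw [e, fwdDiff_iter_const_smul, Pi.smul_apply, norm_smul,
    mul_assoc ‖(2 * Real.pi * Complex.I : ℂ)⁻¹‖]
  exact mul_le_mul_of_nonneg_left (hC k) (norm_nonneg _)

/-! ### Truncation -/

theorem fwdDiff_iter_eq_zero (n : ℕ) : ∀ {a : ℤ → ℂ} {k : ℤ},
    (∀ i ∈ Set.Icc k (k + n), a i = 0) → (fwdDiff (1 : ℤ))^[n] a k = 0 := by
  induction n with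
  | zero =>
    intro a k h
    exact h k (by simp)
  | succ n ih =>
    intro a k h
    rw [Function.iterate_succ_apply]
    refine ih fun i hi => ?_
    simp only [Set.mem_Icc] at hi h
    push_cast at h
    simp only [fwdDiff]
    rw [h i (by omega), h (i + 1) (by omega), sub_zero]

theorem fwdDiff_iter_eq_zero_of_const (n : ℕ) (c : ℂ) (k : ℤ) :
    (fwdDiff (1 : ℤ))^[n + 1] (fun _ => c) k = 0 := by
  have e : fwdDiff (1 : ℤ) (fun _ => c) = fun _ => 0 := by
    funext i
    simp [fwdDiff]
  rw [Function.iterate_succ_apply, e]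
  exact fwdDiff_iter_eq_zero n fun _ _ => rfl

/-- A smooth cutoff, equal to `1` on `[-1, 1]` and to `0` off `(-2, 2)`. -/
def cutoff (x : ℝ) : ℂ := ((⟨1, 2, one_pos, one_lt_two⟩ : ContDiffBump (0 : ℝ)) x : ℝ)

theorem contDiff_cutoff {n : ℕ} : ContDiff ℝ n cutoff :=
  Complex.ofRealCLM.contDiff.comp (ContDiffBump.contDiff _)

theorem cutoff_eq_one {x : ℝ} (h : |x| ≤ 1) : cutoff x = 1 := by
  unfold cutoff
  rw [ContDiffBump.one_of_mem_closedBall _ (by simpa using h), Complex.ofReal_one]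

theorem cutoff_eq_zero {x : ℝ} (h : 2 ≤ |x|) : cutoff x = 0 := by
  unfold cutoff
  rw [ContDiffBump.zero_of_le_dist _ (by simpa using h), Complex.ofReal_zero]

theorem norm_cutoff_le (x : ℝ) : ‖cutoff x‖ ≤ 1 := by
  unfold cutoff
  rw [Complex.norm_real, Real.norm_of_nonneg (ContDiffBump.nonneg _)]
  exact ContDiffBump.le_one _

theorem hasCompactSupport_cutoff : HasCompactSupport cutoff :=
  (ContDiffBump.hasCompactSupport (⟨1, 2, one_pos, one_lt_two⟩ : ContDiffBump (0 : ℝ))).comp_left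
    (g := fun x : ℝ => (x : ℂ)) Complex.ofReal_zero

theorem exists_iteratedDeriv_cutoff_le (n : ℕ) : ∃ M, ∀ x, ‖iteratedDeriv n cutoff x‖ ≤ M := by
  obtain ⟨M, hM⟩ := ((contDiff_cutoff (n := n)).continuous_iteratedFDeriv
    (m := n) le_rfl).bounded_above_of_compact_support (hasCompactSupport_cutoff.iteratedFDeriv n)
  exact ⟨M, fun x => by rw [← norm_iteratedFDeriv_eq_norm_iteratedDeriv]; exact hM x⟩

/-- Where |k| ≤ (n + 2)(N + 1), scaling yields (N + 1)^{-n}, which is at most a constant times (1 +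
|k|)^{-n}. Elsewhere all of k, …, k + n lie beyond 2(N + 1) and the difference is zero. Neither case
involves N in the constant. -/
theorem exists_isSym_cutoff :
    ∃ L : ℕ → ℝ, ∀ N : ℕ, IsSym 0 L fun k : ℤ => cutoff ((N + 1 : ℝ)⁻¹ * k) := by
  choose M hM using exists_iteratedDeriv_cutoff_le
  refine ⟨fun n => M n * (n + 3) ^ n, fun N n k => ?_⟩
  have hM0 : 0 ≤ M n := (norm_nonneg _).trans (hM n 0)
  have hN : (0 : ℝ) < N + 1 := by positivity
  rw [zero_sub, Real.rpow_neg (jw_pos k).le, Real.rpow_natCast]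
  by_cases hk : |(k : ℝ)| ≤ (n + 2) * (N + 1)
  · rw [fwdDiff_iter_int n (fun x => cutoff ((N + 1 : ℝ)⁻¹ * x)) k]
    refine norm_fwdDiff_iter_le n (contDiff_cutoff.comp (contDiff_const.mul contDiff_id))
      fun y _ => ?_
    rw [iteratedDeriv_comp_const_smul contDiff_cutoff, norm_smul, norm_pow, norm_inv,
      Real.norm_of_nonneg hN.le]
    have h1 : jw k ≤ (n + 3) * (N + 1) := by
      unfold jw
      nlinarith
    have h2 : ((N : ℝ) + 1)⁻¹ ≤ (n + 3) * (jw k)⁻¹ := by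
      rw [← div_eq_mul_inv, inv_eq_one_div, div_le_div_iff₀ hN (jw_pos k)]
      linarith
    calc ((N : ℝ) + 1)⁻¹ ^ n * ‖iteratedDeriv n cutoff ((N + 1 : ℝ)⁻¹ * y)‖
        ≤ ((n + 3) * (jw k)⁻¹) ^ n * M n := by
          have := (jw_pos k).le
          exact mul_le_mul (pow_le_pow_left₀ (by positivity) h2 n) (hM n _) (norm_nonneg _)
            (by positivity)
      _ = _ := by rw [mul_pow, inv_pow]; ring
  · rw [fwdDiff_iter_eq_zero, norm_zero]
    · have := jw_pos k
      positivity
    · intro i hi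
      refine cutoff_eq_zero ?_
      rw [abs_mul, abs_of_pos (inv_pos.2 hN), ← div_eq_inv_mul, le_div_iff₀ hN]
      have h1 : |(k : ℝ)| ≤ |(i : ℝ)| + n := by
        have h3 : (k : ℝ) ≤ i := by exact_mod_cast hi.1
        have h4 : (i : ℝ) ≤ k + n := by exact_mod_cast hi.2
        have := abs_sub_abs_le_abs_sub (k : ℝ) i
        have h5 : |(k : ℝ) - i| ≤ n := by
          rw [abs_le]
          constructor <;> linarith
        linarith
      have h2 : (n : ℝ) ≤ n * (N + 1) := by
        nlinarith [Nat.cast_nonneg (α := ℝ) n, Nat.cast_nonneg (α := ℝ) N]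
      linarith

theorem exists_isSym_tpi_pow (n : ℕ) : ∃ L : ℕ → ℝ, IsSym n L fun k : ℤ => tpi k ^ n := by
  induction n with
  | zero =>
    refine ⟨fun j => if j = 0 then 1 else 0, fun j k => ?_⟩
    cases j with
    | zero => simp
    | succ j =>
      simp only [pow_zero]
      rw [fwdDiff_iter_eq_zero_of_const]
      simp
  | succ n ih =>
    obtain ⟨L, hL⟩ := ih
    have h1 : IsSym 1 (fun j => if j ≤ 1 then 2 * Real.pi else 0) tpi := by
      intro j k
      rcases j with _ | _ | j
      · simp only [Function.iterate_zero, id, norm_tpi]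
        unfold jw
        simp
        nlinarith [Real.pi_pos]
      · have : fwdDiff (1 : ℤ) tpi k = 2 * Real.pi * Complex.I := by
          simp only [fwdDiff, tpi]
          push_cast
          ring
        simp [this, abs_of_pos Real.pi_pos]
      · have : fwdDiff (1 : ℤ) tpi = fun _ => 2 * Real.pi * Complex.I := by
          funext i
          simp only [fwdDiff, tpi]
          push_cast
          ring
        rw [Function.iterate_succ_apply, this, fwdDiff_iter_eq_zero_of_const]
        simp
    obtain ⟨M, hM⟩ := exists_isSym_mul n 1 L (fun j => if j ≤ 1 then 2 * Real.pi else 0)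
    refine ⟨M, ?_⟩
    push_cast
    simpa only [pow_succ] using hM _ _ hL h1

/-- Finitely supported approximations of the symbol `(p(k) - p(0)) / (2πik)` with uniform bounds. -/
theorem exists_symbols {r : ℝ} (hr : 1 ≤ r) {p : ℝ → ℂ} (hord : HasOrder (fun k : ℤ => p k) r)
    (hreg : ∀ n : ℕ, 1 ≤ n →
      ContDiff ℝ ((n - 1 : ℕ) : ℕ∞) (fun ξ : ℝ => (ξ : ℂ) ^ (n - 1) * p ξ) ∧
      (∀ a b : ℝ, AbsolutelyContinuousOnInterval
        (iteratedDeriv (n - 1) (fun ξ : ℝ => (ξ : ℂ) ^ (n - 1) * p ξ)) a b) ∧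
      ∃ C > 0, ∀ᵐ ξ : ℝ ∂MeasureTheory.volume,
        ‖iteratedDeriv n (fun ξ : ℝ => (ξ : ℂ) ^ (n - 1) * p ξ) ξ‖
          ≤ C * (1 + ξ ^ 2) ^ ((r - 1) / 2)) :
    ∃ b : ℕ → ℤ → ℂ, (∀ N, ∃ S : Finset ℤ, ∀ k ∉ S, b N k = 0) ∧
      (∀ k, ∀ᶠ N in Filter.atTop, b N k * tpi k = p k - p 0) ∧
      (∀ n, ∃ C, 0 ≤ C ∧ ∀ N k,
        ‖(fwdDiff (1 : ℤ))^[n] (fun k => b N k * tpi k ^ n) k‖ ≤ C * jw k ^ (r - 1)) ∧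
      ∀ N k, ‖b N k * tpi k‖ ≤ ‖p k - p 0‖ := by
  obtain ⟨K, hK⟩ := exists_isSym_div hr hord hreg
  obtain ⟨L, hL⟩ := exists_isSym_cutoff
  have hb : ∀ (N : ℕ) (k : ℤ), (p k - p 0) / tpi k * cutoff ((N + 1 : ℝ)⁻¹ * k) * tpi k
      = (p k - p 0) * cutoff ((N + 1 : ℝ)⁻¹ * k) := fun N k => by
    by_cases hk : k = 0
    · subst hk; simp [tpi]
    · have : tpi k ≠ 0 := by
        unfold tpi
        exact mul_ne_zero Complex.two_pi_I_ne_zero (by exact_mod_cast hk)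
      field_simp
  refine ⟨fun N k => (p k - p 0) / tpi k * cutoff ((N + 1 : ℝ)⁻¹ * k), fun N => ?_, fun k => ?_,
    fun n => ?_, fun N k => ?_⟩
  · refine ⟨Finset.Icc (-(2 * (N + 1))) (2 * (N + 1)), fun k hk => ?_⟩
    dsimp only
    rw [cutoff_eq_zero, mul_zero]
    rw [abs_mul, abs_of_pos (by positivity : (0 : ℝ) < (N + 1 : ℝ)⁻¹), ← div_eq_inv_mul,
      le_div_iff₀ (by positivity)]
    by_contra! h
    rw [abs_lt] at h
    refine hk (Finset.mem_Icc.2 ⟨?_, ?_⟩)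
    · have := h.1.le
      exact_mod_cast this
    · have := h.2.le
      exact_mod_cast this
  · obtain ⟨N₀, hN₀⟩ := exists_nat_ge |(k : ℝ)|
    filter_upwards [Filter.eventually_ge_atTop N₀] with N hN
    rw [hb, cutoff_eq_one, mul_one]
    rw [abs_mul, abs_of_pos (by positivity : (0 : ℝ) < (N + 1 : ℝ)⁻¹), ← div_eq_inv_mul,
      div_le_one (by positivity)]
    have : (N₀ : ℝ) ≤ N := by exact_mod_cast hN
    linarith
  -- The product has order r - 1 + n, and n differences bring it back to r - 1; this balance gives
  -- the same order for every derivative.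
  · obtain ⟨L', hL'⟩ := exists_isSym_tpi_pow n
    obtain ⟨M₁, h₁⟩ := exists_isSym_mul (r - 1) 0 K L
    obtain ⟨M₂, h₂⟩ := exists_isSym_mul (r - 1 + 0) n M₁ L'
    refine ⟨M₂ n, (h₂ _ _ (h₁ _ _ hK (hL 0)) hL').nonneg n, fun N k => ?_⟩
    have := h₂ _ _ (h₁ _ _ hK (hL N)) hL' n k
    rwa [add_zero, add_sub_cancel_right] at this
  · rw [hb, norm_mul]
    exact mul_le_of_le_one_right (norm_nonneg _) (norm_cutoff_le _)

end

end CircleSobolev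

/-! ### Commutator estimates. -/

namespace CircleSobolev

noncomputable section

open scoped ENNReal NNReal

/-! ### Majorants for iterated commutators -/

/-- The absolute value of an integer in `[0, ∞]`. -/
def absE (k : ℤ) : ℝ≥0∞ := (k.natAbs : ℝ≥0∞)

theorem absE_add_le (i k : ℤ) : absE (i + k) ≤ absE i + absE k := by
  unfold absE
  exact_mod_cast Int.natAbs_add_le i k

theorem absE_eq (k : ℤ) : absE k = ENNReal.ofReal |(k : ℝ)| := by
  unfold absE
  rw [← Int.cast_abs, Int.abs_eq_natAbs, Int.cast_natCast, ENNReal.ofReal_natCast]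

theorem absE_le_wt (k : ℤ) : absE k ≤ wt 1 k := by
  rw [absE_eq, wt, ← Real.sqrt_eq_rpow]
  exact ENNReal.ofReal_le_ofReal (Real.abs_le_sqrt (by linarith))

theorem one_add_absE_eq (k : ℤ) : 1 + absE k = ENNReal.ofReal (jw k) := by
  rw [absE_eq, jw, ENNReal.ofReal_add zero_le_one (abs_nonneg _), ENNReal.ofReal_one]

theorem wt_le_one_add_absE {s : ℝ} (hs : 0 ≤ s) (k : ℤ) : wt s k ≤ (1 + absE k) ^ s := by
  rw [one_add_absE_eq, ENNReal.ofReal_rpow_of_pos (jw_pos k)]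
  exact ENNReal.ofReal_le_ofReal (one_add_sq_rpow_le hs k)

theorem one_add_absE_le_wt (k : ℤ) : 1 + absE k ≤ 2 * wt 1 k := by
  have h1 := one_le_wt zero_le_one k
  rw [two_mul]
  exact add_le_add h1 (absE_le_wt k)

theorem wt_one_rpow {t : ℝ} (k : ℤ) : wt 1 k ^ t = wt t k := by
  unfold wt
  rw [ENNReal.ofReal_rpow_of_pos (weight_pos _ _), ← Real.rpow_mul (by positivity)]
  congr 2
  ring

/-- The majorant of the Fourier coefficients of an iterated commutator applied to a function. -/
def maj (t : ℝ) : (n : ℕ) → (Fin n → ℤ → ℝ≥0∞) → (ℤ → ℝ≥0∞) → ℝ≥0∞ → ℤ → ℝ≥0∞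
  | 0, _, β, X, l => (X + absE l) ^ t * β l
  | n + 1, α, β, X, l =>
    ∑' i, absE i * α 0 i * maj t n (fun j => α j.succ) β (X + absE i) (l - i)

/-- The unweighted majorant. -/
def majZero : (n : ℕ) → (Fin n → ℤ → ℝ≥0∞) → (ℤ → ℝ≥0∞) → ℤ → ℝ≥0∞
  | 0, _, β => β
  | n + 1, α, β => conv (fun i => absE i * α 0 i) (majZero n (fun j => α j.succ) β)

/-- In every term the base is X + |i₁| + … + |l - i₁ - …|, at least X + |l| by the triangle
inequality. An output weight is thus absorbed into the exponent. -/
theorem rpow_mul_maj_le {s ρ : ℝ} (hs : 0 ≤ s) (hρ : 0 ≤ ρ) (n : ℕ) :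
    ∀ (α : Fin n → ℤ → ℝ≥0∞) (β : ℤ → ℝ≥0∞) (X Z : ℝ≥0∞) (l : ℤ), Z ≤ X + absE l →
      Z ^ s * maj ρ n α β X l ≤ maj (s + ρ) n α β X l := by
  induction n with
  | zero =>
    intro α β X Z l hZ
    simp only [maj]
    rw [← mul_assoc, ENNReal.rpow_add_of_nonneg _ _ hs hρ]
    gcongr
  | succ n ih =>
    intro α β X Z l hZ
    simp only [maj]
    rw [← ENNReal.tsum_mul_left]
    refine ENNReal.tsum_le_tsum fun i => ?_
    rw [mul_left_comm]
    refine mul_le_mul' le_rfl (ih _ _ _ _ _ (hZ.trans ?_))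
    rw [add_assoc]
    gcongr
    have := absE_add_le i (l - i)
    rwa [add_sub_cancel] at this

theorem add_rpow_le_two_rpow {t : ℝ} (ht : 0 ≤ t) (a b : ℝ≥0∞) :
    (a + b) ^ t ≤ 2 ^ t * (a ^ t + b ^ t) := by
  rcases le_total a b with h | h
  · calc (a + b) ^ t ≤ (2 * b) ^ t := by gcongr; rw [two_mul]; gcongr
      _ = 2 ^ t * b ^ t := ENNReal.mul_rpow_of_nonneg _ _ ht
      _ ≤ _ := by gcongr; exact le_add_self
  · calc (a + b) ^ t ≤ (2 * a) ^ t := by gcongr; rw [two_mul]; gcongr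
      _ = 2 ^ t * a ^ t := ENNReal.mul_rpow_of_nonneg _ _ ht
      _ ≤ _ := by gcongr; exact le_self_add

/-- (a + Y)^t is at most 2^t (a^t + Y^t) in each term, so the summand Y leaves behind a plain
convolution without weight. -/
theorem maj_add_le {t : ℝ} (ht : 0 ≤ t) (n : ℕ) :
    ∀ (α : Fin n → ℤ → ℝ≥0∞) (β : ℤ → ℝ≥0∞) (X Y : ℝ≥0∞) (l : ℤ),
      maj t n α β (X + Y) l ≤ 2 ^ t * (Y ^ t * majZero n α β l + maj t n α β X l) := by
  induction n with
  | zero =>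
    intro α β X Y l
    simp only [maj, majZero]
    rw [← add_mul, ← mul_assoc]
    refine mul_le_mul' ?_ le_rfl
    rw [add_right_comm, add_comm _ Y]
    exact add_rpow_le_two_rpow ht _ _
  | succ n ih =>
    intro α β X Y l
    simp only [maj, majZero, conv]
    rw [← ENNReal.tsum_mul_left, ← ENNReal.tsum_add, ← ENNReal.tsum_mul_left]
    refine ENNReal.tsum_le_tsum fun i => ?_
    rw [add_right_comm]
    refine (mul_le_mul' le_rfl (ih _ _ _ _ _)).trans (le_of_eq ?_)
    ring

theorem tsum_majZero (n : ℕ) : ∀ (α : Fin n → ℤ → ℝ≥0∞) (β : ℤ → ℝ≥0∞),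
    ∑' l, majZero n α β l = (∏ j, ∑' i, absE i * α j i) * ∑' l, β l := by
  induction n with
  | zero => intro α β; simp [majZero]
  | succ n ih =>
    intro α β
    simp only [majZero]
    rw [tsum_conv, ih, Fin.prod_univ_succ, mul_assoc]

/-- The `H^{t+1}` bound of the majorant. -/
theorem exists_l2_maj_le {t : ℝ} (ht : 1 / 2 < t) (n : ℕ) : ∃ C : ℝ≥0∞, C ≠ ⊤ ∧
    ∀ (α : Fin n → ℤ → ℝ≥0∞) (β : ℤ → ℝ≥0∞),
      l2 (maj t n α β 1) ≤ C * ((∏ j, wl2 (t + 1) (α j)) * wl2 t β) := by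
  have ht0 : 0 ≤ t := by linarith
  have hE := embC_ne_top ht
  have h2 : (2 : ℝ≥0∞) ^ t ≠ ⊤ := ENNReal.rpow_ne_top_of_nonneg ht0 (by simp)
  have hA : ∀ α : ℤ → ℝ≥0∞, ∑' i, absE i * α i ≤ embC t * wl2 (t + 1) α := fun α => by
    refine (ENNReal.tsum_le_tsum fun i => mul_le_mul' (absE_le_wt i) le_rfl).trans ?_
    rw [add_comm]
    exact tsum_wt_le t 1 α
  induction n with
  | zero =>
    refine ⟨2 ^ t, h2, fun α β => ?_⟩
    simp only [maj, Finset.univ_eq_empty, Finset.prod_empty, one_mul]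
    rw [wl2, ← l2_const_mul]
    refine l2_mono fun k => ?_
    rw [← mul_assoc]
    gcongr
    rw [← wt_one_rpow, ← ENNReal.mul_rpow_of_nonneg _ _ ht0]
    exact ENNReal.rpow_le_rpow (one_add_absE_le_wt k) ht0
  | succ n ih =>
    obtain ⟨C, hC, ih⟩ := ih
    refine ⟨2 ^ t * (embC t ^ n * embC t + embC t * C), ?_, fun α β => ?_⟩
    · exact ENNReal.mul_ne_top h2 (ENNReal.add_ne_top.2
        ⟨ENNReal.mul_ne_top (ENNReal.pow_ne_top hE) hE, ENNReal.mul_ne_top hE hC⟩)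
    set α' : Fin n → ℤ → ℝ≥0∞ := fun j => α j.succ with hα'
    -- Either the outermost frequency takes the whole weight |i|^{t+1}, leaving an ℓ² factor against
    -- an ℓ¹ convolution, or the weight stays inside, where the outermost factor is ℓ¹ and induction
    -- gives ℓ².
    have h1 : l2 (maj t (n + 1) α β 1) ≤ l2 (fun l => 2 ^ t *
        (conv (fun i => absE i ^ (t + 1) * α 0 i) (majZero n α' β) l
          + conv (fun i => absE i * α 0 i) (maj t n α' β 1) l)) := by
      refine l2_mono fun l => ?_
      simp only [maj, conv]
      rw [← ENNReal.tsum_add, ← ENNReal.tsum_mul_left]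
      refine ENNReal.tsum_le_tsum fun i => ?_
      refine (mul_le_mul' le_rfl (maj_add_le ht0 n _ _ _ _ _)).trans (le_of_eq ?_)
      rw [ENNReal.rpow_add_of_nonneg _ _ ht0 zero_le_one, ENNReal.rpow_one]
      ring
    refine h1.trans ?_
    rw [l2_const_mul, mul_assoc]
    refine mul_le_mul' le_rfl ((l2_add_le _ _).trans ?_)
    rw [add_mul]
    refine add_le_add ((l2_conv_le' _ _).trans ?_) ((l2_conv_le _ _).trans ?_)
    · rw [tsum_majZero, Fin.prod_univ_succ]
      have e1 : l2 (fun i => absE i ^ (t + 1) * α 0 i) ≤ wl2 (t + 1) (α 0) := by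
        refine l2_mono fun k => ?_
        gcongr
        rw [← wt_one_rpow]
        exact ENNReal.rpow_le_rpow (absE_le_wt k) (by linarith)
      have e2 : ∏ j, ∑' i, absE i * α' j i ≤ embC t ^ n * ∏ j, wl2 (t + 1) (α' j) := by
        refine (Finset.prod_le_prod' fun j _ => hA (α' j)).trans (le_of_eq ?_)
        rw [Finset.prod_mul_distrib]
        simp
      calc _ ≤ wl2 (t + 1) (α 0) * ((embC t ^ n * ∏ j, wl2 (t + 1) (α' j)) * (embC t * wl2 t β)) :=
            mul_le_mul' e1 (mul_le_mul' e2 (tsum_le_wl2 t β))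
        _ = _ := by ring
    · rw [Fin.prod_univ_succ]
      calc _ ≤ (embC t * wl2 (t + 1) (α 0)) * (C * ((∏ j, wl2 (t + 1) (α' j)) * wl2 t β)) :=
            mul_le_mul' (hA _) (ih _ _)
        _ = _ := by ring

/-! ### Iterated commutators -/

/-- Multiplication by `g`. -/
def mulOp (g : CT) : CT →L[ℂ] CT := ContinuousLinearMap.mul ℂ CT g

@[simp] theorem mulOp_apply (g w : CT) : mulOp g w = g * w := rfl

/-- The commutator of multiplication by `g` with `B`. -/
def comm (g : CT) (B : CT →L[ℂ] CT) : CT →L[ℂ] CT := mulOp g ∘L B - B ∘L mulOp g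

theorem comm_apply (g : CT) (B : CT →L[ℂ] CT) (w : CT) : comm g B w = g * B w - B (g * w) := rfl

/-- The iterated commutator of multiplications with `B`. -/
def comms : (n : ℕ) → (Fin n → CT) → (CT →L[ℂ] CT) → (CT →L[ℂ] CT)
  | 0, _, B => B
  | n + 1, h, B => comm (h 0) (comms n (fun j => h j.succ) B)

theorem comm_comm (g h : CT) (B : CT →L[ℂ] CT) : comm g (comm h B) = comm h (comm g B) := by
  ext1 w
  simp only [comm_apply, mul_sub]
  rw [mul_left_comm h g (B w), mul_left_comm h g w]
  abel

/-- Multiplications commute with one another, so by the Jacobi identity the order of the commutators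
is immaterial. -/
theorem comms_comm (n : ℕ) (h : Fin n → CT) (g : CT) (B : CT →L[ℂ] CT) :
    comms n h (comm g B) = comm g (comms n h B) := by
  induction n with
  | zero => rfl
  | succ n ih =>
    simp only [comms]
    rw [ih, comm_comm]

theorem comm_mulOp_comp (g e : CT) (B : CT →L[ℂ] CT) :
    comm g (mulOp e ∘L B) = mulOp e ∘L comm g B := by
  ext1 w
  simp only [comm_apply, ContinuousLinearMap.comp_apply, mulOp_apply, mul_sub]
  rw [mul_left_comm]

theorem comms_mulOp_comp (n : ℕ) (h : Fin n → CT) (e : CT) (B : CT →L[ℂ] CT) :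
    comms n h (mulOp e ∘L B) = mulOp e ∘L comms n h B := by
  induction n with
  | zero => rfl
  | succ n ih =>
    simp only [comms]
    rw [ih, comm_mulOp_comp]

/-- `B` is the Fourier multiplier with symbol `a`. -/
def IsMult (B : CT →L[ℂ] CT) (a : ℤ → ℂ) : Prop := ∀ w l, fc l (B w) = a l * fc l w

/-- Multiplication by e_i shifts frequencies, so after multiplying back by e_{-i} the commutator is
again a Fourier multiplier, whose symbol is a difference. -/
theorem IsMult.comm_expo {B : CT →L[ℂ] CT} {a : ℤ → ℂ} (h : IsMult B a) (i : ℤ) :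
    IsMult (mulOp (expo (-i)) ∘L comm (expo i) B) fun k => a k - a (k + i) := fun w l => by
  rw [ContinuousLinearMap.comp_apply, mulOp_apply, fc_expo_mul, comm_apply, map_sub, fc_expo_mul,
    h, h, fc_expo_mul]
  rw [sub_neg_eq_add, add_sub_cancel_right, sub_mul]

theorem comm_expo_eq (i : ℤ) (B : CT →L[ℂ] CT) :
    mulOp (expo i) ∘L (mulOp (expo (-i)) ∘L comm (expo i) B) = comm (expo i) B := by
  ext1 w
  simp only [ContinuousLinearMap.comp_apply, mulOp_apply]
  rw [← mul_assoc, ← expo_add, add_neg_cancel, expo_zero, one_mul]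

/-- The estimate of the `n`-th differences of `a`. -/
def DiffBound (ρ : ℝ) (n : ℕ) (C X : ℝ≥0∞) (a : ℤ → ℂ) : Prop :=
  ∀ k, ‖(fwdDiff (1 : ℤ))^[n] a k‖ₑ ≤ C * (X + absE k) ^ ρ

theorem fwdDiff_iter_translate (j : ℕ) (a : ℤ → ℂ) (i k : ℤ) :
    (fwdDiff (1 : ℤ))^[j] (fun m => a (m + i)) k = (fwdDiff (1 : ℤ))^[j] a (k + i) := by
  induction j generalizing a with
  | zero => rfl
  | succ j ih =>
    rw [Function.iterate_succ_apply, Function.iterate_succ_apply, ← ih]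
    have e : fwdDiff (1 : ℤ) (fun m => a (m + i)) = fun m => fwdDiff (1 : ℤ) a (m + i) := by
      funext m
      simp only [fwdDiff]
      rw [add_right_comm]
    rw [e]

theorem fwdDiff_iter_sub (n : ℕ) (a b : ℤ → ℂ) :
    (fwdDiff (1 : ℤ))^[n] (fun k => a k - b k)
      = fun k => (fwdDiff (1 : ℤ))^[n] a k - (fwdDiff (1 : ℤ))^[n] b k := by
  have h := fwdDiff_iter_add (1 : ℤ) a (fun k => -b k) n
  have h2 := fwdDiff_iter_const_smul (1 : ℤ) (-1 : ℤ) b n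
  have e : (fun k => -b k) = (-1 : ℤ) • b := by funext k; simp
  rw [e, h2] at h
  have e3 : (fun k => a k - b k) = a + (-1 : ℤ) • b := by funext k; simp [sub_eq_add_neg]
  rw [e3, h]
  funext k
  simp [sub_eq_add_neg]

/-- Telescoping into unit steps, none of which leaves the region controlled by X + m + |k|. -/
theorem enorm_sub_translate_le {ρ : ℝ} (hρ : 0 ≤ ρ) {C X : ℝ≥0∞} {b : ℤ → ℂ}
    (h : ∀ k, ‖fwdDiff (1 : ℤ) b k‖ₑ ≤ C * (X + absE k) ^ ρ) (k : ℤ) (m : ℕ) :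
    ‖b k - b (k + m)‖ₑ ≤ m * (C * (X + m + absE k) ^ ρ) := by
  have key : ∀ j : ℕ, j ≤ m → ‖b k - b (k + j)‖ₑ ≤ j * (C * (X + m + absE k) ^ ρ) := by
    intro j
    induction j with
    | zero => simp
    | succ j ih =>
      intro hj
      have e : b k - b (k + (j + 1 : ℕ)) = (b k - b (k + j)) - fwdDiff (1 : ℤ) b (k + j) := by
        simp only [fwdDiff]
        push_cast
        rw [add_assoc]
        ring
      rw [e]
      refine (enorm_sub_le).trans ?_
      push_cast
      rw [add_mul, one_mul]
      refine add_le_add (ih (by omega)) ((h _).trans ?_)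
      refine mul_le_mul' le_rfl (ENNReal.rpow_le_rpow ?_ hρ)
      rw [add_assoc]
      refine add_le_add le_rfl ?_
      refine (absE_add_le _ _).trans ?_
      rw [add_comm]
      gcongr
      unfold absE
      rw [Int.natAbs_natCast]
      exact_mod_cast (by omega : j ≤ m)
  exact key m le_rfl

/-- One difference is spent to gain the factor |i|; the base grows by |i| because the telescoping
path has that length. Negative i telescopes to the left. -/
theorem DiffBound.translate {ρ : ℝ} (hρ : 0 ≤ ρ) {n : ℕ} {C X : ℝ≥0∞} {a : ℤ → ℂ}
    (h : DiffBound ρ (n + 1) C X a) (i : ℤ) :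
    DiffBound ρ n (C * absE i) (X + absE i) fun k => a k - a (k + i) := by
  intro k
  rw [fwdDiff_iter_sub]
  dsimp only
  rw [fwdDiff_iter_translate]
  set b := (fwdDiff (1 : ℤ))^[n] a with hb
  have hd : ∀ k, ‖fwdDiff (1 : ℤ) b k‖ₑ ≤ C * (X + absE k) ^ ρ := fun k => by
    have := h k
    rwa [Function.iterate_succ_apply'] at this
  rw [mul_assoc, mul_left_comm]
  rcases le_total 0 i with hi | hi
  · obtain ⟨m, rfl⟩ := Int.eq_ofNat_of_zero_le hi
    exact enorm_sub_translate_le hρ hd k m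
  · obtain ⟨m, hm⟩ := Int.eq_ofNat_of_zero_le (neg_nonneg.2 hi)
    obtain rfl : i = -(m : ℤ) := by omega
    have key : ∀ j : ℕ, j ≤ m → ‖b k - b (k - j)‖ₑ ≤ j * (C * (X + m + absE k) ^ ρ) := by
      intro j
      induction j with
      | zero => simp
      | succ j ih =>
        intro hj
        have e : b k - b (k - (j + 1 : ℕ))
            = (b k - b (k - j)) + fwdDiff (1 : ℤ) b (k - (j + 1 : ℕ)) := by
          simp only [fwdDiff]
          push_cast
          rw [show k - ((j : ℤ) + 1) + 1 = k - j by ring]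
          ring
        rw [e]
        refine (enorm_add_le _ _).trans ?_
        push_cast
        rw [add_mul, one_mul]
        refine add_le_add (ih (by omega)) ((hd _).trans ?_)
        refine mul_le_mul' le_rfl (ENNReal.rpow_le_rpow ?_ hρ)
        rw [add_assoc]
        refine add_le_add le_rfl ?_
        rw [sub_eq_add_neg, add_comm k]
        refine (absE_add_le _ _).trans ?_
        gcongr
        unfold absE
        rw [Int.natAbs_neg]
        exact_mod_cast (by omega : (j + 1 : ℤ).natAbs ≤ m)
    have := key m le_rfl
    rw [← sub_eq_add_neg]
    unfold absE at this ⊢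
    rwa [Int.natAbs_neg, Int.natAbs_natCast]

/-- The commutator is linear in h 0, which is expanded in exponentials. For each e_i the outer
commutator is moved onto B and becomes e_i times a multiplier with one difference fewer, which is
the recursion defining `maj`. -/
theorem afc_comms_le {ρ : ℝ} (hρ : 0 ≤ ρ) (n : ℕ) : ∀ (B : CT →L[ℂ] CT) (a : ℤ → ℂ) (C X : ℝ≥0∞)
    (h : Fin n → CT) (w : CT) (l : ℤ), IsMult B a → DiffBound ρ n C X a →
      (∀ j, ∑' k, afc (h j) k ≠ ⊤) →
      afc (comms n h B w) l ≤ C * maj ρ n (fun j => afc (h j)) (afc w) X l := by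
  induction n with
  | zero =>
    intro B a C X h w l hB ha _
    simp only [comms, maj]
    rw [afc, hB, enorm_mul, ← mul_assoc]
    exact mul_le_mul' (ha l) le_rfl
  | succ n ih =>
    intro B a C X h w l hB ha hh
    set h' : Fin n → CT := fun j => h j.succ with hh'
    set F := comms n h' B with hF
    let L : CT →L[ℂ] ℂ := fc l ∘L ((ContinuousLinearMap.mul ℂ CT).flip (F w)
      - F ∘L (ContinuousLinearMap.mul ℂ CT).flip w)
    have hL : ∀ g, L g = fc l (comm g F w) := fun g => rfl
    have hs := hasSum_map_fc L (hh 0)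
    have e0 : afc (comms (n + 1) h B w) l = ‖L (h 0)‖ₑ := rfl
    rw [e0]
    refine (enorm_le_tsum_of_hasSum hs).trans ?_
    simp only [maj]
    rw [← ENNReal.tsum_mul_left]
    refine ENNReal.tsum_le_tsum fun i => ?_
    have e1 : comm (expo i) F = mulOp (expo i) ∘L
        comms n h' (mulOp (expo (-i)) ∘L comm (expo i) B) := by
      rw [hF, ← comms_comm, ← comms_mulOp_comp, comm_expo_eq]
    rw [enorm_smul, hL, e1, ContinuousLinearMap.comp_apply, mulOp_apply, fc_expo_mul]
    have h2 := ih _ _ _ _ h' w (l - i) (hB.comm_expo i) (ha.translate hρ i) fun j => hh j.succ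
    calc _ ≤ afc (h 0) i * (C * absE i * maj ρ n (fun j => afc (h' j)) (afc w) (X + absE i) (l - i)) :=
          mul_le_mul' le_rfl h2
      _ = _ := by ring

/-- Iterated commutators of a Fourier multiplier with multiplications, in Sobolev spaces. -/
theorem exists_sobN_comms_le {q r : ℝ} (hr : 1 ≤ r) (hq : 3 / 2 + r < q) (n : ℕ) :
    ∃ M : ℝ≥0∞, M ≠ ⊤ ∧ ∀ (B : CT →L[ℂ] CT) (a : ℤ → ℂ) (C : ℝ≥0∞) (h : Fin n → CT) (w : CT),
      IsMult B a → DiffBound (r - 1) n C 1 a → (∀ j, ∑' k, afc (h j) k ≠ ⊤) →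
      sobN (q - r) (comms n h B w) ≤ C * M * ((∏ j, sobN q (h j)) * sobN (q - 1) w) := by
  obtain ⟨M, hM, hb⟩ := exists_l2_maj_le (t := q - 1) (by linarith) n
  refine ⟨M, hM, fun B a C h w hB ha hh => ?_⟩
  have h1 := hb (fun j => afc (h j)) (afc w)
  rw [sub_add_cancel] at h1
  rw [mul_assoc]
  refine le_trans ?_ (mul_le_mul' le_rfl h1)
  rw [← l2_const_mul]
  refine l2_mono fun l => ?_
  -- The output weight q - r and the symbol order r - 1 add up to q - 1, the order of the input.
  have h2 := rpow_mul_maj_le (s := q - r) (ρ := r - 1) (by linarith) (by linarith) n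
    (fun j => afc (h j)) (afc w) 1 (1 + absE l) l le_rfl
  rw [show q - r + (r - 1) = q - 1 by ring] at h2
  calc wt (q - r) l * afc (comms n h B w) l
      ≤ (1 + absE l) ^ (q - r) * (C * maj (r - 1) n (fun j => afc (h j)) (afc w) 1 l) :=
        mul_le_mul' (wt_le_one_add_absE (by linarith) l)
          (afc_comms_le (by linarith) n B a C 1 h w l hB ha hh)
    _ ≤ _ := by
      rw [mul_left_comm]
      exact mul_le_mul' le_rfl h2

end

end CircleSobolev

/-! ### Passing to the limit with uniformly bounded derivatives. -/

namespace CircleSobolev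

noncomputable section

open scoped ENNReal NNReal

open Filter Topology

/-! ### Limits of families of smooth maps with uniformly bounded derivatives -/

theorem enorm_le_ofReal_iff {Y : Type*} [SeminormedAddCommGroup Y] {x : Y} {B : ℝ} (hB : 0 ≤ B) :
    ‖x‖ₑ ≤ ENNReal.ofReal B ↔ ‖x‖ ≤ B := by
  rw [← ofReal_norm, ENNReal.ofReal_le_ofReal_iff hB]

/-- The mean value inequality applied twice; the sharp factor 1/2 is not needed. -/
theorem norm_taylor_two_le {Y : Type*} [NormedAddCommGroup Y] [NormedSpace ℝ Y]
    {γ γ' γ'' : ℝ → Y} {B : ℝ} (h1 : ∀ t, HasDerivAt γ (γ' t) t)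
    (h2 : ∀ t, HasDerivAt γ' (γ'' t) t) (hB : ∀ t ∈ Set.Icc (0 : ℝ) 1, ‖γ'' t‖ ≤ B) :
    ‖γ 1 - γ 0 - γ' 0‖ ≤ B := by
  have hI : Convex ℝ (Set.Icc (0 : ℝ) 1) := convex_Icc 0 1
  have hB0 : 0 ≤ B := (norm_nonneg _).trans (hB 0 (by simp))
  have h3 : ∀ t ∈ Set.Icc (0 : ℝ) 1, ‖γ' t - γ' 0‖ ≤ B := fun t ht => by
    have := hI.norm_image_sub_le_of_norm_hasDerivWithin_le
      (fun x _ => (h2 x).hasDerivWithinAt) hB (by simp : (0 : ℝ) ∈ Set.Icc (0 : ℝ) 1) ht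
    refine this.trans ?_
    rw [sub_zero, Real.norm_of_nonneg ht.1]
    exact mul_le_of_le_one_right hB0 ht.2
  have h4 : ∀ t ∈ Set.Icc (0 : ℝ) 1,
      HasDerivWithinAt (fun t => γ t - t • γ' 0) (γ' t - γ' 0) (Set.Icc 0 1) t := fun t _ => by
    have := (h1 t).sub ((hasDerivAt_id t).smul_const (γ' 0))
    rw [one_smul] at this
    exact this.hasDerivWithinAt
  have := hI.norm_image_sub_le_of_norm_hasDerivWithin_le h4 h3
    (by simp : (0 : ℝ) ∈ Set.Icc (0 : ℝ) 1) (by simp : (1 : ℝ) ∈ Set.Icc (0 : ℝ) 1)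
  simp only [one_smul, zero_smul, sub_zero, norm_one, mul_one] at this
  rwa [sub_right_comm] at this

/-- The trigonometric monomial in `H^s`. -/
def monomial (s : ℝ) (l : ℤ) : Sob s :=
  Sob.mk (Pi.single l 1) (summable_of_ne_finset_zero (s := {l}) fun k hk => by
    have : k ≠ l := by simpa using hk
    simp [this])

theorem coeff_sum_monomial {s : ℝ} (K : Finset ℤ) (x : ℤ → ℂ) (l : ℤ) :
    (∑ k ∈ K, x k • monomial s k).coeff l = if l ∈ K then x l else 0 := by
  let L : Sob s →ₗ[ℂ] ℂ :=
    { toFun := fun u => u.coeff l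
      map_add' := fun _ _ => rfl
      map_smul' := fun _ _ => rfl }
  have h : (∑ k ∈ K, x k • monomial s k).coeff l = ∑ k ∈ K, L (x k • monomial s k) := map_sum L _ _
  have h2 : ∀ k, L (x k • monomial s k) = if k = l then x k else 0 := fun k => by
    change x k * (Pi.single k (1 : ℂ) : ℤ → ℂ) l = _
    rw [Pi.single_apply]
    by_cases hk : k = l
    · simp [hk]
    · simp [hk, Ne.symm hk]
  rw [h]
  simp only [h2]
  simp

theorem enorm_sum_monomial {s : ℝ} (K : Finset ℤ) (x : ℤ → ℂ) :
    ‖∑ k ∈ K, x k • monomial s k‖ₑ = wl2 s fun l => if l ∈ K then ‖x l‖ₑ else 0 := by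
  rw [Sob.enorm_eq]
  congr 1
  funext l
  rw [coeff_sum_monomial]
  split_ifs <;> simp

/-- Along an ultrafilter every bounded sequence converges, so all coefficients have limits
simultaneously and the limits inherit linearity; no subsequence has to be extracted. -/
theorem exists_tendsto_hyperfilter {f : ℕ → ℂ} {M : ℝ} (h : ∀ N, ‖f N‖ ≤ M) :
    ∃ z, Tendsto f (hyperfilter ℕ : Filter ℕ) (𝓝 z) := by
  have hc := isCompact_closedBall (0 : ℂ) M
  obtain ⟨z, -, hz⟩ := hc.ultrafilter_le_nhds ((hyperfilter ℕ).map f) (by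
    rw [Ultrafilter.coe_map, le_principal_iff, mem_map]
    exact univ_mem' fun N => by simpa using h N)
  exact ⟨z, hz⟩

section Limit

variable {E V : Type*} [NormedAddCommGroup E] [NormedSpace ℝ E] [NormedAddCommGroup V]
  [NormedSpace ℂ V] {s : ℝ}

/-- Limits of uniformly bounded families of multilinear maps with values in `H^s`. -/
theorem exists_limit_multilinear {n : ℕ}
    (X : ℕ → V → ℤ → MultilinearMap ℝ (fun _ : Fin n => E) ℂ) {M : ℝ} (hM : 0 ≤ M)
    (hadd : ∀ N v v' l h, X N (v + v') l h = X N v l h + X N v' l h)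
    (hsmul : ∀ N (c : ℂ) v l h, X N (c • v) l h = c * X N v l h)
    (hX : ∀ N v h, wl2 s (fun l => ‖X N v l h‖ₑ) ≤ ENNReal.ofReal (M * (∏ j, ‖h j‖) * ‖v‖)) :
    ∃ T : ContinuousMultilinearMap ℝ (fun _ : Fin n => E) (V →L[ℂ] Sob s),
      ∀ h v l, Tendsto (fun N => X N v l h) (hyperfilter ℕ : Filter ℕ) (𝓝 ((T h v).coeff l)) := by
  have hb : ∀ v l h, ∃ B : ℝ, ∀ N, ‖X N v l h‖ ≤ B := fun v l h => by
    refine ⟨((wt s l)⁻¹ * ENNReal.ofReal (M * (∏ j, ‖h j‖) * ‖v‖)).toReal, fun N => ?_⟩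
    have h1 := (le_l2 (fun l => wt s l * ‖X N v l h‖ₑ) l).trans (hX N v h)
    rw [← ofReal_norm, mul_comm, ← ENNReal.le_div_iff_mul_le (Or.inl (wt_ne_zero s l))
      (Or.inl (wt_ne_top s l)), ENNReal.div_eq_inv_mul] at h1
    refine (ENNReal.ofReal_le_iff_le_toReal ?_).1 h1
    exact ENNReal.mul_ne_top (ENNReal.inv_ne_top.2 (wt_ne_zero s l)) ENNReal.ofReal_ne_top
  have hlim : ∀ v l h, ∃ z, Tendsto (fun N => X N v l h) (hyperfilter ℕ : Filter ℕ) (𝓝 z) :=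
    fun v l h => exists_tendsto_hyperfilter (hb v l h).choose_spec
  choose z hz using hlim
  -- Fatou's lemma: coefficientwise limits keep the uniform H^s bound.
  have hzb : ∀ v h, wl2 s (fun l => ‖z v l h‖ₑ) ≤ ENNReal.ofReal (M * (∏ j, ‖h j‖) * ‖v‖) :=
    fun v h => wl2_le_of_tendsto (fun l => (continuous_enorm.tendsto _).comp (hz v l h))
      (Eventually.of_forall fun N => hX N v h)
  let A : (Fin n → E) → V →L[ℂ] Sob s := fun h => LinearMap.mkContinuous
    { toFun := fun v =>
        Sob.ofSeq (fun l => z v l h) (ne_top_of_le_ne_top ENNReal.ofReal_ne_top (hzb v h))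
      map_add' := fun v v' => Sob.ext fun l => by
        refine tendsto_nhds_unique (hz (v + v') l h) ?_
        simp only [hadd]
        exact (hz v l h).add (hz v' l h)
      map_smul' := fun c v => Sob.ext fun l => by
        refine tendsto_nhds_unique (hz (c • v) l h) ?_
        simp only [hsmul]
        exact (hz v l h).const_mul c } (M * ∏ j, ‖h j‖) fun v => by
      have h0 : 0 ≤ ∏ j, ‖h j‖ := Finset.prod_nonneg fun _ _ => norm_nonneg _
      rw [← enorm_le_ofReal_iff (by positivity), Sob.enorm_eq]
      exact hzb v h
  have hA : ∀ h v l, (A h v).coeff l = z v l h := fun h v l => rfl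
  refine ⟨MultilinearMap.mkContinuous
    { toFun := A
      map_update_add' := fun h i x y => by
        ext1 v
        refine Sob.ext fun l => ?_
        rw [add_apply, Sob.coeff_add, hA, hA, hA]
        refine tendsto_nhds_unique (hz v l _) ?_
        convert (hz v l _).add (hz v l _) using 2 with N
        exact (X N v l).map_update_add h i x y
      map_update_smul' := fun h i c x => by
        ext1 v
        refine Sob.ext fun l => ?_
        rw [smul_apply]
        change z v l _ = (c : ℂ) * z v l _
        refine tendsto_nhds_unique (hz v l _) ?_
        convert (hz v l _).const_mul (c : ℂ) using 2 with N
        exact ((X N v l).map_update_smul h i c x).trans (Complex.real_smul) } M fun h => ?_, fun h v l => hz v l h⟩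
  have h0 : 0 ≤ ∏ j, ‖h j‖ := Finset.prod_nonneg fun _ _ => norm_nonneg _
  refine ContinuousLinearMap.opNorm_le_bound _ (by positivity) fun v => ?_
  rw [← enorm_le_ofReal_iff (by positivity), Sob.enorm_eq]
  exact hzb v h

/-- A limit of smooth maps with values in operators into `H^s`, whose derivatives are uniformly
bounded, is smooth. -/
theorem exists_contDiffOn_limit
    (X : ℕ → (n : ℕ) → E → V → ℤ → MultilinearMap ℝ (fun _ : Fin n => E) ℂ) {u₀ : E} {δ : ℝ}
    (hadd : ∀ N n u v v' l h, X N n u (v + v') l h = X N n u v l h + X N n u v' l h)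
    (hsmul : ∀ N n u (c : ℂ) v l h, X N n u (c • v) l h = c * X N n u v l h)
    (hX : ∀ n, ∃ M : ℝ, 0 ≤ M ∧ ∀ N, ∀ u ∈ Metric.ball u₀ δ, ∀ v h,
      wl2 s (fun l => ‖X N n u v l h‖ₑ) ≤ ENNReal.ofReal (M * (∏ j, ‖h j‖) * ‖v‖))
    (hd : ∀ N n u d v l h t, HasDerivAt (fun t : ℝ => X N n (u + t • d) v l h)
      (X N (n + 1) (u + t • d) v l (Fin.cons d h)) t) :
    ∃ T : E → V →L[ℂ] Sob s, ContDiffOn ℝ ∞ T (Metric.ball u₀ δ) ∧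
      ∀ u ∈ Metric.ball u₀ δ, ∀ v l, Tendsto (fun N => X N 0 u v l 0)
        (hyperfilter ℕ : Filter ℕ) (𝓝 ((T u v).coeff l)) := by
  choose M hM hX using hX
  have hT : ∀ n u, ∃ T : ContinuousMultilinearMap ℝ (fun _ : Fin n => E) (V →L[ℂ] Sob s),
      u ∈ Metric.ball u₀ δ → ∀ h v l,
        Tendsto (fun N => X N n u v l h) (hyperfilter ℕ : Filter ℕ) (𝓝 ((T h v).coeff l)) :=
    fun n u => by
      by_cases hu : u ∈ Metric.ball u₀ δ
      · obtain ⟨T, hT⟩ := exists_limit_multilinear (fun N => X N n u) (hM n)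
          (fun N => hadd N n u) (fun N => hsmul N n u) (fun N => hX n N u hu)
        exact ⟨T, fun _ => hT⟩
      · exact ⟨0, fun h => absurd h hu⟩
  choose T hT using hT
  -- The quadratic remainder involves only the bound of order n + 2, which does not depend on N and
  -- so survives the limit in operator norm.
  have key : ∀ n, ∀ u₁ ∈ Metric.ball u₀ δ, ∀ u₂ ∈ Metric.ball u₀ δ,
      ‖T n u₂ - T n u₁ - (T (n + 1) u₁).curryLeft (u₂ - u₁)‖ ≤ M (n + 2) * ‖u₂ - u₁‖ ^ 2 := by
    intro n u₁ h₁ u₂ h₂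
    set d := u₂ - u₁ with hdd
    have hM2 := hM (n + 2)
    refine ContinuousMultilinearMap.opNorm_le_bound (by positivity) fun h => ?_
    refine ContinuousLinearMap.opNorm_le_bound _ (by positivity) fun v => ?_
    set B := M (n + 2) * ‖d‖ ^ 2 * (∏ j, ‖h j‖) * ‖v‖ with hB
    have hB0 : 0 ≤ B := by positivity
    have hline : ∀ t ∈ Set.Icc (0 : ℝ) 1, u₁ + t • d ∈ Metric.ball u₀ δ := fun t ht =>
      (convex_ball u₀ δ).add_smul_sub_mem h₁ h₂ ht
    -- Derivatives are known coefficient by coefficient; restricting to a finite set K of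
    -- frequencies gives a genuinely differentiable curve in H^s.
    have hfin : ∀ (N : ℕ) (K : Finset ℤ), wl2 s (fun l => if l ∈ K then
        ‖X N n u₂ v l h - X N n u₁ v l h - X N (n + 1) u₁ v l (Fin.cons d h)‖ₑ else 0)
          ≤ ENNReal.ofReal B := by
      intro N K
      have hγ : ∀ m (h : Fin m → E) t, HasDerivAt
          (fun t : ℝ => ∑ l ∈ K, X N m (u₁ + t • d) v l h • monomial s l)
          (∑ l ∈ K, X N (m + 1) (u₁ + t • d) v l (Fin.cons d h) • monomial s l) t := fun m h t =>
        HasDerivAt.fun_sum fun l _ => (hd N m u₁ d v l h t).smul_const _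
      have := norm_taylor_two_le (hγ n h) (hγ (n + 1) (Fin.cons d h)) (B := B) fun t ht => by
        rw [← enorm_le_ofReal_iff hB0, enorm_sum_monomial]
        refine le_trans (wl2_mono fun l => ?_) ((hX (n + 2) N _ (hline t ht) v
            (Fin.cons d (Fin.cons d h))).trans (le_of_eq ?_))
        · split_ifs
          · exact le_rfl
          · exact zero_le
        · rw [hB, Fin.prod_univ_succ, Fin.prod_univ_succ]
          simp only [Fin.cons_zero, Fin.cons_succ]
          congr 1
          ring
      simp only [one_smul, zero_smul, add_zero] at this
      rw [← Finset.sum_sub_distrib, ← Finset.sum_sub_distrib] at this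
      simp only [← sub_smul] at this
      rw [hdd, add_sub_cancel, ← hdd] at this
      rw [← enorm_sum_monomial]
      exact (enorm_le_ofReal_iff hB0).2 this
    rw [← enorm_le_ofReal_iff hB0, Sob.enorm_eq]
    -- The cutoff N and the set of frequencies K are sent to the limit together.
    refine wl2_le_of_tendsto (L := (hyperfilter ℕ : Filter ℕ) ×ˢ (atTop : Filter (Finset ℤ)))
      (F := fun NK l => if l ∈ NK.2 then ‖X NK.1 n u₂ v l h - X NK.1 n u₁ v l h
        - X NK.1 (n + 1) u₁ v l (Fin.cons d h)‖ₑ else 0) (fun l => ?_)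
      (Eventually.of_forall fun NK => hfin NK.1 NK.2)
    have h3 := ((hT n u₂ h₂ h v l).sub (hT n u₁ h₁ h v l)).sub (hT (n + 1) u₁ h₁ (Fin.cons d h) v l)
    have h4 := (continuous_enorm.tendsto _).comp (h3.comp
      (tendsto_fst (f := (hyperfilter ℕ : Filter ℕ)) (g := (atTop : Filter (Finset ℤ)))))
    refine h4.congr' ?_
    filter_upwards [tendsto_snd.eventually (eventually_ge_atTop ({l} : Finset ℤ))] with NK hNK
    rw [if_pos (hNK (Finset.mem_singleton_self l))]
    rfl
  have hderiv : ∀ n, ∀ u ∈ Metric.ball u₀ δ, HasFDerivAt (T n) (T (n + 1) u).curryLeft u := by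
    intro n u hu
    refine (hasFDerivAt_iff_isLittleO (𝕜 := ℝ) (E := E)
      (F := ContinuousMultilinearMap ℝ (fun _ : Fin n => E) (V →L[ℂ] Sob s)) (f := T n)
      (f' := (T (n + 1) u).curryLeft) (x := u)).2 ?_
    refine Asymptotics.IsBigO.trans_isLittleO (g := fun x => ‖x - u‖ ^ 2) ?_
      (Asymptotics.isLittleO_pow_sub_sub u one_lt_two)
    refine Asymptotics.IsBigO.of_bound (M (n + 2)) ?_
    filter_upwards [Metric.isOpen_ball.mem_nhds hu] with x hx
    rw [Real.norm_of_nonneg (by positivity)]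
    exact key n u hu x hx
  refine ⟨fun u => T 0 u 0, ?_, fun u hu v l => hT 0 u hu 0 v l⟩
  have hF : HasFTaylorSeriesUpToOn ∞ (fun u => T 0 u 0) (fun u n => T n u) (Metric.ball u₀ δ) :=
    { zero_eq := fun u _ => rfl
      fderivWithin := fun m _ u hu => (hderiv m u hu).hasFDerivWithinAt
      cont := fun m _ u hu => (hderiv m u hu).continuousAt.continuousWithinAt }
  exact hF.contDiffOn

end Limit

end

end CircleSobolev

/-! ### Conjugated multipliers with explicit kernels, and their derivatives. -/

namespace CircleSobolev

noncomputable section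

open scoped ENNReal NNReal

open Filter Topology

/-! ### Multilinearity of iterated commutators -/

theorem comm_add_left (g g' : CT) (B : CT →L[ℂ] CT) : comm (g + g') B = comm g B + comm g' B := by
  ext1 w
  rw [add_apply]
  simp only [comm_apply, add_mul, map_add]
  abel

theorem comm_smul_left (c : ℂ) (g : CT) (B : CT →L[ℂ] CT) : comm (c • g) B = c • comm g B := by
  ext1 w
  rw [smul_apply]
  simp only [comm_apply, smul_mul_assoc, map_smul, smul_sub]

theorem comm_add_right (g : CT) (B B' : CT →L[ℂ] CT) : comm g (B + B') = comm g B + comm g B' := by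
  ext1 w
  simp only [comm_apply, add_apply, mul_add]
  abel

theorem comm_smul_right (c : ℂ) (g : CT) (B : CT →L[ℂ] CT) : comm g (c • B) = c • comm g B := by
  ext1 w
  simp only [comm_apply, smul_apply, mul_smul_comm, smul_sub]

theorem comms_update_add (n : ℕ) : ∀ [DecidableEq (Fin n)] (h : Fin n → CT) (i : Fin n) (x y : CT)
    (B : CT →L[ℂ] CT), comms n (Function.update h i (x + y)) B
      = comms n (Function.update h i x) B + comms n (Function.update h i y) B := by
  induction n with
  | zero => intro _ h i; exact i.elim0
  | succ n ih =>
    intro inst h i x y B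
    obtain rfl : inst = instDecidableEqFin (n + 1) := Subsingleton.elim _ _
    refine Fin.cases ?_ (fun i => ?_) i
    · have e : ∀ z, (fun j : Fin n => Function.update h 0 z j.succ) = fun j => h j.succ :=
        fun z => funext fun j => Function.update_of_ne (Fin.succ_ne_zero j) _ _
      simp only [comms, e, Function.update_self, comm_add_left]
    · have e : ∀ z, (fun j : Fin n => Function.update h i.succ z j.succ)
          = Function.update (fun j => h j.succ) i z := fun z => by
        funext j
        simp only [Function.update_apply, Fin.succ_inj]
      simp only [comms, e, ih, comm_add_right,
        Function.update_of_ne (Fin.succ_ne_zero i).symm]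

theorem comms_update_smul (n : ℕ) : ∀ [DecidableEq (Fin n)] (h : Fin n → CT) (i : Fin n) (c : ℂ) (x : CT)
    (B : CT →L[ℂ] CT), comms n (Function.update h i (c • x)) B
      = c • comms n (Function.update h i x) B := by
  induction n with
  | zero => intro _ h i; exact i.elim0
  | succ n ih =>
    intro inst h i c x B
    obtain rfl : inst = instDecidableEqFin (n + 1) := Subsingleton.elim _ _
    refine Fin.cases ?_ (fun i => ?_) i
    · have e : ∀ z, (fun j : Fin n => Function.update h 0 z j.succ) = fun j => h j.succ :=
        fun z => funext fun j => Function.update_of_ne (Fin.succ_ne_zero j) _ _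
      simp only [comms, e, Function.update_self, comm_smul_left]
    · have e : ∀ z, (fun j : Fin n => Function.update h i.succ z j.succ)
          = Function.update (fun j => h j.succ) i z := fun z => by
        funext j
        simp only [Function.update_apply, Fin.succ_inj]
      simp only [comms, e, ih, comm_smul_right,
        Function.update_of_ne (Fin.succ_ne_zero i).symm]

/-! ### Conjugated Fourier multipliers -/

/-- The function `exp(2πik(x + U(x)))`. -/
def expShift (k : ℤ) (U : CT) : CT := expo k * NormedSpace.exp (tpi k • U)

theorem expShift_zero (k : ℤ) : expShift k 0 = expo k := by
  have h : tpi k • (0 : CT) = 0 := by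
    ext x
    simp
  rw [expShift, h, NormedSpace.exp_zero, mul_one]

theorem expShift_apply (k : ℤ) (U : CT) (x : UnitAddCircle) :
    expShift k U x = expo k x * Complex.exp (tpi k * U x) := by
  have h := NormedSpace.map_exp (ContinuousMap.evalAlgHom ℂ ℂ x)
    (continuous_eval_const x) (tpi k • U)
  rw [expShift, ContinuousMap.mul_apply, Complex.exp_eq_exp_ℂ]
  congr 1

theorem hasDerivAt_expShift (k : ℤ) (U D : CT) (t : ℝ) :
    HasDerivAt (fun t : ℝ => expShift k (U + (t : ℂ) • D))
      (tpi k • (D * expShift k (U + (t : ℂ) • D))) t := by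
  have h1 : HasDerivAt (fun t : ℝ => tpi k • (U + (t : ℂ) • D)) (tpi k • D) t := by
    have := (((Complex.ofRealCLM.hasDerivAt (x := t)).smul_const D).const_add U).const_smul (tpi k)
    refine this.congr_deriv ?_
    rw [Complex.ofRealCLM_apply, Complex.ofReal_one, one_smul]
  have h2 := (hasFDerivAt_exp (𝕂 := ℝ) (x := tpi k • (U + (t : ℂ) • D))).comp_hasDerivAt _ h1
  refine (h2.const_mul (expo k)).congr_deriv ?_
  rw [expShift]
  ext x
  simp
  ring

/-- The operator `w ↦ ∑ₖ cₖ e_k(x + U(x)) ∫ e_{-k}(y + U(y)) w(y) dy`. -/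
def conjOp (S : Finset ℤ) (c : ℤ → ℂ) (U : CT) : CT →L[ℂ] CT :=
  ∑ k ∈ S, c k • (circleInt ∘L mulOp (expShift (-k) U)).smulRight (expShift k U)

theorem conjOp_apply (S : Finset ℤ) (c : ℤ → ℂ) (U w : CT) :
    conjOp S c U w = ∑ k ∈ S, (c k * circleInt (expShift (-k) U * w)) • expShift k U := by
  unfold conjOp
  rw [sum_apply]
  refine Finset.sum_congr rfl fun k _ => ?_
  rw [smul_apply, ContinuousLinearMap.smulRight_apply, smul_smul]
  rfl

theorem isMult_conjOp {S : Finset ℤ} {c : ℤ → ℂ} (hc : ∀ k ∉ S, c k = 0) :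
    IsMult (conjOp S c 0) c := fun w l => by
  have h : conjOp S c 0 w = trig S fun k => c k * fc k w := by
    rw [conjOp_apply]
    simp only [expShift_zero]
    rfl
  rw [h, fc_trig]
  split_ifs with hl
  · rfl
  · rw [hc l hl, zero_mul]

/-- The two exponentials in the kernel carry opposite signs of k. The product rule thus yields 2πik
(D(x) - D(y)), a commutator with symbol c_k · 2πik. -/
theorem hasDerivAt_conjOp (S : Finset ℤ) (c : ℤ → ℂ) (U D w : CT) (t : ℝ) :
    HasDerivAt (fun t : ℝ => conjOp S c (U + (t : ℂ) • D) w)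
      (comm D (conjOp S (fun k => c k * tpi k) (U + (t : ℂ) • D)) w) t := by
  simp only [conjOp_apply]
  refine (HasDerivAt.fun_sum (u := S) fun k _ => (((circleInt.restrictScalars ℝ).hasFDerivAt.comp_hasDerivAt t
    ((hasDerivAt_expShift (-k) U D t).mul_const w)).const_mul (c k)).smul
      (hasDerivAt_expShift k U D t)).congr_deriv ?_
  rw [comm_apply, conjOp_apply, conjOp_apply, Finset.mul_sum, ← Finset.sum_sub_distrib]
  refine Finset.sum_congr rfl fun k _ => ?_
  set A := expShift k (U + (t : ℂ) • D)
  set A' := expShift (-k) (U + (t : ℂ) • D)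
  have e1 : circleInt.restrictScalars ℝ (tpi (-k) • (D * A') * w) = -(tpi k * circleInt (A' * (D * w))) := by
    change circleInt _ = _
    have : tpi (-k) • (D * A') * w = tpi (-k) • (A' * (D * w)) := by
      rw [smul_mul_assoc, mul_comm D A', mul_assoc]
    rw [this, map_smul, tpi_neg, smul_eq_mul, neg_mul]
  rw [e1]
  ext x
  simp
  ring

/-- With h fixed, iterated commutators are linear in the operator, so differentiation passes
through. -/
theorem hasDerivAt_comms (n : ℕ) : ∀ (h : Fin n → CT) (S : Finset ℤ) (c : ℤ → ℂ) (U D w : CT) (t : ℝ),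
    HasDerivAt (fun t : ℝ => comms n h (conjOp S c (U + (t : ℂ) • D)) w)
      (comms n h (comm D (conjOp S (fun k => c k * tpi k) (U + (t : ℂ) • D))) w) t := by
  induction n with
  | zero => intro h S c U D w t; exact hasDerivAt_conjOp S c U D w t
  | succ n ih =>
    intro h S c U D w t
    exact ((ih _ S c U D w t).const_mul (h 0)).sub (ih _ S c U D (h 0 * w) t)

theorem Dif.circleInt_rt (D : Dif) (f : CT) : circleInt (D.rt f * D.dC) = circleInt f := by
  rw [circleInt_apply, circleInt_apply, ← D.integral_rt (f.continuous)]
  refine MeasureTheory.integral_congr_ae (Eventually.of_forall fun x => ?_)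
  change f (D.toMap x) * (D.d x : ℂ) = D.d x • f (D.toMap x)
  rw [Complex.real_smul, mul_comm]

/-- Right translation is multiplicative and hence carries commutators to commutators. The factor D'
on the input is the Jacobian of ∫ e_{-k} w, so the conjugate of an operator followed by d/dx
involves no inverse derivative. -/
theorem Dif.comms_rt (D : Dif) {U : CT} (hU : ∀ k, D.rt (expo k) = expShift k U) (n : ℕ) :
    ∀ (g : Fin n → CT) (S : Finset ℤ) (c : ℤ → ℂ) (w : CT),
      comms n (fun j => D.rt (g j)) (conjOp S c U) (D.rt w * D.dC)
        = D.rt (comms n g (conjOp S c 0) w) := by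
  induction n with
  | zero =>
    intro g S c w
    simp only [comms]
    rw [conjOp_apply, conjOp_apply]
    have e : D.rt (∑ k ∈ S, (c k * circleInt (expShift (-k) 0 * w)) • expShift k 0)
        = ∑ k ∈ S, D.rt ((c k * circleInt (expShift (-k) 0 * w)) • expShift k 0) := by
      ext x
      simp
    rw [e]
    refine Finset.sum_congr rfl fun k _ => ?_
    rw [D.rt_smul, expShift_zero, expShift_zero, ← hU, ← hU, ← mul_assoc, ← D.rt_mul, D.circleInt_rt]
  | succ n ih =>
    intro g S c w
    simp only [comms, comm_apply]
    rw [← mul_assoc, ← D.rt_mul, ih (fun j => g j.succ), ih (fun j => g j.succ), D.rt_sub, D.rt_mul]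

end

end CircleSobolev

/-! ### Local smoothness in terms of the lift. -/

namespace CircleSobolev

noncomputable section

open scoped ENNReal NNReal

open Filter Topology

theorem rt_expo_difOf {q : ℝ} (hq : 3 / 2 < q) {u : RSob q} (hu : u ∈ diffLifts q) (k : ℤ) :
    (difOf hq u hu).rt (expo k) = expShift k u.1.toCT := by
  ext x
  obtain ⟨y, rfl⟩ := eq_coe_of_circle x
  rw [expShift_apply, RSob.toCT_coe (by linarith), Dif.rt_apply]
  change (fourier k ((u.lift y : ℝ) : UnitAddCircle) : ℂ)
    = fourier k (y : UnitAddCircle) * Complex.exp (tpi k * (u.fn y : ℂ))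
  rw [fourier_coe_apply, fourier_coe_apply, ← Complex.exp_add]
  congr 1
  unfold RSob.lift tpi
  push_cast
  ring

namespace Dif.IsInv

theorem rt_rt {D E : Dif} (h : D.IsInv E) (f : CT) : D.rt (E.rt f) = f := by
  ext x
  rw [Dif.rt_apply, Dif.rt_apply, h.left]

theorem rt_der {D E : Dif} (h : D.IsInv E) (f : CT) : D.rt (E.rt f * E.dC) * D.dC = f := by
  ext x
  have h1 := h.d_mul (D.toMap x)
  rw [h.left] at h1
  change f (E.toMap (D.toMap x)) * (E.d (D.toMap x) : ℂ) * (D.d x : ℂ) = f x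
  rw [h.left, mul_assoc, ← Complex.ofReal_mul, h1, Complex.ofReal_one, mul_one]

end Dif.IsInv

/-- Uniform estimates of the iterated commutators of conjugated Fourier multipliers. -/
theorem exists_local_sobN_comms_le {q r : ℝ} (hr : 1 ≤ r) (hq : 3 / 2 + r < q) {u₀ : RSob q}
    (hu₀ : u₀ ∈ diffLifts q) :
    ∃ δ > 0, (∀ u ∈ Metric.ball u₀ δ, u ∈ diffLifts q) ∧
      (∀ u ∈ Metric.ball u₀ δ, ∀ hu : u ∈ diffLifts q, ∀ E, (difOf (by linarith) u hu).IsInv E →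
        ∃ C : ℝ≥0∞, C ≠ ⊤ ∧ RtBound E q C) ∧
      ∀ n, ∃ M : ℝ≥0∞, M ≠ ⊤ ∧ ∀ (S : Finset ℤ) (c : ℤ → ℂ) (C : ℝ≥0∞), C ≠ ⊤ →
        (∀ k ∉ S, c k = 0) →
        DiffBound (r - 1) n C 1 c → ∀ u ∈ Metric.ball u₀ δ, ∀ (h : Fin n → Sob q) (v : Sob q),
          sobN (q - r) (comms n (fun j => (h j).toCT) (conjOp S c u.1.toCT) v.derCT)
            ≤ C * M * ((∏ j, ‖h j‖ₑ) * ‖v‖ₑ) := by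
  have hq' : 3 / 2 < q := by linarith
  have hq1 : 1 / 2 < q := by linarith
  obtain ⟨δ, hδ, C₁, hC₁, hloc⟩ :=
    exists_local_rtBound (s := q - r) hq' (by linarith) (by linarith) hu₀
  have hloc' : ∀ u ∈ Metric.ball u₀ δ, ∃ hu : u ∈ diffLifts q,
      RtBound (difOf hq' u hu) (q - r) C₁ ∧ ∀ E, (difOf hq' u hu).IsInv E → RtBound E q C₁ :=
    fun u hu => hloc u (by rwa [Metric.mem_ball, dist_eq_norm] at hu)
  refine ⟨δ, hδ, fun u hu => (hloc' u hu).1, fun u hu hu' E hE =>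
    ⟨C₁, hC₁, (hloc' u hu).2.2 E hE⟩, fun n => ?_⟩
  obtain ⟨M, hM, hb⟩ := exists_sobN_comms_le hr hq n
  refine ⟨C₁ * M * (C₁ ^ n * (ENNReal.ofReal (2 * Real.pi) * C₁)), ?_, ?_⟩
  · exact ENNReal.mul_ne_top (ENNReal.mul_ne_top hC₁ hM) (ENNReal.mul_ne_top
      (ENNReal.pow_ne_top hC₁) (ENNReal.mul_ne_top ENNReal.ofReal_ne_top hC₁))
  intro S c C hCt hc hCb u hu h v
  obtain ⟨hu', hD, hE⟩ := hloc' u hu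
  set D := difOf hq' u hu' with hDdef
  obtain ⟨E, hDE⟩ := D.exists_inv
  have hE := hE E hDE
  have hsob : ∀ w : Sob q, sobN q (E.rt w.toCT) ≤ C₁ * ‖w‖ₑ := fun w => by
    have := hE.sobN_rt_le (w.tsum_afc_toCT hq1)
    rwa [Sob.sobN_toCT hq1] at this
  have hsobt : ∀ w : Sob q, sobN q (E.rt w.toCT) ≠ ⊤ := fun w =>
    ne_top_of_le_ne_top (ENNReal.mul_ne_top hC₁ enorm_ne_top) (hsob w)
  set g : Fin n → CT := fun j => E.rt (h j).toCT with hg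
  -- This is the derivative of v ∘ E, so its H^{q-1} norm is bounded through the H^q norm of v ∘ E,
  -- with no separate estimate of E'.
  set w' : CT := E.rt v.derCT * E.dC with hw'
  have hw : sobN (q - 1) w' ≤ ENNReal.ofReal (2 * Real.pi) * (C₁ * ‖v‖ₑ) := by
    have h1 := (E.isDer_rt (v.isDer_toCT hq')).sobN_der_le (q - 1)
    rw [sub_add_cancel] at h1
    exact h1.trans (mul_le_mul' le_rfl (hsob v))
  have e : comms n (fun j => (h j).toCT) (conjOp S c u.1.toCT) v.derCT
      = D.rt (comms n g (conjOp S c 0) w') := by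
    rw [← D.comms_rt (fun k => rt_expo_difOf hq' hu' k), hw', hDE.rt_der]
    congr 2
    funext j
    rw [hg, hDE.rt_rt]
  have hb1 := hb _ c C g w' (isMult_conjOp hc) hCb fun j => tsum_afc_ne_top hq1 (hsobt (h j))
  have hprod : ∏ j, sobN q (g j) ≤ C₁ ^ n * ∏ j, ‖h j‖ₑ := by
    refine (Finset.prod_le_prod' fun j _ => hsob (h j)).trans (le_of_eq ?_)
    rw [Finset.prod_mul_distrib]
    simp
  rw [e]
  have hb2 := hb1.trans (mul_le_mul' le_rfl (mul_le_mul' hprod hw))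
  -- Finiteness is needed before translating back: the bound for `D.rt` extends beyond trigonometric
  -- polynomials only for summable coefficients.
  have hfin : sobN (q - r) (comms n g (conjOp S c 0) w') ≠ ⊤ := by
    refine ne_top_of_le_ne_top (ENNReal.mul_ne_top (ENNReal.mul_ne_top hCt hM)
      (ENNReal.mul_ne_top (ENNReal.mul_ne_top (ENNReal.pow_ne_top hC₁)
        (ENNReal.prod_ne_top fun j _ => enorm_ne_top))
      (ENNReal.mul_ne_top ENNReal.ofReal_ne_top (ENNReal.mul_ne_top hC₁ enorm_ne_top)))) hb2
  refine (hD.sobN_rt_le (tsum_afc_ne_top (by linarith) hfin)).trans ?_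
  refine (mul_le_mul' le_rfl hb2).trans (le_of_eq ?_)
  ring

theorem RSob.toCT_smul {q : ℝ} (hq : 1 / 2 < q) (c : ℝ) (u : RSob q) :
    (c • u).1.toCT = (c : ℂ) • u.1.toCT := Sob.toCT_smul hq (c : ℂ) u.1

theorem RSob.toCT_add {q : ℝ} (hq : 1 / 2 < q) (u v : RSob q) :
    (u + v).1.toCT = u.1.toCT + v.1.toCT := Sob.toCT_add hq u.1 v.1

/-- Fourier coefficients of iterated commutators, as multilinear maps. -/
def commsCoeff {q : ℝ} (hq : 1 / 2 < q) (n : ℕ) (B : CT →L[ℂ] CT) (w : CT) (l : ℤ) :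
    MultilinearMap ℝ (fun _ : Fin n => RSob q) ℂ where
  toFun h := fc l (comms n (fun j => (h j).1.toCT) B w)
  map_update_add' h i x y := by
    have e : ∀ z : RSob q, (fun j => (Function.update h i z j).1.toCT)
        = Function.update (fun j => (h j).1.toCT) i z.1.toCT := fun z =>
      funext fun j => Function.apply_update (fun _ (u : RSob q) => u.1.toCT) h i z j
    rw [e, e, e, RSob.toCT_add hq, comms_update_add, add_apply, map_add]
  map_update_smul' h i c x := by
    have e : ∀ z : RSob q, (fun j => (Function.update h i z j).1.toCT)
        = Function.update (fun j => (h j).1.toCT) i z.1.toCT := fun z =>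
      funext fun j => Function.apply_update (fun _ (u : RSob q) => u.1.toCT) h i z j
    rw [e, e, RSob.toCT_smul hq, comms_update_smul, smul_apply, map_smul, Complex.real_smul,
      smul_eq_mul]

theorem commsCoeff_apply {q : ℝ} (hq : 1 / 2 < q) (n : ℕ) (B : CT →L[ℂ] CT) (w : CT) (l : ℤ)
    (h : Fin n → RSob q) :
    commsCoeff hq n B w l h = fc l (comms n (fun j => (h j).1.toCT) B w) := rfl

theorem diffBound_of_norm_le {ρ C : ℝ} (hC : 0 ≤ C) {n : ℕ} {a : ℤ → ℂ}
    (h : ∀ k, ‖(fwdDiff (1 : ℤ))^[n] a k‖ ≤ C * jw k ^ ρ) :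
    DiffBound ρ n (ENNReal.ofReal C) 1 a := fun k => by
  rw [one_add_absE_eq, ENNReal.ofReal_rpow_of_pos (jw_pos k), ← ENNReal.ofReal_mul hC]
  exact (enorm_le_ofReal_iff (mul_nonneg hC (Real.rpow_nonneg (jw_pos k).le _))).2 (h k)

theorem eval_eq_iff {s : ℝ} (hs : 1 / 2 < s) {u v : Sob s} (h : ∀ x, u.eval x = v.eval x) : u = v :=
  Sob.ext fun k => by
    rw [← Sob.fourierCoeff_eval hs u, ← Sob.fourierCoeff_eval hs v, funext h]

/-- Above order 1/2 the pointwise values determine the Sobolev class, both for v ∘ φ⁻¹ and for the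
result. -/
theorem IsConjugate.unique {q s : ℝ} {hq : 3 / 2 < q} (hs : 1 / 2 < s) {P : Sob q →L[ℂ] Sob s}
    {φ : DiffSob q hq} {T T' : Sob q →L[ℂ] Sob s} (h : IsConjugate P φ T)
    (h' : IsConjugate P φ T') : T = T' := by
  ext1 v
  obtain ⟨w, hw, hT⟩ := h v
  obtain ⟨w', hw', hT'⟩ := h' v
  obtain rfl : w = w' := eval_eq_iff (by linarith) fun x => by rw [hw, hw']
  exact eval_eq_iff hs fun x => by rw [hT, hT']

/-- Locally, the conjugation of the multiplier is a smooth function of the lift. -/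
theorem exists_local_smooth {r : ℝ} (hr : 1 ≤ r) {p : ℝ → ℂ}
    (hord : HasOrder (fun k : ℤ => p k) r) {b : ℕ → ℤ → ℂ}
    (hb1 : ∀ N, ∃ S : Finset ℤ, ∀ k ∉ S, b N k = 0)
    (hb2 : ∀ k : ℤ, ∀ᶠ N in atTop, b N k * tpi k = p k - p 0)
    (hb3 : ∀ n, ∃ C, 0 ≤ C ∧ ∀ N k,
      ‖(fwdDiff (1 : ℤ))^[n] (fun k => b N k * tpi k ^ n) k‖ ≤ C * jw k ^ (r - 1))
    (hb4 : ∀ N (k : ℤ), ‖b N k * tpi k‖ ≤ ‖p k - p 0‖)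
    {q : ℝ} (hq : 3 / 2 + r < q) {u₀ : RSob q} (hu₀ : u₀ ∈ diffLifts q) :
    ∃ δ > 0, ∃ T : RSob q → Sob q →L[ℂ] Sob (q - r), ContDiffOn ℝ ∞ T (Metric.ball u₀ δ) ∧
      ∀ u ∈ Metric.ball u₀ δ, ∃ hu : u ∈ diffLifts q,
        IsConjugate (multiplier hord q) (diffOfLift (by linarith) ⟨u, hu⟩) (T u) := by
  have hq' : 3 / 2 < q := by linarith
  have hq1 : 1 / 2 < q := by linarith
  obtain ⟨δ, hδ, hmem, hinv, hbound⟩ := exists_local_sobN_comms_le hr hq hu₀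
  choose S hS using hb1
  have hS' : ∀ N n, ∀ k ∉ S N, b N k * tpi k ^ n = 0 := fun N n k hk => by rw [hS N k hk, zero_mul]
  obtain ⟨T₀, hT₀, hlim⟩ := exists_contDiffOn_limit (V := Sob q) (s := q - r)
    (fun N n u v l => commsCoeff hq1 n (conjOp (S N) (fun k => b N k * tpi k ^ n) u.1.toCT)
      v.derCT l) (u₀ := u₀) (δ := δ)
    (fun N n u v v' l h => by
      simp only [commsCoeff_apply, Sob.derCT_add hq', map_add])
    (fun N n u c v l h => by
      simp only [commsCoeff_apply, Sob.derCT_smul hq', map_smul, smul_eq_mul])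
    (fun n => by
      obtain ⟨C, hC, hCb⟩ := hb3 n
      obtain ⟨M, hM, hMb⟩ := hbound n
      refine ⟨(ENNReal.ofReal C * M).toReal, ENNReal.toReal_nonneg, fun N u hu v h => ?_⟩
      have := hMb (S N) _ _ ENNReal.ofReal_ne_top (hS' N n) (diffBound_of_norm_le hC (hCb N)) u hu
        (fun j => (h j).1) v
      refine le_trans this (le_of_eq ?_)
      rw [mul_assoc (ENNReal.toReal _), ENNReal.ofReal_mul ENNReal.toReal_nonneg,
        ENNReal.ofReal_toReal (ENNReal.mul_ne_top ENNReal.ofReal_ne_top hM),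
        ENNReal.ofReal_mul (Finset.prod_nonneg fun _ _ => norm_nonneg _),
        ENNReal.ofReal_prod_of_nonneg fun _ _ => norm_nonneg _, ofReal_norm]
      congr 2
      exact Finset.prod_congr rfl fun j _ => (ofReal_norm (h j)).symm)
    (fun N n u d v l h t => by
      simp only [commsCoeff_apply]
      have h1 := hasDerivAt_comms n (fun j => (h j).1.toCT) (S N) (fun k => b N k * tpi k ^ n)
        u.1.toCT d.1.toCT v.derCT t
      have h2 := ((fc l).restrictScalars ℝ).hasFDerivAt.comp_hasDerivAt t h1
      have e : ∀ t : ℝ, (u + t • d).1.toCT = u.1.toCT + (t : ℂ) • d.1.toCT := fun t => by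
        rw [RSob.toCT_add hq1, RSob.toCT_smul hq1]
      simp only [e]
      refine h2.congr_deriv ?_
      -- The new direction appears innermost; moving it outermost puts it in the first slot, as
      -- `Fin.cons` requires.
      rw [comms_comm]
      simp only [comms, Fin.cons_zero, Fin.cons_succ, pow_succ, mul_assoc]
      rfl)
  have hconst : HasOrder (fun _ : ℤ => p 0) r := by
    refine ⟨‖p 0‖ + 1, by positivity, fun k => ?_⟩
    have : (1 : ℝ) ≤ (1 + (k : ℝ) ^ 2) ^ (r / 2) :=
      Real.one_le_rpow (by nlinarith [sq_nonneg (k : ℝ)]) (by linarith)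
    nlinarith [norm_nonneg (p 0)]
  -- The summand from p(0) is independent of u, and `T₀` is the conjugate of P - p(0).
  refine ⟨δ, hδ, fun u => multiplier hconst q + T₀ u, contDiffOn_const.add hT₀,
    fun u hu => ⟨hmem u hu, ?_⟩⟩
  intro v
  set D := difOf hq' u (hmem u hu) with hD
  obtain ⟨E, hDE⟩ := D.exists_inv
  obtain ⟨C, hC, hE⟩ := hinv u hu (hmem u hu) E hDE
  have hw0 : sobN q (E.rt v.toCT) ≠ ⊤ := by
    refine ne_top_of_le_ne_top ?_ (hE.sobN_rt_le (v.tsum_afc_toCT hq1))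
    rw [Sob.sobN_toCT hq1]
    exact ENNReal.mul_ne_top hC enorm_ne_top
  set w : Sob q := Sob.ofCT (E.rt v.toCT) hw0 with hwdef
  have hw : w.toCT = E.rt v.toCT := Sob.toCT_ofCT hq1 _ _
  have hDw : D.rt w.toCT = v.toCT := by rw [hw, hDE.rt_rt]
  have hwd : D.rt w.derCT * D.dC = v.derCT := by
    rw [Sob.derCT_eq_of_isDer hq' w (f' := E.rt v.derCT * E.dC)
      (by rw [hw]; exact E.isDer_rt (v.isDer_toCT hq')), hDE.rt_der]
  have hfix : ∀ x, D.toMap x = diffOfLift hq' ⟨u, hmem u hu⟩ x := fun x => rfl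
  have hs : 1 / 2 < q - r := by linarith
  set Q : CT := ofCoeff fun k => (p k - p 0) * w.coeff k with hQ
  have hsum : Summable fun k : ℤ => ‖(p k - p 0) * w.coeff k‖ := by
    have h1 := (multiplier hord q w).summable_coeff hs
    have h2 := (multiplier hconst q w).summable_coeff hs
    refine Summable.of_nonneg_of_le (fun k => norm_nonneg _) (fun k => ?_) (h1.add h2)
    rw [multiplier_coeff, multiplier_coeff, sub_mul]
    exact norm_sub_le _ _
  have hPw : (multiplier hord q w).toCT = p 0 • w.toCT + Q :=
    Sob.toCT_eq_of_fc hs _ fun k => by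
      rw [map_add, map_smul, hQ, fc_ofCoeff hsum, Sob.fc_toCT hq1, multiplier_coeff, smul_eq_mul]
      ring
  -- Dominated convergence of Fourier series: each coefficient is eventually exact, and the
  -- truncated symbols never exceed the full one.
  have hconv : Tendsto (fun N => conjOp (S N) (fun k => b N k * tpi k ^ 0) 0 w.derCT) atTop
      (𝓝 Q) := by
    have e : ∀ N, conjOp (S N) (fun k => b N k * tpi k ^ 0) 0 w.derCT
        = ofCoeff fun k => b N k * tpi k * w.coeff k := fun N => by
      have h0 : ∀ k ∉ S N, (b N k * tpi k * w.coeff k) • expo k = 0 := fun k hk => by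
        rw [hS N k hk, zero_mul, zero_mul]
        ext x
        simp
      rw [ofCoeff, tsum_eq_sum h0, conjOp_apply]
      refine Finset.sum_congr rfl fun k _ => ?_
      rw [expShift_zero, expShift_zero, ← fc_apply, Sob.fc_derCT hq', pow_zero, mul_one, mul_assoc]
    simp only [e]
    refine tendsto_tsum_of_dominated_convergence hsum (fun k => ?_)
      (Eventually.of_forall fun N k => ?_)
    · refine tendsto_const_nhds.congr' ?_
      filter_upwards [hb2 k] with N hN
      rw [hN]
    · rw [norm_smul, norm_expo, mul_one, norm_mul, norm_mul]
      have := hb4 N k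
      rw [norm_mul] at this ⊢
      exact mul_le_mul_of_nonneg_right this (norm_nonneg _)
  -- An ordinary limit is also a limit along the ultrafilter, which identifies the abstract limit
  -- with the conjugated operator.
  have hT₀v : (T₀ u v).toCT = D.rt Q := Sob.toCT_eq_of_fc hs _ fun l => by
    refine tendsto_nhds_unique ?_ (hlim u hu v l)
    have h1 := (((fc l).continuous.tendsto _).comp ((D.continuous_rt.tendsto Q).comp hconv)).mono_left
      (Nat.hyperfilter_le_atTop)
    refine h1.congr fun N => ?_
    have h2 := D.comms_rt (fun k => rt_expo_difOf hq' (hmem u hu) k) 0 (fun j => j.elim0) (S N)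
      (fun k => b N k * tpi k ^ 0) w.derCT
    rw [hwd] at h2
    simp only [comms] at h2
    rw [commsCoeff_apply]
    simp only [comms]
    rw [h2]
    rfl
  have hTv : ((multiplier hconst q + T₀ u) v).toCT = D.rt (multiplier hord q w).toCT := by
    have h1 : (multiplier hconst q v).toCT = p 0 • v.toCT := Sob.toCT_eq_of_fc hs _ fun k => by
      rw [map_smul, Sob.fc_toCT hq1, multiplier_coeff, smul_eq_mul]
    rw [add_apply, Sob.toCT_add hs, h1, hT₀v, hPw, D.rt_add, D.rt_smul, hDw]
  refine ⟨w, fun x => ?_, fun x => ?_⟩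
  · rw [← Sob.toCT_apply hq1, ← Sob.toCT_apply hq1, hw, Dif.rt_apply]
    congr 1
    have h1 := hDE.right x
    rw [hfix] at h1
    exact ((Equiv.symm_apply_eq _).2 h1.symm).symm
  · rw [← Sob.toCT_apply hs, ← Sob.toCT_apply hs, hTv, Dif.rt_apply, hfix]

end

end CircleSobolev

/-! ### Descent from lifts to charts of the diffeomorphism group. -/

theorem mainTheorem1 (r : ℝ) (hr : 1 ≤ r) (p : ℝ → ℂ)
    (hord : CircleSobolev.HasOrder (fun k : ℤ => p k) r)
    (hreg : ∀ n : ℕ, 1 ≤ n →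
      ContDiff ℝ ((n - 1 : ℕ) : ℕ∞) (fun ξ : ℝ => (ξ : ℂ) ^ (n - 1) * p ξ) ∧
      (∀ a b : ℝ, AbsolutelyContinuousOnInterval
        (iteratedDeriv (n - 1) (fun ξ : ℝ => (ξ : ℂ) ^ (n - 1) * p ξ)) a b) ∧
      ∃ C > 0, ∀ᵐ ξ : ℝ ∂MeasureTheory.volume,
        ‖iteratedDeriv n (fun ξ : ℝ => (ξ : ℂ) ^ (n - 1) * p ξ) ξ‖
          ≤ C * (1 + ξ ^ 2) ^ ((r - 1) / 2))
    (q : ℝ) (hq : 3 / 2 + r < q) :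
    ∃ Pc : CircleSobolev.DiffSob q (by linarith) →
        (CircleSobolev.Sob q →L[ℂ] CircleSobolev.Sob (q - r)),
      (∀ φ, CircleSobolev.IsConjugate (CircleSobolev.multiplier hord q) φ (Pc φ)) ∧
      ContMDiff 𝓘(ℝ, CircleSobolev.RSob q)
        𝓘(ℝ, CircleSobolev.Sob q →L[ℂ] CircleSobolev.Sob (q - r)) ∞ Pc := by
  have hq' : 3 / 2 < q := by linarith
  obtain ⟨b, hb1, hb2, hb3, hb4⟩ := CircleSobolev.exists_symbols hr hord hreg
  have hloc := fun (u₀ : CircleSobolev.RSob q) (hu₀ : u₀ ∈ CircleSobolev.diffLifts q) =>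
    CircleSobolev.exists_local_smooth hr hord hb1 hb2 hb3 hb4 hq hu₀
  have hex : ∀ φ : CircleSobolev.DiffSob q hq',
      ∃ T, CircleSobolev.IsConjugate (CircleSobolev.multiplier hord q) φ T := fun φ => by
    obtain ⟨u, rfl⟩ := CircleSobolev.diffOfLift_surjective hq' φ
    obtain ⟨δ, hδ, T, -, hT⟩ := hloc u.1 u.2
    obtain ⟨hu, h⟩ := hT u.1 (Metric.mem_ball_self hδ)
    exact ⟨T u.1, h⟩
  choose Pc hPc using hex
  refine ⟨Pc, hPc, fun φ => ?_⟩
  obtain ⟨v, hv, hvφ⟩ := CircleSobolev.chart_diffOfLift hq' _ (mem_chart_source (CircleSobolev.RSob q) φ)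
  obtain ⟨δ, hδ, T, hTs, hT⟩ := hloc v.1 v.2
  have hball : Metric.ball v.1 δ ∈ nhds v.1 := Metric.ball_mem_nhds _ hδ
  have h1 : ContDiffAt ℝ ∞ T v.1 := hTs.contDiffAt hball
  have hchart : (chartAt (CircleSobolev.RSob q) φ) φ = v.1 := hv.symm
  have h2 : ContMDiffAt 𝓘(ℝ, CircleSobolev.RSob q)
      𝓘(ℝ, CircleSobolev.Sob q →L[ℂ] CircleSobolev.Sob (q - r)) ∞
      (T ∘ extChartAt 𝓘(ℝ, CircleSobolev.RSob q) φ) φ := by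
    refine ContMDiffAt.comp φ ?_ contMDiffAt_extChartAt
    rw [show extChartAt 𝓘(ℝ, CircleSobolev.RSob q) φ φ = v.1 from hchart]
    exact h1.contMDiffAt
  refine h2.congr_of_eventuallyEq ?_
  have hc : ContinuousAt (chartAt (CircleSobolev.RSob q) φ) φ :=
    (chartAt (CircleSobolev.RSob q) φ).continuousAt (mem_chart_source _ φ)
  filter_upwards [(chartAt (CircleSobolev.RSob q) φ).open_source.mem_nhds (mem_chart_source _ φ),
    hc.preimage_mem_nhds (by rw [hchart]; exact hball)] with ψ hψ hψb
  obtain ⟨w, hw, hwψ⟩ := CircleSobolev.chart_diffOfLift hq' _ hψ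
  have hw2 : w.1 = (chartAt (CircleSobolev.RSob q) φ) ψ := hw
  obtain ⟨hu, h⟩ := hT w.1 (by rw [hw2]; exact hψb)
  -- Uniqueness of the conjugate makes the pointwise choice of `Pc` harmless and identifies it near
  -- φ with the local smooth map read in the chart.
  have h3 : Pc ψ = T w.1 := CircleSobolev.IsConjugate.unique (by linarith) (hPc ψ) (by
    rw [← hwψ]
    exact h)
  rw [h3, hw2]
  rfl
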